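/- Let $S$ be a finite set of places of $\mathbb Q$ containing $\infty$, and let $\lambda>0$. **Semilocal space.** Let $\mathbb A_S=\prod_{v\in S}\mathbb Q_v$ with its additive Haar measure ($\mathbb Z_p$ having measure $1$, and Lebesgue measure on $\mathbb R$), let $|x|_S=\prod_{v\in S}|x_v|_v$, let $\Gamma=\{\pm\prod_{p\in S\setminus\{\infty\}}p^{n_p}: n_p\in\mathbb Z\}$ and $\Gamma_+=\Gamma\cap\mathbb Q_{>0}$, and let $X_S=\mathbb A_S/\Gamma$, with the quotient measure (computed on the fundamental domain $\prod_p\mathbb Z_p^*\times\mathbb R_{>0}$). Let $K_S$ be the kernel of the module $|\cdot|_S$ on $\mathrm{GL}_1(\mathbb A_S)/\Gamma$, and $L^2(X_S)^{K_S}$ the space of $K_S$-invariant elements of $L^2(X_S)$. A function $\varphi$ on $\mathbb A_S$ with $\varphi(-x)=\varphi(x)$ has the class $x\mapsto\sum_{\gamma\in\Gamma_+}\varphi(\gamma x)$ on $X_S$; the class of a general $\varphi$ is half the sum over $\Gamma$. **Sonin spaces.** Let $\alpha$ be the additive character of $\mathbb A_S$ which is the product of $e_\infty(x)=e^{2\pi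 i x}$ and of the characters $e_p:\mathbb Q_p\to\mathbb Q_p/\mathbb Z_p\subset\mathbb Q/\mathbb Z\to\mathbb C$, the last map being $r\mapsto e^{2\pi i r}$. Let $\mathbb F_S$ be the continuous operator in $L^2(X_S)$ which sends the class of a Bruhat–Schwartz function $\varphi$ on $\mathbb A_S$ to the class of its Fourier transform $y\mapsto\int\varphi(x)\,\alpha(-xy)\,dx$. Set $$\mathbf S_\lambda(X_S,\alpha)=\{f\in L^2(X_S)^{K_S}:\ f(x)=0 \text{ and } \mathbb F_Sf(x)=0 \text{ for a.e. } x \text{ with } |x|_S<\lambda\},$$ and let $\mathbf S_\lambda(\mathbb R,e_\infty)$ be the space of the even $f\in L^2(\mathbb R)$ such that $f$ and its Fourier transform vanish almost everywhere on $|x|<\lambda$. For an even function $f$ on $\mathbb R$ let $\theta_S(f)$ be the class on $X_S$ of $\big(\bigotimes_{p}\sigma_p\big)\otimes f$, where $\sigma_p=\epsilon_0-\frac1p\epsilon_1$ and $\epsilon_n$ is the characteristic function of $\{x\in\mathbb Q_p:|x|=p^n\}$. **Dual Hardy–Titchmarsh transform.** Let $L_\infty(z)=\pi^{-z/2}\Gamma(z/2)$,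 $L_p(z)=(1-p^{-z})^{-1}$, $E_S(s)=\prod_{v\in S}L_v(\frac12+is)$ and $E_\infty(s)=L_\infty(\frac12+is)$. Define $$\upsilon_S:L^2(X_S)^{K_S}\to L^2\Big(\mathbb R,\tfrac{ds}{|E_S(s)|^2}\Big),\qquad \upsilon_S(f)(s)=E_S(s)\int_0^\infty f(1\times u)\,u^{\frac12-is}\,\frac{du}{u},$$ and, for even $f\in L^2(\mathbb R)$, $\upsilon_\infty(f)(s)=E_\infty(s)\int_0^\infty f(u)\,u^{\frac12-is}\frac{du}{u}$, both integrals being taken in the sense of the $L^2$ (Plancherel) Fourier transform of the group $\mathbb R_+^*$. **The space $\mathcal B_\lambda$.** Let $\mathcal B_\lambda$ be the space of entire functions which is the image of $\mathbf S_\lambda(\mathbb R,e_\infty)$ under $f\mapsto\check{\mathcal M}(f)$, where $\check{\mathcal M}(f)$ is the entire function given by $$\check{\mathcal M}(f)(z)=\pi^{-z/2}\,\Gamma\big(\tfrac z2\big)\int_0^\infty f(t)\,t^{1-z}\,\frac{dt}{t}\qquad(\operatorname{Re}z>\tfrac12),$$ with the inner product of $L^2\big(\mathbb R,\frac{ds}{|E_\infty(s)|^2}\big)$,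 in which $F\in\mathcal B_\lambda$ is identified with $s\mapsto F(\frac12+is)$. **Proposition.** $\mathcal B_\lambda$ is a Hilbert space, and $\upsilon_S$ is an isomorphism of hilbertian spaces (a linear homeomorphism) from $\mathbf S_\lambda(X_S,\alpha)$ onto $\mathcal B_\lambda$: there is a linear homeomorphism $\Phi:\mathbf S_\lambda(X_S,\alpha)\to\mathcal B_\lambda$ with $\Phi(h)(\frac12+is)=\upsilon_S(h)(s)$ for all $h\in\mathbf S_\lambda(X_S,\alpha)$ and almost all $s\in\mathbb R$. Moreover, for every $f\in\mathbf S_\lambda(\mathbb R,e_\infty)$ one has $\theta_S(f)\in\mathbf S_\lambda(X_S,\alpha)$, $\upsilon_S(\theta_S(f))=\upsilon_\infty(f)$, and the entire function $\Phi(\theta_S(f))$ is $\check{\mathcal M}(f)$. -/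

import Mathlib

open MeasureTheory FourierTransform SchwartzMap
open scoped ENNReal Topology

noncomputable section

namespace Semilocal

/-! ### The `p`-adic fields: Haar measure and additive character -/

instance factPrime (p : Nat.Primes) : Fact (p : ℕ).Prime := ⟨p.2⟩

instance padicMeasurableSpace (p : ℕ) [Fact p.Prime] : MeasurableSpace ℚ_[p] := borel _

instance padicBorelSpace (p : ℕ) [Fact p.Prime] : BorelSpace ℚ_[p] := ⟨rfl⟩

/-- The ring `ℤ_p ⊆ ℚ_p`, as a compact set with non-empty interior. -/
def padicUnitBall (p : ℕ) [Fact p.Prime] : TopologicalSpace.PositiveCompacts ℚ_[p] where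
  carrier := Metric.closedBall 0 1
  isCompact' := isCompact_closedBall 0 1
  interior_nonempty' :=
    ⟨0, mem_interior_iff_mem_nhds.2 (Metric.closedBall_mem_nhds 0 one_pos)⟩

/-- The additive Haar measure of `ℚ_p`, normalized by `vol(ℤ_p) = 1`. -/
def padicHaar (p : ℕ) [Fact p.Prime] : Measure ℚ_[p] := Measure.addHaarMeasure (padicUnitBall p)

instance padicHaar_isAddHaar (p : ℕ) [Fact p.Prime] : (padicHaar p).IsAddHaarMeasure := by
  unfold padicHaar
  infer_instance

/-- Every `p`-adic number is congruent modulo `ℤ_p` to some `a / p ^ n`. -/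
theorem exists_padic_frac (p : ℕ) [Fact p.Prime] (x : ℚ_[p]) :
    ∃ r : ℚ, (∃ (a : ℤ) (n : ℕ), r = a / (p : ℚ) ^ n) ∧ ‖x - (r : ℚ_[p])‖ ≤ 1 := by
  have hp : (1 : ℝ) < p := by exact_mod_cast (Fact.out : p.Prime).one_lt
  have hp0 : (p : ℚ_[p]) ≠ 0 := by exact_mod_cast (Fact.out : p.Prime).ne_zero
  obtain ⟨n, hn⟩ := pow_unbounded_of_one_lt ‖x‖ hp
  have hpn : ‖(p : ℚ_[p]) ^ n‖ = ((p : ℝ) ^ n)⁻¹ := by simp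
  have hpos : (0 : ℝ) < (p : ℝ) ^ n := by positivity
  have hy : ‖x * (p : ℚ_[p]) ^ n‖ ≤ 1 := by
    rw [norm_mul, hpn, ← div_eq_mul_inv, div_le_one hpos]
    exact hn.le
  let y : ℤ_[p] := ⟨x * (p : ℚ_[p]) ^ n, hy⟩
  have h2 := (PadicInt.norm_le_pow_iff_mem_span_pow (y - (y.appr n : ℤ_[p])) n).2 (y.appr_spec n)
  refine ⟨((y.appr n : ℤ) : ℚ) / (p : ℚ) ^ n, ⟨_, _, rfl⟩, ?_⟩
  have h3 : x - ((((y.appr n : ℤ) : ℚ) / (p : ℚ) ^ n : ℚ) : ℚ_[p])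
      = ((y - (y.appr n : ℤ_[p]) : ℤ_[p]) : ℚ_[p]) / (p : ℚ_[p]) ^ n := by
    push_cast
    rw [sub_div]
    congr 1
    exact (mul_div_cancel_right₀ x (pow_ne_zero n hp0)).symm
  rw [h3, norm_div, hpn, div_inv_eq_mul]
  have h4 : ‖((y - (y.appr n : ℤ_[p]) : ℤ_[p]) : ℚ_[p])‖ ≤ (p : ℝ) ^ (-n : ℤ) := h2
  calc _ ≤ (p : ℝ) ^ (-n : ℤ) * (p : ℝ) ^ n := by gcongr
    _ = 1 := by
      rw [zpow_neg, zpow_natCast]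
      exact inv_mul_cancel₀ hpos.ne'

/-- The character `e_p : ℚ_p → ℚ_p / ℤ_p ⊆ ℚ / ℤ → ℂ`, the last map being `r ↦ exp (2πir)`. -/
def padicChar (p : ℕ) [Fact p.Prime] (x : ℚ_[p]) : ℂ :=
  Complex.exp (2 * Real.pi * Complex.I * ((exists_padic_frac p x).choose : ℂ))

/-! ### The semilocal adele class space

A finite set of places containing `∞` is given by the finite set `S` of its finite places. -/

variable (S : Finset Nat.Primes)

/-- The ring `𝔸_S = ∏_{v ∈ S} ℚ_v`, the real place being the last factor. -/
abbrev Adele : Type := (∀ p : S, ℚ_[(p : Nat.Primes)]) × ℝ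

/-- The additive Haar measure of `𝔸_S`. -/
def adeleHaar : Measure (Adele S) :=
  (Measure.pi fun p : S => padicHaar (p : Nat.Primes)).prod volume

/-- The character `α` of `𝔸_S`: the product of the `e_p` and of `e_∞ (x) = exp (2πix)`. -/
def adeleChar (x : Adele S) : ℂ :=
  (∏ p : S, padicChar (p : Nat.Primes) (x.1 p)) * Complex.exp (2 * Real.pi * Complex.I * x.2)

/-- The group `Γ` of the rational numbers `± ∏_{p ∈ S} p ^ {n_p}`, i.e. of the rational numbers
which are units at all the primes outside `S`. -/
def Gam : Subgroup ℚˣ where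
  carrier := {q | ∀ p : Nat.Primes, p ∉ S → ‖(((q : ℚˣ) : ℚ) : ℚ_[p])‖ = 1}
  one_mem' := by intro p _; simp
  mul_mem' := by
    intro a b ha hb p hp
    simp [ha p hp, hb p hp]
  inv_mem' := by
    intro a ha p hp
    simp [ha p hp]

/-- `X_S = 𝔸_S / Γ`, where `Γ` acts by multiplication (diagonally). -/
abbrev XS : Type := Quotient (MulAction.orbitRel (Gam S) (Adele S))

/-- The projection `π_S : 𝔸_S → X_S`. -/
def proj (x : Adele S) : XS S := Quotient.mk _ x

/-- The module `|(u_v)|_S = ∏_{v ∈ S} |u_v|_v` on `𝔸_S`. -/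
def adeleMod (x : Adele S) : ℝ := (∏ p : S, ‖x.1 p‖) * |x.2|

theorem nat_mul_prod_padicNorm (n : ℕ) (hn : n ≠ 0) (T : Finset Nat.Primes)
    (hT : ∀ p : Nat.Primes, p ∉ T → ‖((n : ℚ) : ℚ_[p])‖ = 1) :
    (∏ p ∈ T, ‖((n : ℚ) : ℚ_[p])‖) * (n : ℝ) = 1 := by
  have hkey : ∀ p : Nat.Primes,
      ‖((n : ℚ) : ℚ_[p])‖ = (((p : ℕ) ^ n.factorization p : ℕ) : ℝ)⁻¹ := by
    intro p
    have h := Padic.norm_eq_zpow_neg_valuation (p := (p : ℕ)) (x := ((n : ℚ) : ℚ_[p]))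
      (by exact_mod_cast hn)
    rw [h]
    simp [Nat.factorization_def n p.2]
  have hsub : ∀ p : Nat.Primes, p ∉ T → n.factorization p = 0 := by
    intro p hp
    have h := hT p hp
    rw [hkey p, inv_eq_one] at h
    have h' : (p : ℕ) ^ n.factorization p = 1 := by exact_mod_cast h
    rcases Nat.pow_eq_one.1 h' with h1 | h1
    · exact absurd h1 p.2.one_lt.ne'
    · exact h1
  have hprod : ∏ p ∈ T, (p : ℕ) ^ n.factorization p = n := by
    conv_rhs => rw [← Nat.prod_factorization_pow_eq_self hn]
    rw [Finsupp.prod]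
    symm
    have himg : ∏ q ∈ T.image (fun p : Nat.Primes => (p : ℕ)), q ^ n.factorization q
        = ∏ p ∈ T, (p : ℕ) ^ n.factorization p :=
      Finset.prod_image (fun a _ b _ h => Nat.Primes.coe_nat_injective h)
    rw [← himg]
    apply Finset.prod_subset
    · intro q hq
      have hq' : q.Prime := Nat.prime_of_mem_primeFactors (by simpa using hq)
      rw [Finset.mem_image]
      refine ⟨⟨q, hq'⟩, ?_, rfl⟩
      by_contra hcon
      exact (Finsupp.mem_support_iff.1 hq) (hsub ⟨q, hq'⟩ hcon)
    · intro q _ hq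
      simp [Finsupp.notMem_support_iff.1 hq]
  have h1 : (∏ p ∈ T, ‖((n : ℚ) : ℚ_[p])‖) = (n : ℝ)⁻¹ := by
    rw [Finset.prod_congr rfl (fun p _ => hkey p), Finset.prod_inv_distrib, ← Nat.cast_prod, hprod]
  rw [h1]
  exact inv_mul_cancel₀ (by exact_mod_cast hn)

/-- The product formula for the elements of `Γ`. -/
theorem gam_prod_norm (q : Gam S) :
    (∏ p : S, ‖(((q : ℚˣ) : ℚ) : ℚ_[(p : Nat.Primes)])‖) * |(((q : ℚˣ) : ℚ) : ℝ)| = 1 := by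
  obtain ⟨q, hq⟩ := q
  change (∏ p : S, ‖((q : ℚ) : ℚ_[(p : Nat.Primes)])‖) * |((q : ℚ) : ℝ)| = 1
  have hq1 : ∀ p : Nat.Primes, p ∉ S → ‖((q : ℚ) : ℚ_[p])‖ = 1 := hq
  generalize hr : (q : ℚ) = r at *
  have hr0 : r ≠ 0 := by rw [← hr]; exact q.ne_zero
  have hnum0 : r.num.natAbs ≠ 0 := by simpa using hr0
  have hnumn : ∀ p : Nat.Primes,
      ‖((r.num.natAbs : ℚ) : ℚ_[p])‖ = ‖((r.num : ℤ) : ℚ_[p])‖ := by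
    intro p
    rcases Int.natAbs_eq r.num with h | h
    · conv_rhs => rw [h]
      rw [Rat.cast_natCast, Int.cast_natCast]
    · conv_rhs => rw [h]
      rw [Rat.cast_natCast, Int.cast_neg, Int.cast_natCast, norm_neg]
  have hdiv : ∀ p : Nat.Primes,
      ‖((r : ℚ) : ℚ_[p])‖ = ‖((r.num.natAbs : ℚ) : ℚ_[p])‖ / ‖((r.den : ℚ) : ℚ_[p])‖ := by
    intro p
    rw [hnumn p, ← norm_div]
    congr 1
    conv_lhs => rw [← Rat.num_div_den r]
    push_cast
    rfl
  have hcop : ∀ p : Nat.Primes, p ∉ S →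
      ‖((r.num.natAbs : ℚ) : ℚ_[p])‖ = 1 ∧ ‖((r.den : ℚ) : ℚ_[p])‖ = 1 := by
    intro p hp
    have h1 := hq1 p hp
    rw [hdiv p] at h1
    have hd0 : ‖((r.den : ℚ) : ℚ_[p])‖ ≠ 0 := by simp
    have heq := (div_eq_one_iff_eq hd0).1 h1
    suffices h : ‖((r.den : ℚ) : ℚ_[p])‖ = 1 from ⟨heq.trans h, h⟩
    by_contra hne
    have hd : (p : ℕ) ∣ r.den := by
      by_contra hnd
      apply hne
      rw [Rat.cast_natCast]
      exact (Padic.norm_natCast_eq_one_iff).2 ((p.2.coprime_iff_not_dvd).2 hnd)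
    have hn : (p : ℕ) ∣ r.num.natAbs := by
      by_contra hnd
      apply hne
      rw [← heq, Rat.cast_natCast]
      exact (Padic.norm_natCast_eq_one_iff).2 ((p.2.coprime_iff_not_dvd).2 hnd)
    exact Nat.not_coprime_of_dvd_of_dvd p.2.one_lt hn hd r.reduced
  have hA := nat_mul_prod_padicNorm r.num.natAbs hnum0 S (fun p hp => (hcop p hp).1)
  have hB := nat_mul_prod_padicNorm r.den r.den_nz S (fun p hp => (hcop p hp).2)
  have habs : |(r : ℝ)| = (r.num.natAbs : ℝ) / r.den := by
    rw [Rat.cast_def, abs_div, Nat.abs_cast, Nat.cast_natAbs, Int.cast_abs]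
  have hS : (∏ p : S, ‖((r : ℚ) : ℚ_[(p : Nat.Primes)])‖)
      = ∏ p ∈ S, ‖((r : ℚ) : ℚ_[p])‖ :=
    Finset.prod_coe_sort S (fun p : Nat.Primes => ‖((r : ℚ) : ℚ_[p])‖)
  rw [hS, Finset.prod_congr rfl (fun p _ => hdiv p), Finset.prod_div_distrib, habs,
    div_mul_div_comm, hA, hB, div_one]

theorem adeleMod_smul (q : Gam S) (x : Adele S) : adeleMod S (q • x) = adeleMod S x := by
  have h1 : ∀ p : S, (q • x).1 p = (((q : ℚˣ) : ℚ) : ℚ_[(p : Nat.Primes)]) * x.1 p := by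
    intro p
    change ((q : ℚˣ) : ℚ) • x.1 p = _
    rw [Rat.smul_def]
  have h2 : (q • x).2 = (((q : ℚˣ) : ℚ) : ℝ) * x.2 := by
    change ((q : ℚˣ) : ℚ) • x.2 = _
    rw [Rat.smul_def]
  unfold adeleMod
  rw [h2, Finset.prod_congr rfl (fun p _ => by rw [h1 p, norm_mul]), Finset.prod_mul_distrib,
    abs_mul, mul_mul_mul_comm, gam_prod_norm, one_mul]

/-- The module on `X_S`. -/
def modX : XS S → ℝ :=
  Quotient.lift (adeleMod S) (by
    rintro a b ⟨q, rfl⟩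
    exact adeleMod_smul S q b)

/-- The set `R_S^* × ℝ_+^*`: it meets the orbit of every invertible element of `𝔸_S` in exactly one
point, and the complement of `GL₁(𝔸_S)` is a null set. -/
def fundDom : Set (Adele S) :=
  (Set.univ.pi fun p : S => Metric.sphere (0 : ℚ_[(p : Nat.Primes)]) 1) ×ˢ Set.Ioi (0 : ℝ)

/-- The measure of `X_S` induced by the (`Γ`-invariant) additive Haar measure of `𝔸_S`: the image
of its restriction to a fundamental domain. -/
def muX : Measure (XS S) := ((adeleHaar S).restrict (fundDom S)).map (proj S)

/-- The Hilbert space `L²(X_S)`. -/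
abbrev L2X : Type := Lp ℂ 2 (muX S)

/-- `L²(X_S)^{K_S}`, where `K_S` is the group of the classes of the `u ∈ GL₁(𝔸_S)` with `|u|_S = 1`:
the elements of `L²(X_S)` which have a `K_S`-invariant representative. -/
def L2Xinv : Submodule ℂ (L2X S) where
  carrier := {f | ∃ g : XS S → ℂ, f =ᵐ[muX S] g ∧
    ∀ u : (Adele S)ˣ, adeleMod S u = 1 → ∀ x : Adele S, g (proj S (u * x)) = g (proj S x)}
  zero_mem' := ⟨0, Lp.coeFn_zero _ _ _, fun _ _ _ => rfl⟩
  add_mem' := by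
    rintro f₁ f₂ ⟨g₁, h₁, k₁⟩ ⟨g₂, h₂, k₂⟩
    refine ⟨g₁ + g₂, (Lp.coeFn_add f₁ f₂).trans (h₁.add h₂), fun u hu x => ?_⟩
    simp [k₁ u hu x, k₂ u hu x]
  smul_mem' := by
    rintro c f ⟨g, h, k⟩
    refine ⟨c • g, (Lp.coeFn_smul c f).trans (h.const_smul c), fun u hu x => ?_⟩
    simp [k u hu x]

/-- The class on `X_S` of a function on `𝔸_S`: the sum of its values over the orbit,
`x ↦ ∑_{γ ∈ Γ_+} φ (γ x)` for a function `φ` with `φ (-x) = φ x`, where `Γ_+` is the group of the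
positive elements of `Γ`. (As `Γ = {±1} × Γ_+`, this is half the sum over `Γ`.) -/
def classX (φ : Adele S → ℂ) : XS S → ℂ :=
  Quotient.lift (fun x => (1 / 2 : ℂ) * ∑' q : Gam S, φ (q • x)) (by
    rintro a b ⟨q, rfl⟩
    simp only [smul_smul]
    congr 1
    exact (Equiv.mulRight q).tsum_eq (fun r : Gam S => φ (r • b)))

/-! ### The Fourier transform and the Sonin space -/

/-- The Fourier transform of an integrable function on `𝔸_S` with respect to the character `α`; for
a product function it is the product of the local Fourier transforms. -/
def adeleFourier (φ : Adele S → ℂ) (y : Adele S) : ℂ :=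
  ∫ x, φ x * adeleChar S (-(x * y)) ∂(adeleHaar S)

/-- The products of a locally constant function with compact support on `∏_p ℚ_p` and a Schwartz
function on `ℝ`. They span the Bruhat–Schwartz space of `𝔸_S`. -/
def IsBruhatSchwartz (φ : Adele S → ℂ) : Prop :=
  ∃ (ψ : (∀ p : S, ℚ_[(p : Nat.Primes)]) → ℂ) (g : 𝓢(ℝ, ℂ)),
    IsLocallyConstant ψ ∧ HasCompactSupport ψ ∧ φ = fun x => ψ x.1 * g x.2

/-- The graph of the Fourier transform `𝔽_S` of `L²(X_S)`, the continuous operator which sends the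
class of a Bruhat–Schwartz function on `𝔸_S` to the class of its Fourier transform: the closure of
the linear span of the pairs formed by these two classes. -/
def fourierGraph : Submodule ℂ (L2X S × L2X S) :=
  (Submodule.span ℂ {P : L2X S × L2X S | ∃ φ : Adele S → ℂ, IsBruhatSchwartz S φ ∧
    P.1 =ᵐ[muX S] classX S φ ∧ P.2 =ᵐ[muX S] classX S (adeleFourier S φ)}).topologicalClosure

/-- The elements of `L²(X_S)` which vanish (almost everywhere) on `|x|_S < λ`. -/
def vanishX (lam : ℝ) : Submodule ℂ (L2X S) where
  carrier := {f | ∀ᵐ x ∂(muX S), modX S x < lam → f x = 0}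
  zero_mem' := by
    filter_upwards [Lp.coeFn_zero ℂ 2 (muX S)] with x hx _
    rw [hx, Pi.zero_apply]
  add_mem' := by
    intro f g hf hg
    filter_upwards [hf, hg, Lp.coeFn_add f g] with x h1 h2 h3 hx
    rw [h3, Pi.add_apply, h1 hx, h2 hx, add_zero]
  smul_mem' := by
    intro c f hf
    filter_upwards [hf, Lp.coeFn_smul c f] with x h1 h3 hx
    rw [h3, Pi.smul_apply, h1 hx, smul_zero]

/-- The semilocal Sonin space `𝐒_λ(X_S, α)`: the `f ∈ L²(X_S)^{K_S}` such that `f` and `𝔽_S f`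
vanish on `|x|_S < λ`. -/
def soninX (lam : ℝ) : Submodule ℂ (L2Xinv S) where
  carrier := {f | (f : L2X S) ∈ vanishX S lam ∧
    ∃ g : L2X S, ((f : L2X S), g) ∈ fourierGraph S ∧ g ∈ vanishX S lam}
  zero_mem' := ⟨Submodule.zero_mem _, 0, Submodule.zero_mem _, Submodule.zero_mem _⟩
  add_mem' := by
    rintro f₁ f₂ ⟨h₁, g₁, k₁, l₁⟩ ⟨h₂, g₂, k₂, l₂⟩
    exact ⟨Submodule.add_mem _ h₁ h₂, g₁ + g₂, Submodule.add_mem _ k₁ k₂,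
      Submodule.add_mem _ l₁ l₂⟩
  smul_mem' := by
    rintro c f ⟨h, g, k, l⟩
    exact ⟨Submodule.smul_mem _ c h, c • g, Submodule.smul_mem _ c k, Submodule.smul_mem _ c l⟩

/-- `𝐒_λ(ℝ, e_∞)`: the even `f ∈ L²(ℝ)` such that `f` and its Fourier transform
`y ↦ ∫ f(x) exp(-2πixy) dx` vanish on `|x| < λ`. -/
def soninR (lam : ℝ) : Submodule ℂ (Lp ℂ 2 (volume : Measure ℝ)) where
  carrier := {f | (∀ᵐ x : ℝ, f (-x) = f x) ∧ (∀ᵐ x : ℝ, |x| < lam → f x = 0) ∧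
    ∀ᵐ x : ℝ, |x| < lam → (𝓕 f : Lp ℂ 2 (volume : Measure ℝ)) x = 0}
  zero_mem' := by
    have h0 := Lp.coeFn_zero ℂ 2 (volume : Measure ℝ)
    have hF : (𝓕 (0 : Lp ℂ 2 (volume : Measure ℝ)) : Lp ℂ 2 (volume : Measure ℝ)) = 0 :=
      (Lp.fourierTransformₗᵢ ℝ ℂ).map_zero
    refine ⟨?_, ?_, ?_⟩
    · filter_upwards [h0, (Measure.measurePreserving_neg volume).quasiMeasurePreserving.ae h0]
        with x h1 h2
      simp only [h1, h2, Pi.zero_apply]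
    · filter_upwards [h0] with x h1 _
      rw [h1, Pi.zero_apply]
    · rw [hF]
      filter_upwards [h0] with x h1 _
      rw [h1, Pi.zero_apply]
  add_mem' := by
    rintro f g ⟨f1, f2, f3⟩ ⟨g1, g2, g3⟩
    have h0 := Lp.coeFn_add f g
    refine ⟨?_, ?_, ?_⟩
    · filter_upwards [f1, g1, h0,
        (Measure.measurePreserving_neg volume).quasiMeasurePreserving.ae h0] with x a b h1 h2
      simp only [h1, h2, Pi.add_apply, a, b]
    · filter_upwards [f2, g2, h0] with x a b h1 hx
      rw [h1, Pi.add_apply, a hx, b hx, add_zero]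
    · rw [FourierTransform.fourier_add]
      filter_upwards [f3, g3, Lp.coeFn_add (𝓕 f : Lp ℂ 2 (volume : Measure ℝ)) (𝓕 g)]
        with x a b h1 hx
      rw [h1, Pi.add_apply, a hx, b hx, add_zero]
  smul_mem' := by
    rintro c f ⟨f1, f2, f3⟩
    have h0 := Lp.coeFn_smul c f
    refine ⟨?_, ?_, ?_⟩
    · filter_upwards [f1, h0,
        (Measure.measurePreserving_neg volume).quasiMeasurePreserving.ae h0] with x a h1 h2
      simp only [h1, h2, Pi.smul_apply, a]
    · filter_upwards [f2, h0] with x a h1 hx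
      rw [h1, Pi.smul_apply, a hx, smul_zero]
    · rw [FourierTransform.fourier_smul]
      filter_upwards [f3, Lp.coeFn_smul c (𝓕 f : Lp ℂ 2 (volume : Measure ℝ))] with x a h1 hx
      rw [h1, Pi.smul_apply, a hx, smul_zero]

/-- `σ_p = ε_0 - p⁻¹ ε_1`, where `ε_n` is the characteristic function of `|x| = p ^ n`. -/
def sigmaP (p : ℕ) [Fact p.Prime] (x : ℚ_[p]) : ℂ :=
  (Metric.sphere (0 : ℚ_[p]) 1).indicator 1 x
    - (p : ℂ)⁻¹ * (Metric.sphere (0 : ℚ_[p]) (p : ℝ)).indicator 1 x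

/-- `θ_S (f)`: the class on `X_S` of the function `(⨂_p σ_p) ⊗ f` (for an even function `f`). -/
def theta (f : ℝ → ℂ) : XS S → ℂ :=
  classX S fun x => (∏ p : S, sigmaP (p : Nat.Primes) (x.1 p)) * f x.2

/-! ### The dual Hardy–Titchmarsh transform -/

/-- The Haar measure `d^*u = du / u` of `ℝ_+^*`. -/
def dStar : Measure ℝ :=
  (volume.restrict (Set.Ioi (0 : ℝ))).withDensity fun u => ENNReal.ofReal u⁻¹

theorem measurable_dStar_density : Measurable fun u : ℝ => ENNReal.ofReal u⁻¹ :=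
  measurable_inv.ennreal_ofReal

theorem memLp_rpow_half_mul {φ : ℝ → ℂ} (h : MemLp φ 2 (volume.restrict (Set.Ioi (0 : ℝ)))) :
    MemLp (fun u : ℝ => ((u ^ (1 / 2 : ℝ) : ℝ) : ℂ) * φ u) 2 dStar := by
  have hm : AEStronglyMeasurable (fun u : ℝ => ((u ^ (1 / 2 : ℝ) : ℝ) : ℂ) * φ u)
      (volume.restrict (Set.Ioi (0 : ℝ))) := by
    refine AEStronglyMeasurable.mul (Measurable.aestronglyMeasurable ?_) h.1
    fun_prop
  have hm' : AEStronglyMeasurable (fun u : ℝ => ((u ^ (1 / 2 : ℝ) : ℝ) : ℂ) * φ u) dStar :=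
    hm.mono_ac (withDensity_absolutelyContinuous _ _)
  rw [memLp_two_iff_integrable_sq_norm hm', dStar,
    integrable_withDensity_iff_integrable_smul' measurable_dStar_density
      (Filter.Eventually.of_forall fun _ => ENNReal.ofReal_lt_top)]
  have hf := (memLp_two_iff_integrable_sq_norm h.1).1 h
  refine hf.congr ?_
  filter_upwards [ae_restrict_mem measurableSet_Ioi] with u hu
  have hu0 : (0 : ℝ) < u := hu
  rw [ENNReal.toReal_ofReal (by positivity), norm_mul, smul_eq_mul, mul_pow, Complex.norm_real,
    Real.norm_eq_abs, sq_abs, ← Real.sqrt_eq_rpow, Real.sq_sqrt hu0.le,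
    inv_mul_cancel_left₀ hu0.ne']

theorem memLp_comp_exp {g : ℝ → ℂ} (h : MemLp g 2 dStar) :
    MemLp (fun τ : ℝ => g (Real.exp (2 * Real.pi * τ))) 2 volume := by
  have hpi : (0 : ℝ) < 2 * Real.pi := by positivity
  let e : ℝ → ℝ := fun τ => Real.exp (2 * Real.pi * τ)
  have hder : ∀ τ ∈ (Set.univ : Set ℝ), HasDerivWithinAt e (e τ * (2 * Real.pi)) Set.univ τ := by
    intro τ _
    have h1 : HasDerivAt (fun τ : ℝ => 2 * Real.pi * τ) (2 * Real.pi) τ := by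
      simpa using (hasDerivAt_id τ).const_mul (2 * Real.pi)
    exact h1.exp.hasDerivWithinAt
  have hinj : Set.InjOn e Set.univ := by
    intro a _ b _ hab
    have := Real.exp_injective hab
    exact mul_left_cancel₀ hpi.ne' this
  have himg : e '' Set.univ = Set.Ioi 0 := by
    ext u
    constructor
    · rintro ⟨τ, -, rfl⟩
      exact Real.exp_pos _
    · intro hu
      refine ⟨Real.log u / (2 * Real.pi), Set.mem_univ _, ?_⟩
      simp only [e]
      rw [mul_div_cancel₀ _ hpi.ne', Real.exp_log hu]
  have hac : volume.restrict (Set.Ioi (0 : ℝ)) ≪ dStar := by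
    refine withDensity_absolutelyContinuous' measurable_dStar_density.aemeasurable ?_
    filter_upwards [ae_restrict_mem measurableSet_Ioi] with u hu
    have hu0 : (0 : ℝ) < u := hu
    rw [Ne, ENNReal.ofReal_eq_zero, not_le]
    positivity
  have hme : Measurable e := by
    have : Continuous e := by fun_prop
    exact this.measurable
  have hqmp : Measure.QuasiMeasurePreserving e volume (volume.restrict (Set.Ioi (0 : ℝ))) := by
    refine ⟨hme, Measure.AbsolutelyContinuous.mk fun s hs h0 => ?_⟩
    rw [Measure.restrict_apply hs] at h0
    rw [Measure.map_apply hme hs]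
    have h1 := lintegral_image_eq_lintegral_abs_deriv_mul (s := e ⁻¹' s) (f := e)
      (hme hs) (fun τ _ => (hder τ trivial).mono (Set.subset_univ _))
      (hinj.mono (Set.subset_univ _)) (fun _ => 1)
    have h2 : e '' (e ⁻¹' s) = s ∩ Set.Ioi 0 := by
      rw [Set.image_preimage_eq_inter_range, ← Set.image_univ, himg]
    rw [h2, setLIntegral_one, h0] at h1
    have h3 := (lintegral_eq_zero_iff (by fun_prop)).1 h1.symm
    rw [Filter.EventuallyEq, ae_restrict_iff' (hme hs)] at h3
    have h4 : ∀ᵐ τ : ℝ, τ ∉ e ⁻¹' s := by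
      filter_upwards [h3] with τ h5 h6
      have h7 := h5 h6
      have h8 : 0 < |e τ * (2 * Real.pi)| := abs_pos.2 (mul_pos (Real.exp_pos _) hpi).ne'
      simp only [mul_one, Pi.zero_apply, ENNReal.ofReal_eq_zero] at h7
      exact absurd h7 (not_le.2 h8)
    exact measure_eq_zero_iff_ae_notMem.2 h4
  have hgm : AEStronglyMeasurable g (volume.restrict (Set.Ioi (0 : ℝ))) := h.1.mono_ac hac
  have hm : AEStronglyMeasurable (fun τ : ℝ => g (e τ)) volume :=
    hgm.comp_quasiMeasurePreserving hqmp
  have hI := (memLp_two_iff_integrable_sq_norm h.1).1 h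
  rw [dStar, integrable_withDensity_iff_integrable_smul' measurable_dStar_density
      (Filter.Eventually.of_forall fun _ => ENNReal.ofReal_lt_top)] at hI
  have hI2 : IntegrableOn (fun u : ℝ => (ENNReal.ofReal u⁻¹).toReal • ‖g u‖ ^ 2)
      (e '' Set.univ) := by
    rw [himg]
    exact hI
  rw [integrableOn_image_iff_integrableOn_abs_deriv_smul MeasurableSet.univ hder hinj,
    integrableOn_univ] at hI2
  change MemLp (fun τ : ℝ => g (e τ)) 2 volume
  rw [memLp_two_iff_integrable_sq_norm hm]
  refine (hI2.const_mul (2 * Real.pi)⁻¹).congr (Filter.Eventually.of_forall fun τ => ?_)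
  have he : 0 < e τ := Real.exp_pos _
  simp only [smul_eq_mul]
  rw [ENNReal.toReal_ofReal (by positivity), abs_of_pos (by positivity)]
  field_simp

/-- The multiplicative Fourier transform `𝔽_μ : L²(ℝ_+^*, d^*u) → L²(ℝ)`,
`𝔽_μ (g)(s) = ∫_0^∞ g(u) u^{-is} d^*u`. The substitution `u = exp (2πτ)` turns it into `2π` times
the Fourier transform of `τ ↦ g (exp (2πτ))`, and defines it on the whole of `L²`. -/
def mulFourier (g : ℝ → ℂ) (h : MemLp g 2 dStar) : Lp ℂ 2 (volume : Measure ℝ) :=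
  ((2 * Real.pi : ℝ) : ℂ) • 𝓕 (memLp_comp_exp h).toLp

/-- The function `u ↦ f (1 × u)` on `ℝ_+^*`, for `f ∈ L²(X_S)^{K_S}`: the value is that of a
`K_S`-invariant representative (two of these agree at `1 × u` for almost every `u`). -/
def radial (f : L2Xinv S) (u : ℝ) : ℂ := f.2.choose (proj S (1, u))

theorem radial_eq (f : L2Xinv S) {x : Adele S} (hx : x ∈ fundDom S) :
    f.2.choose (proj S x) = radial S f x.2 := by
  have hx1 : ∀ p : S, ‖x.1 p‖ = 1 := fun p => by
    have := hx.1 p (Set.mem_univ p)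
    simpa using this
  have hne : ∀ p : S, x.1 p ≠ 0 := fun p => norm_ne_zero_iff.1 (by rw [hx1 p]; exact one_ne_zero)
  let u : (Adele S)ˣ :=
    ⟨(x.1, 1), (fun p => (x.1 p)⁻¹, 1),
      Prod.ext (funext fun p => mul_inv_cancel₀ (hne p)) (one_mul 1),
      Prod.ext (funext fun p => inv_mul_cancel₀ (hne p)) (one_mul 1)⟩
  have hu : adeleMod S u = 1 := by
    change (∏ p : S, ‖x.1 p‖) * |(1 : ℝ)| = 1
    simp [hx1]
  have h := f.2.choose_spec.2 u hu (1, x.2)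
  have hux : (u : Adele S) * (1, x.2) = x :=
    Prod.ext (mul_one x.1) (one_mul x.2)
  rw [hux] at h
  exact h

theorem memLp_radial (f : L2Xinv S) : MemLp (radial S f) 2 (volume.restrict (Set.Ioi (0 : ℝ))) := by
  let ν := (Measure.pi fun p : S => padicHaar (p : Nat.Primes)).restrict
    (Set.univ.pi fun p : S => Metric.sphere (0 : ℚ_[(p : Nat.Primes)]) 1)
  let τ := (volume : Measure ℝ).restrict (Set.Ioi 0)
  have hrestr : (adeleHaar S).restrict (fundDom S) = ν.prod τ :=
    (Measure.prod_restrict _ _).symm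
  have hν : ν ≠ 0 := by
    rw [Ne, Measure.restrict_eq_zero, Measure.pi_pi, Finset.prod_eq_zero_iff]
    rintro ⟨p, -, hp⟩
    refine (IsOpen.measure_pos (padicHaar (p : Nat.Primes))
      (IsUltrametricDist.isOpen_sphere (0 : ℚ_[(p : Nat.Primes)]) one_ne_zero)
      ⟨1, by simp⟩).ne' hp
  have hpm : Measurable (proj S) := fun s hs => hs
  have hmap : muX S = (ν.prod τ).map (proj S) := by rw [muX, hrestr]
  have hfm : MemLp (f : L2X S) 2 ((ν.prod τ).map (proj S)) := by
    rw [← hmap]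
    exact Lp.memLp _
  have h1 : MemLp ((f : L2X S) ∘ proj S) 2 (ν.prod τ) :=
    (memLp_map_measure_iff hfm.1 hpm.aemeasurable).1 hfm
  have h2 : (f : L2X S) ∘ proj S =ᵐ[ν.prod τ] f.2.choose ∘ proj S := by
    have h := f.2.choose_spec.1
    exact ae_eq_comp hpm.aemeasurable (h.filter_mono (by rw [hmap]))
  have hmeas : MeasurableSet (fundDom S) :=
    (MeasurableSet.univ_pi fun p => Metric.isClosed_sphere.measurableSet).prod measurableSet_Ioi
  have h3 : f.2.choose ∘ proj S =ᵐ[ν.prod τ] fun x => radial S f x.2 := by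
    rw [← hrestr]
    filter_upwards [ae_restrict_mem hmeas] with x hx
    exact radial_eq S f hx
  have h4 : MemLp (fun x : Adele S => radial S f x.2) 2 (ν.prod τ) :=
    (memLp_congr_ae (h2.trans h3)).1 h1
  have h5 : AEStronglyMeasurable (radial S f) τ := h4.1.of_comp_snd hν
  rw [memLp_two_iff_integrable_sq_norm h5]
  have h6 := (memLp_two_iff_integrable_sq_norm h4.1).1 h4
  exact Integrable.of_comp_snd (f := fun u => ‖radial S f u‖ ^ 2) h6 hν

/-- `𝒰_S = 𝔽_μ ∘ w_S` on `L²(X_S)^{K_S}`, where `w_S (f)(u) = u^{1/2} f(1 × u)`. -/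
def USmap (f : L2Xinv S) : Lp ℂ 2 (volume : Measure ℝ) :=
  mulFourier _ (memLp_rpow_half_mul (memLp_radial S f))

/-- `𝔽_μ ∘ w_∞` on even functions in `L²(ℝ)`, where `w_∞ (f)(u) = u^{1/2} f(u)`. -/
def Uinf (f : Lp ℂ 2 (volume : Measure ℝ)) : Lp ℂ 2 (volume : Measure ℝ) :=
  mulFourier _ (memLp_rpow_half_mul ((Lp.memLp f).restrict (Set.Ioi (0 : ℝ))))

/-- `E_S (s) = ∏_{v ∈ S} L_v (1/2 + is)`, with `L_∞ (z) = π^{-z/2} Γ(z/2)` and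
`L_p (z) = (1 - p^{-z})⁻¹`. -/
def ES (s : ℝ) : ℂ :=
  Complex.Gammaℝ (1 / 2 + Complex.I * s) *
    ∏ p : S, (1 - (((p : Nat.Primes) : ℕ) : ℂ) ^ (-(1 / 2 + Complex.I * s) : ℂ))⁻¹

/-- The measure `ds / |E_S (s)|²`. -/
def weight : Measure ℝ := volume.withDensity fun s => ENNReal.ofReal (‖ES S s‖ ^ 2)⁻¹

theorem measurable_ES : Measurable (ES S) := by
  unfold ES
  have h1 : Measurable fun z : ℂ => Complex.Gammaℝ z := by
    have h := Complex.differentiable_Gammaℝ_inv.continuous.measurable.inv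
    rwa [show (fun s => (Complex.Gammaℝ s)⁻¹)⁻¹ = fun z => Complex.Gammaℝ z from
      funext fun z => inv_inv _] at h
  refine (h1.comp (by fun_prop)).mul (Finset.measurable_prod _ fun p _ => ?_)
  fun_prop

theorem ES_ne_zero (s : ℝ) : ES S s ≠ 0 := by
  unfold ES
  have hre : (1 / 2 + Complex.I * s : ℂ).re = 1 / 2 := by simp
  refine mul_ne_zero (Complex.Gammaℝ_ne_zero_of_re_pos (by rw [hre]; norm_num))
    (Finset.prod_ne_zero_iff.2 fun p _ => inv_ne_zero ?_)
  intro h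
  have hp : 1 < ((p : Nat.Primes) : ℕ) := (p : Nat.Primes).2.one_lt
  have h1 : ‖(((p : Nat.Primes) : ℕ) : ℂ) ^ (-(1 / 2 + Complex.I * s) : ℂ)‖ = 1 := by
    rw [← sub_eq_zero.1 h, norm_one]
  rw [Complex.norm_natCast_cpow_of_pos (by lia), Complex.neg_re, hre] at h1
  have h2 := Real.rpow_lt_one_of_one_lt_of_neg
    (x := (((p : Nat.Primes) : ℕ) : ℝ)) (by exact_mod_cast hp) (z := -(1 / 2)) (by norm_num)
  exact h2.ne h1

theorem measurable_weight : Measurable fun s => ENNReal.ofReal (‖ES S s‖ ^ 2)⁻¹ :=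
  (((measurable_ES S).norm.pow_const 2).inv).ennreal_ofReal

theorem volume_abs_weight : (volume : Measure ℝ) ≪ weight S := by
  refine withDensity_absolutelyContinuous' (measurable_weight S).aemeasurable
    (Filter.Eventually.of_forall fun s => ?_)
  have := norm_pos_iff.2 (ES_ne_zero S s)
  rw [Ne, ENNReal.ofReal_eq_zero, not_le]
  positivity

theorem memLp_weight (f : Lp ℂ 2 (volume : Measure ℝ)) :
    MemLp (fun s => ES S s * f s) 2 (weight S) := by
  have hm : AEStronglyMeasurable (fun s => ES S s * f s) volume :=
    (measurable_ES S).aestronglyMeasurable.mul (Lp.aestronglyMeasurable f)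
  have hm' : AEStronglyMeasurable (fun s => ES S s * f s) (weight S) :=
    hm.mono_ac (withDensity_absolutelyContinuous _ _)
  rw [memLp_two_iff_integrable_sq_norm hm', weight,
    integrable_withDensity_iff_integrable_smul' (measurable_weight S)
      (Filter.Eventually.of_forall fun _ => ENNReal.ofReal_lt_top)]
  have hf := (memLp_two_iff_integrable_sq_norm (Lp.aestronglyMeasurable f)).1 (Lp.memLp f)
  refine hf.congr (Filter.Eventually.of_forall fun s => ?_)
  have hE := norm_ne_zero_iff.2 (ES_ne_zero S s)
  simp only
  rw [ENNReal.toReal_ofReal (by positivity), norm_mul, smul_eq_mul, mul_pow,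
    inv_mul_cancel_left₀ (pow_ne_zero 2 hE)]

/-- The operator `β_S : L²(ℝ) → L²(ℝ, ds / |E_S (s)|²)` of multiplication by `E_S`. -/
def betaS (f : Lp ℂ 2 (volume : Measure ℝ)) : Lp ℂ 2 (weight S) := (memLp_weight S f).toLp

/-- The dual Hardy–Titchmarsh transform `υ_S = β_S ∘ 𝒰_S`. -/
def upsilon (f : L2Xinv S) : Lp ℂ 2 (weight S) := betaS S (USmap S f)

/-- The dual Hardy–Titchmarsh transform `υ_∞` on even functions in `L²(ℝ)`. -/
def upsilonInf (f : Lp ℂ 2 (volume : Measure ℝ)) : Lp ℂ 2 (weight ∅) := betaS ∅ (Uinf f)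

/-! ### The Hilbert space of entire functions -/

/-- The restriction of a function to the critical line. -/
def critical (F : ℂ → ℂ) (s : ℝ) : ℂ := F (1 / 2 + Complex.I * s)

/-- The entire functions whose restriction to the critical line is in `L²(ℝ, ds / |E_∞ (s)|²)`. -/
def entireSub : Submodule ℂ (ℂ → ℂ) where
  carrier := {F | Differentiable ℂ F ∧ MemLp (critical F) 2 (weight ∅)}
  zero_mem' := ⟨differentiable_const 0, MemLp.zero⟩
  add_mem' := fun hF hG => ⟨hF.1.add hG.1, hF.2.add hG.2⟩
  smul_mem' := fun c _ hF => ⟨hF.1.const_smul c, hF.2.const_smul c⟩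

/-- The vector space `entireSub`. (A separate type, as its topology is not that of pointwise
convergence.) -/
def EntireL2 : Type := entireSub

instance entireAddCommGroup : AddCommGroup EntireL2 := inferInstanceAs (AddCommGroup entireSub)

instance entireModule : Module ℂ EntireL2 := inferInstanceAs (Module ℂ entireSub)

/-- The entire function underlying an element of `EntireL2`. -/
def EntireL2.fn (F : EntireL2) : ℂ → ℂ := F.1

/-- The embedding of `EntireL2` in `L²(ℝ, ds / |E_∞ (s)|²)`. -/
def entireToLp : EntireL2 →ₗ[ℂ] Lp ℂ 2 (weight ∅) where
  toFun F := F.2.2.toLp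
  map_add' F G := MemLp.toLp_add F.2.2 G.2.2
  map_smul' c F := MemLp.toLp_const_smul c F.2.2

theorem entireToLp_injective : Function.Injective entireToLp := by
  rw [injective_iff_map_eq_zero]
  intro F hF
  have h1 : critical F.1 =ᵐ[weight ∅] 0 := by
    have h := F.2.2.coeFn_toLp
    have h' : (F.2.2.toLp : Lp ℂ 2 (weight ∅)) = 0 := hF
    rw [h'] at h
    exact h.symm.trans (Lp.coeFn_zero _ _ _)
  have h2 : critical F.1 =ᵐ[volume] 0 := (volume_abs_weight ∅).ae_eq h1
  have hc : Continuous (critical F.1) := by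
    unfold critical
    exact F.2.1.continuous.comp (by fun_prop)
  have h3 : critical F.1 = 0 := (Continuous.ae_eq_iff_eq volume hc continuous_const).1 h2
  have hA : AnalyticOnNhd ℂ F.1 Set.univ := fun z _ => F.2.1.analyticAt z
  have hfr : ∃ᶠ z in 𝓝[≠] (1 / 2 : ℂ), F.1 z = 0 := by
    have ht : Filter.Tendsto (fun n : ℕ => (1 / 2 : ℂ) + Complex.I * ((1 / ((n : ℝ) + 1) : ℝ) : ℂ))
        Filter.atTop (𝓝[≠] (1 / 2 : ℂ)) := by
      rw [tendsto_nhdsWithin_iff]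
      constructor
      · have h0 : Filter.Tendsto (fun n : ℕ => 1 / ((n : ℝ) + 1)) Filter.atTop (𝓝 0) :=
          tendsto_one_div_add_atTop_nhds_zero_nat
        have h4 : Continuous fun t : ℝ => (1 / 2 : ℂ) + Complex.I * (t : ℂ) := by fun_prop
        have h5 := h4.tendsto 0
        rw [Complex.ofReal_zero, mul_zero, add_zero] at h5
        exact h5.comp h0
      · refine Filter.Eventually.of_forall fun n => ?_
        have : ((n : ℝ) + 1) ≠ 0 := by positivity
        simp only [Set.mem_compl_iff, Set.mem_singleton_iff, add_eq_left, mul_eq_zero,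
          Complex.I_ne_zero, false_or, Complex.ofReal_eq_zero]
        positivity
    exact ht.frequently (Filter.Frequently.of_forall fun n => congrFun h3 _)
  have h4 : Set.EqOn F.1 0 Set.univ :=
    hA.eqOn_of_preconnected_of_frequently_eq (fun z _ => analyticAt_const)
      isPreconnected_univ (Set.mem_univ (1 / 2 : ℂ)) hfr
  exact Subtype.ext (funext fun z => h4 (Set.mem_univ z))

/-- The norm of `EntireL2` is that of `L²(ℝ, ds / |E_∞ (s)|²)`. -/
instance entireNormed : NormedAddCommGroup EntireL2 :=
  NormedAddCommGroup.induced EntireL2 (Lp ℂ 2 (weight ∅)) entireToLp entireToLp_injective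

/-- The inner product of `EntireL2` is that of `L²(ℝ, ds / |E_∞ (s)|²)`. -/
instance entireInner : InnerProductSpace ℂ EntireL2 where
  toNormedSpace := NormedSpace.induced ℂ EntireL2 (Lp ℂ 2 (weight ∅)) entireToLp
  inner F G := inner ℂ (entireToLp F) (entireToLp G)
  norm_sq_eq_re_inner F := norm_sq_eq_re_inner (𝕜 := ℂ) (entireToLp F)
  conj_inner_symm F G := inner_conj_symm _ _
  add_left F G H := by
    rw [map_add]
    exact inner_add_left _ _ _
  smul_left F G c := by
    rw [LinearMap.map_smul]
    exact inner_smul_left _ _ _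

/-- The defining formula of `M̌ (f)`: for `Re z > 1/2` it is
`π^{-z/2} Γ(z/2) ∫_0^∞ f(t) t^{1-z} d^*t`. -/
def checkM (f : ℝ → ℂ) (z : ℂ) : ℂ :=
  Complex.Gammaℝ z * ∫ t in Set.Ioi (0 : ℝ), f t * (t : ℂ) ^ (1 - z) / t

theorem integrable_checkM {lam : ℝ} (hlam : 0 < lam) {f : Lp ℂ 2 (volume : Measure ℝ)}
    (hf : f ∈ soninR lam) {z : ℂ} (hz : 1 / 2 < z.re) :
    IntegrableOn (fun t : ℝ => f t * (t : ℂ) ^ (1 - z) / t) (Set.Ioi 0) := by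
  have hcpow : ∀ t : ℝ, 0 < t → (t : ℂ) ^ (1 - z) / t = (t : ℂ) ^ (-z) := by
    intro t ht
    have ht' : (t : ℂ) ≠ 0 := by exact_mod_cast ht.ne'
    rw [sub_eq_add_neg, Complex.cpow_add _ _ ht', Complex.cpow_one, mul_div_cancel_left₀ _ ht']
  have hk : MemLp (fun t : ℝ => (t : ℂ) ^ (-z)) 2 (volume.restrict (Set.Ioi lam)) := by
    have hm : AEStronglyMeasurable (fun t : ℝ => (t : ℂ) ^ (-z))
        (volume.restrict (Set.Ioi lam)) := by
      refine ContinuousOn.aestronglyMeasurable ?_ measurableSet_Ioi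
      intro t ht
      have ht0 : 0 < t := hlam.trans ht
      exact (Complex.continuousAt_ofReal_cpow_const t (-z) (Or.inr ht0.ne')).continuousWithinAt
    rw [memLp_two_iff_integrable_sq_norm hm]
    have hI : IntegrableOn (fun t : ℝ => t ^ (-2 * z.re)) (Set.Ioi lam) :=
      integrableOn_Ioi_rpow_of_lt (by linarith) hlam
    refine hI.congr_fun (fun t ht => ?_) measurableSet_Ioi
    have ht0 : 0 < t := hlam.trans ht
    simp only
    rw [Complex.norm_cpow_eq_rpow_re_of_pos ht0, ← Real.rpow_natCast, ← Real.rpow_mul ht0.le]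
    congr 1
    simp
    ring
  have hprod : IntegrableOn (fun t : ℝ => f t * (t : ℂ) ^ (-z)) (Set.Ioi lam) :=
    ((Lp.memLp f).restrict (Set.Ioi lam)).integrable_mul hk
  have hzero : IntegrableOn (fun t : ℝ => f t * (t : ℂ) ^ (1 - z) / t) (Set.Ioc 0 lam) := by
    have h0 : IntegrableOn (fun _ : ℝ => (0 : ℂ)) (Set.Ioc 0 lam) := integrable_zero _ _ _
    refine h0.congr_fun_ae ?_
    rw [Filter.EventuallyEq, ae_restrict_iff' measurableSet_Ioc]
    have hne : ∀ᵐ t : ℝ, t ≠ lam := by simp [ae_iff, measure_singleton]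
    filter_upwards [hf.2.1, hne] with t h1 h2 ht
    have : f t = 0 := h1 (by rw [abs_of_pos ht.1]; exact lt_of_le_of_ne ht.2 h2)
    simp [this]
  rw [← Set.Ioc_union_Ioi_eq_Ioi hlam.le]
  refine hzero.union (hprod.congr_fun (fun t ht => ?_) measurableSet_Ioi)
  have ht0 : 0 < t := hlam.trans ht
  simp only
  rw [mul_div_assoc, hcpow t ht0]

/-- `F` is the entire function `M̌ (f)`: it is given by the defining formula on the half-plane
`Re z > 1/2`, where the integral converges absolutely for every `f ∈ L²(ℝ)` which vanishes near
`0`. -/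
def IsCheckM (f : ℝ → ℂ) (F : ℂ → ℂ) : Prop :=
  Differentiable ℂ F ∧ ∀ z : ℂ, 1 / 2 < z.re → F z = checkM f z

/-- The space `ℬ_λ`: the image of the Sonin space `𝐒_λ(ℝ, e_∞)` under `M̌`, with the inner product
of `L²(ℝ, ds / |E_∞ (s)|²)`. -/
def spaceB (lam : ℝ) (hlam : 0 < lam) : Submodule ℂ EntireL2 where
  carrier := {F | ∃ f ∈ soninR lam, IsCheckM f F.fn}
  zero_mem' := by
    refine ⟨0, Submodule.zero_mem _, differentiable_const 0, fun z _ => ?_⟩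
    have h : ∫ t in Set.Ioi (0 : ℝ),
        (0 : Lp ℂ 2 (volume : Measure ℝ)) t * (t : ℂ) ^ (1 - z) / t = 0 := by
      apply integral_eq_zero_of_ae
      filter_upwards [ae_restrict_of_ae (Lp.coeFn_zero ℂ 2 (volume : Measure ℝ))] with t ht
      simp only [ht, Pi.zero_apply, zero_mul, zero_div]
    rw [checkM, h, mul_zero]
    rfl
  add_mem' := by
    rintro F G ⟨f, hf, hF, hF'⟩ ⟨g, hg, hG, hG'⟩
    refine ⟨f + g, Submodule.add_mem _ hf hg, hF.add hG, fun z hz => ?_⟩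
    change F.fn z + G.fn z = _
    rw [hF' z hz, hG' z hz, checkM, checkM, checkM, ← mul_add,
      ← integral_add (integrable_checkM hlam hf hz) (integrable_checkM hlam hg hz)]
    congr 1
    apply integral_congr_ae
    filter_upwards [ae_restrict_of_ae (Lp.coeFn_add f g)] with t ht
    simp only [ht, Pi.add_apply]
    ring
  smul_mem' := by
    rintro c F ⟨f, hf, hF, hF'⟩
    refine ⟨c • f, Submodule.smul_mem _ c hf, hF.const_smul c, fun z hz => ?_⟩
    change c * F.fn z = _
    rw [hF' z hz, checkM, checkM, mul_left_comm, ← integral_const_mul]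
    congr 1
    apply integral_congr_ae
    filter_upwards [ae_restrict_of_ae (Lp.coeFn_smul c f)] with t ht
    simp only [ht, Pi.smul_apply, smul_eq_mul]
    ring

end Semilocal

end

noncomputable section

namespace Semilocal

/-! ### Gaussian theta integrals and the entire continuation of the Mellin transform -/

section

/-! Both spaces in the statement are copies of the real Sonin space: `checkEquiv` identifies it with
`spaceB`, `thetaSonin` identifies it with `soninX`, and the required map is `checkEquiv` composed
with the inverse of `thetaSonin`.

The real side. Integrating `f` against Gaussians gives a function `thetaInt f` whose Mellin
transform at `z/2` is `checkM f z`. Parseval gives `thetaInt_fourier`, a functional equation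
exchanging `x` with `1/x` and `f` with its Fourier transform. As both vanish near `0`, `thetaInt f`
decays exponentially at infinity and faster than every power at `0`, so its Mellin transform is
entire (`exists_isCheckM`). Its restriction to the critical line is `upsilonInf f` by an `L²` limit
from the right (`critical_of_mellin`), and Plancherel makes the map a multiple of an isometry.

The operator `θ_S`. On the fundamental domain only the elements `±∏_{p ∈ T} p⁻¹` of `Γ`, with `T ⊆
S`, meet the support of the `σ_p`, so `θ_S` becomes the product of the operators `f ↦ f - p⁻¹
f(·/p)` (`theta_proj`). Each is `1 - A` with `‖A‖ ≤ p^(-1/2) < 1`, hence invertible by a Neumann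
series, in both directions compatible with parity and with vanishing on `|x| < λ`
(`exists_thetaEquiv`). It multiplies Mellin transforms by `∏ (1 - p^(-z))`, which the local factors
in `E_S` cancel. That is why the space of entire functions does not depend on `S`.

The Fourier transform. Each `σ_p` is its own Fourier transform (`fourier_sigmaP`), so `θ_S` carries
the real Fourier transform into the closed relation `fourierGraph`, and the real Sonin space into
the semilocal one. Conversely, a `K_S`-invariant function is an even function of the module, hence
some `θ_S(f)` with `f` even. That the Fourier transform of `f` vanishes near `0` follows from
Parseval's formula `pairX_thetaL2`, obtained by unfolding sums over `Γ`: any `g` related to `θ_S(f)`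
has the same pairings with all classes `θ_S(b)` as `θ_S(𝓕 f)`, and there are enough such classes to
detect the restriction to `|x|_S < λ` (`fourier_mem_vanSub`). No proof that the relation is
single-valued is needed. -/

theorem fourier_toLp_ae_eq {f : ℝ → ℂ} (h1 : Integrable f) (h2 : MemLp f 2 (volume : Measure ℝ)) :
    (𝓕 h2.toLp : Lp ℂ 2 (volume : Measure ℝ)) =ᵐ[volume] 𝓕 f := by
  have hc : Continuous (𝓕 f) :=
    VectorFourier.fourierIntegral_continuous Real.continuous_fourierChar
      (L := innerₗ ℝ) continuous_inner h1
  -- The `L²` transform is accessible through tempered distributions: tested against a smooth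
  -- compactly supported `g`, both sides become the integral of `f` times the transform of `g`.
  refine ae_eq_of_integral_contDiff_smul_eq
    ((Lp.memLp _).locallyIntegrable (by norm_num)) hc.locallyIntegrable ?_
  intro g hg hgc
  have hgc' : HasCompactSupport (fun x => (g x : ℂ)) := hgc.comp_left Complex.ofReal_zero
  let G : 𝓢(ℝ, ℂ) := hgc'.toSchwartzMap (Complex.ofRealCLM.contDiff.comp hg)
  have hG : ∀ x, G x = (g x : ℂ) := fun x => rfl
  have e1 := congrArg (fun T => T G)
    (Lp.fourier_toTemperedDistribution_eq (h2.toLp : Lp ℂ 2 (volume : Measure ℝ)))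
  simp only [TemperedDistribution.fourier_apply, Lp.toTemperedDistribution_apply, hG] at e1
  have e2 := VectorFourier.integral_fourierIntegral_smul_eq_flip (μ := volume) (ν := volume)
    (L := innerₗ ℝ) (f := f) (g := fun x => (g x : ℂ)) Real.continuous_fourierChar
    continuous_inner h1 G.integrable
  rw [flip_innerₗ] at e2
  have e3 : ∫ x, g x • 𝓕 f x = ∫ x, f x • 𝓕 (fun x => (g x : ℂ)) x := by
    rw [show (∫ x, f x • 𝓕 (fun x => (g x : ℂ)) x) = _ from e2.symm]
    refine integral_congr_ae (Filter.Eventually.of_forall fun x => ?_)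
    change (g x : ℂ) * _ = _ * (g x : ℂ)
    exact mul_comm _ _
  rw [e3]
  refine Eq.trans e1.symm ?_
  refine integral_congr_ae ?_
  filter_upwards [h2.coeFn_toLp] with x hx
  rw [hx, SchwartzMap.fourier_coe]
  exact mul_comm _ _

/-- The Gaussian `t ↦ exp (-π x t²)`. -/
def gauss (x t : ℝ) : ℝ := Real.exp (-(Real.pi * x * t ^ 2))

theorem continuous_gauss (x : ℝ) : Continuous (gauss x) := by
  unfold gauss; fun_prop

theorem integrable_gauss {x : ℝ} (hx : 0 < x) : Integrable (fun t => (gauss x t : ℂ)) := by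
  have h := integrable_exp_neg_mul_sq (b := Real.pi * x) (by positivity)
  have h' : Integrable (gauss x) := by
    refine h.congr (Filter.Eventually.of_forall fun t => ?_)
    simp only [gauss]
    congr 1
    ring
  exact h'.ofReal

theorem memLp_gauss {x : ℝ} (hx : 0 < x) :
    MemLp (fun t => (gauss x t : ℂ)) 2 (volume : Measure ℝ) := by
  have hc : Continuous fun t => (gauss x t : ℂ) :=
    Complex.continuous_ofReal.comp (continuous_gauss x)
  rw [memLp_two_iff_integrable_sq_norm hc.aestronglyMeasurable]
  have h := integrable_exp_neg_mul_sq (b := 2 * (Real.pi * x)) (by positivity)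
  refine h.congr (Filter.Eventually.of_forall fun t => ?_)
  simp only [gauss, Complex.norm_real, Real.norm_eq_abs, sq_abs]
  rw [← Real.exp_nat_mul]
  congr 1
  push_cast
  ring

theorem fourier_gauss {x : ℝ} (hx : 0 < x) :
    𝓕 (fun t => (gauss x t : ℂ)) = fun y => ((x ^ (-(1 / 2) : ℝ) : ℝ) : ℂ) * gauss x⁻¹ y := by
  have h := fourier_gaussian_pi (b := (x : ℂ)) (by simpa using hx)
  have e : (fun t => (gauss x t : ℂ)) = fun t : ℝ => Complex.exp (-Real.pi * x * t ^ 2) := by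
    funext t; simp [gauss]
  rw [e, h]
  funext y
  rw [Complex.ofReal_cpow hx.le, Complex.ofReal_neg, Complex.cpow_neg, one_div]
  congr 1
  · norm_num
  · simp [gauss, div_eq_mul_inv]

/-- Plancherel against a Gaussian, which is real and whose transform is the Gaussian of parameter
`x⁻¹` up to the factor `x^(-1/2)`. -/
theorem integral_gauss_mul_fourier (f : Lp ℂ 2 (volume : Measure ℝ)) {x : ℝ} (hx : 0 < x) :
    ∫ t, (gauss x t : ℂ) * f t
      = ((x ^ (-(1 / 2) : ℝ) : ℝ) : ℂ) *
        ∫ t, (gauss x⁻¹ t : ℂ) * (𝓕 f : Lp ℂ 2 (volume : Measure ℝ)) t := by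
  have h := Lp.inner_fourier_eq (memLp_gauss hx).toLp f
  rw [L2.inner_def, L2.inner_def] at h
  rw [← integral_const_mul]
  refine Eq.trans ?_ (h.symm.trans ?_)
  · refine integral_congr_ae ?_
    filter_upwards [(memLp_gauss hx).coeFn_toLp] with t ht
    rw [ht, RCLike.inner_apply, Complex.conj_ofReal, mul_comm]
  · refine integral_congr_ae ?_
    filter_upwards [fourier_toLp_ae_eq (integrable_gauss hx) (memLp_gauss hx)] with t ht
    rw [ht, fourier_gauss hx, RCLike.inner_apply, map_mul, Complex.conj_ofReal,
      Complex.conj_ofReal]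
    ring

/-- The theta integral `½ ∫_ℝ f(t) exp (-π x t²) dt`. -/
def thetaInt (f : ℝ → ℂ) (x : ℝ) : ℂ := (1 / 2 : ℂ) * ∫ t, (gauss x t : ℂ) * f t

/-- The theta functional equation; it converts decay at infinity for the Fourier transform into
decay at `0` for `f`. -/
theorem thetaInt_fourier (f : Lp ℂ 2 (volume : Measure ℝ)) {x : ℝ} (hx : 0 < x) :
    thetaInt f x = ((x ^ (-(1 / 2) : ℝ) : ℝ) : ℂ) *
      thetaInt (𝓕 f : Lp ℂ 2 (volume : Measure ℝ)) x⁻¹ := by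
  rw [thetaInt, thetaInt, integral_gauss_mul_fourier f hx]
  ring

/-- For `x ≥ 1` and `|t| ≥ λ` the Gaussian of parameter `x` is at most `exp(-π(x - 1)λ²)` times that
of parameter `1`, and the region `|t| < λ` contributes nothing. -/
theorem thetaInt_isBigO {lam : ℝ} (hlam : 0 < lam) (f : Lp ℂ 2 (volume : Measure ℝ))
    (hf : ∀ᵐ x : ℝ, |x| < lam → f x = 0) :
    thetaInt f =O[Filter.atTop] fun x => Real.exp (-(Real.pi * lam ^ 2) * x) := by
  have hi : Integrable fun t => (gauss 1 t : ℂ) * f t :=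
    (memLp_gauss one_pos).integrable_mul (Lp.memLp f)
  refine Asymptotics.IsBigO.of_bound
    (Real.exp (Real.pi * lam ^ 2) * ∫ t, ‖(gauss 1 t : ℂ) * f t‖) ?_
  filter_upwards [Filter.eventually_ge_atTop 1] with x hx
  rw [thetaInt, norm_mul]
  have h1 : ‖∫ t, (gauss x t : ℂ) * f t‖ ≤ ∫ t, Real.exp (-(Real.pi * lam ^ 2) * x) *
      (Real.exp (Real.pi * lam ^ 2) * ‖(gauss 1 t : ℂ) * f t‖) := by
    refine norm_integral_le_of_norm_le ((hi.norm.const_mul _).const_mul _) ?_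
    filter_upwards [hf] with t ht
    by_cases htl : |t| < lam
    · simp [ht htl]
    · rw [norm_mul, norm_mul, ← mul_assoc, ← mul_assoc]
      refine mul_le_mul_of_nonneg_right ?_ (norm_nonneg _)
      simp only [gauss, Complex.norm_real, Real.norm_eq_abs, Real.abs_exp]
      rw [← Real.exp_add, ← Real.exp_add, Real.exp_le_exp]
      have h2 : lam ^ 2 ≤ t ^ 2 := by
        rw [← sq_abs t]
        exact pow_le_pow_left₀ hlam.le (not_lt.1 htl) 2
      have h3 : 0 ≤ (x - 1) * (t ^ 2 - lam ^ 2) := mul_nonneg (by linarith) (by linarith)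
      nlinarith [mul_nonneg Real.pi_pos.le h3]
  rw [integral_const_mul, integral_const_mul] at h1
  rw [Real.norm_eq_abs, Real.abs_exp]
  have h4 : ‖(1 / 2 : ℂ)‖ ≤ 1 := by norm_num
  calc _ ≤ 1 * ‖∫ t, (gauss x t : ℂ) * f t‖ := by gcongr
    _ ≤ _ := by rw [one_mul]; exact h1.trans (le_of_eq (by ring))

/-- A Gamma integral, read off from the Mellin transform of a theta series with a single term. It is
the source of the factor `π^(-z/2) Γ(z/2)` in `checkM`. -/
theorem integral_cpow_mul_gauss {t : ℝ} (ht : 0 < t) {z : ℂ} (hz : 0 < z.re) :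
    ∫ x in Set.Ioi (0 : ℝ), (x : ℂ) ^ (z / 2 - 1) * gauss x t
      = Complex.Gammaℝ z * ((t : ℂ) ^ (1 - z) / t) := by
  have h := hasSum_mellin_pi_mul_sq (ι := Unit) (a := fun _ => 1) (r := fun _ => t)
    (F := fun x => (gauss x t : ℂ)) hz (by
      intro x _
      have : (gauss x t : ℂ) = if t = 0 then 0 else (1 : ℂ) * Real.exp (-Real.pi * t ^ 2 * x) := by
        rw [if_neg ht.ne', one_mul, gauss]
        congr 2
        ring
      simp only [this]
      exact hasSum_unique _) (by simpa using Summable.of_finite)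
  have h' := h.unique (hasSum_unique _)
  rw [mellin] at h'
  simp only [smul_eq_mul] at h'
  rw [h', abs_of_pos ht, mul_one, Complex.cpow_sub _ _ (by exact_mod_cast ht.ne'), Complex.cpow_one]
  have : (t : ℂ) ≠ 0 := by exact_mod_cast ht.ne'
  field_simp

theorem integrable_rpow_mul_gauss {t : ℝ} (ht : 0 < t) {s : ℝ} (hs : 0 < s) :
    IntegrableOn (fun x => x ^ (s / 2 - 1) * gauss x t) (Set.Ioi 0) := by
  have h := integrableOn_rpow_mul_exp_neg_mul_rpow (p := 1) (s := s / 2 - 1)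
    (b := Real.pi * t ^ 2) (by linarith) one_pos (by positivity)
  refine h.congr_fun (fun x _ => ?_) measurableSet_Ioi
  simp only [gauss, Real.rpow_one]
  congr 2
  ring

/-- Integrating the absolute value in `x` first leaves a constant multiple of `|f(t)| t^(-Re z)`,
integrable by hypothesis; this licenses Fubini. -/
theorem integrable_thetaInt_kernel {f : Lp ℂ 2 (volume : Measure ℝ)}
    (hint : ∀ z : ℂ, 1 / 2 < z.re →
      IntegrableOn (fun t : ℝ => f t * (t : ℂ) ^ (1 - z) / t) (Set.Ioi 0))
    {z : ℂ} (hz : 1 / 2 < z.re) :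
    Integrable (fun q : ℝ × ℝ => (q.2 : ℂ) ^ (z / 2 - 1) * (gauss q.2 q.1 * f q.1))
      ((volume.restrict (Set.Ioi (0 : ℝ))).prod (volume.restrict (Set.Ioi (0 : ℝ)))) := by
  have hm : AEStronglyMeasurable
      (fun q : ℝ × ℝ => (q.2 : ℂ) ^ (z / 2 - 1) * (gauss q.2 q.1 * f q.1))
      ((volume.restrict (Set.Ioi (0 : ℝ))).prod (volume.restrict (Set.Ioi (0 : ℝ)))) := by
    refine AEStronglyMeasurable.mul ?_ (AEStronglyMeasurable.mul ?_ ?_)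
    · exact Measurable.aestronglyMeasurable (by fun_prop)
    · unfold gauss
      exact Continuous.aestronglyMeasurable (by fun_prop)
    · exact ((Lp.aestronglyMeasurable f).restrict).comp_fst
  have hn : ∀ t x : ℝ, 0 < x → ‖(x : ℂ) ^ (z / 2 - 1) * (gauss x t * f t)‖
      = ‖f t‖ * (x ^ (z.re / 2 - 1) * gauss x t) := by
    intro t x hx
    rw [norm_mul, norm_mul, Complex.norm_cpow_eq_rpow_re_of_pos hx, Complex.norm_real,
      Real.norm_eq_abs, abs_of_pos (show 0 < gauss x t from Real.exp_pos _)]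
    simp only [Complex.sub_re, Complex.div_ofNat_re, Complex.one_re]
    ring
  rw [integrable_prod_iff hm]
  constructor
  · filter_upwards [ae_restrict_mem measurableSet_Ioi] with t ht
    have hi := (integrable_rpow_mul_gauss ht (s := z.re) (by linarith)).const_mul ‖f t‖
    refine (integrable_norm_iff ?_).1 (IntegrableOn.congr_fun hi
      (fun x hx => (hn t x hx).symm) measurableSet_Ioi)
    unfold gauss
    exact Measurable.aestronglyMeasurable (by fun_prop)
  · have hv : ∀ t ∈ Set.Ioi (0 : ℝ), ‖Complex.Gammaℝ (z.re : ℂ)‖ * ‖f t * (t : ℂ) ^ (1 - z) / t‖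
        = ∫ x in Set.Ioi (0 : ℝ), ‖(x : ℂ) ^ (z / 2 - 1) * (gauss x t * f t)‖ := by
      intro t ht
      have ht0 : (0 : ℝ) < t := ht
      rw [setIntegral_congr_fun measurableSet_Ioi (fun x hx => hn t x hx), integral_const_mul]
      have h := integral_cpow_mul_gauss ht0 (z := (z.re : ℂ)) (by simp; linarith)
      have h2 : ∫ x in Set.Ioi (0 : ℝ), (x : ℂ) ^ ((z.re : ℂ) / 2 - 1) * gauss x t
          = ((∫ x in Set.Ioi (0 : ℝ), x ^ (z.re / 2 - 1) * gauss x t : ℝ) : ℂ) := by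
        rw [← integral_complex_ofReal]
        refine setIntegral_congr_fun measurableSet_Ioi fun x hx => ?_
        rw [Complex.ofReal_mul, Complex.ofReal_cpow (le_of_lt hx)]
        push_cast
        rfl
      have h3 : 0 ≤ ∫ x in Set.Ioi (0 : ℝ), x ^ (z.re / 2 - 1) * gauss x t :=
        setIntegral_nonneg measurableSet_Ioi fun x hx =>
          mul_nonneg (Real.rpow_nonneg (le_of_lt hx) _) (Real.exp_pos _).le
      have h4 := congrArg norm (h2.symm.trans h)
      rw [Complex.norm_real, Real.norm_of_nonneg h3] at h4
      rw [h4, norm_mul, norm_div, norm_div, norm_mul, Complex.norm_cpow_eq_rpow_re_of_pos ht0,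
        Complex.norm_cpow_eq_rpow_re_of_pos ht0]
      simp only [Complex.sub_re, Complex.one_re, Complex.ofReal_re]
      ring
    exact IntegrableOn.congr_fun ((hint z hz).norm.const_mul _) hv measurableSet_Ioi

theorem integral_eq_two_mul_of_even {f : ℝ → ℂ} (hi : Integrable f)
    (hf : ∀ᵐ x : ℝ, f (-x) = f x) :
    ∫ x, f x = 2 * ∫ x in Set.Ioi (0 : ℝ), f x := by
  have h1 := integral_comp_neg_Iic (0 : ℝ) f
  rw [neg_zero, integral_congr_ae (ae_restrict_of_ae hf)] at h1
  rw [← intervalIntegral.integral_Iic_add_Ioi (b := 0) hi.integrableOn hi.integrableOn, h1, two_mul]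

theorem mellin_thetaInt {f : Lp ℂ 2 (volume : Measure ℝ)}
    (hev : ∀ᵐ x : ℝ, f (-x) = f x)
    (hint : ∀ z : ℂ, 1 / 2 < z.re →
      IntegrableOn (fun t : ℝ => f t * (t : ℂ) ^ (1 - z) / t) (Set.Ioi 0))
    {z : ℂ} (hz : 1 / 2 < z.re) :
    MellinConvergent (thetaInt f) (z / 2) ∧ mellin (thetaInt f) (z / 2) = checkM f z := by
  have hth : ∀ x, 0 < x → thetaInt f x = ∫ t in Set.Ioi (0 : ℝ), (gauss x t : ℂ) * f t := by
    intro x hx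
    rw [thetaInt, integral_eq_two_mul_of_even]
    · ring
    · exact (memLp_gauss hx).integrable_mul (Lp.memLp f)
    · filter_upwards [hev] with t ht
      rw [ht]
      simp [gauss]
  have hk := integrable_thetaInt_kernel hint hz
  constructor
  · have h := hk.integral_prod_right
    refine IntegrableOn.congr_fun h (fun x hx => ?_) measurableSet_Ioi
    simp only [integral_const_mul]
    rw [hth x hx, smul_eq_mul]
  · rw [mellin, setIntegral_congr_fun measurableSet_Ioi (fun x hx => by
      simp only [hth x hx, smul_eq_mul, ← integral_const_mul]; rfl)]
    rw [integral_integral_swap (f := fun x t : ℝ => (x : ℂ) ^ (z / 2 - 1) * (gauss x t * f t))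
      hk.swap, checkM, ← integral_const_mul]
    refine setIntegral_congr_fun measurableSet_Ioi fun t ht => ?_
    have h := integral_cpow_mul_gauss ht (z := z) (by linarith)
    simp only [← mul_assoc]
    rw [integral_mul_const, h]
    ring

/-- `M̌ (f)` extends to an entire function. -/
theorem exists_isCheckM {lam : ℝ} (hlam : 0 < lam) {f : Lp ℂ 2 (volume : Measure ℝ)}
    (hf : f ∈ soninR lam) : IsCheckM f fun z => mellin (thetaInt f) (z / 2) := by
  have hint : ∀ z : ℂ, 1 / 2 < z.re →
      IntegrableOn (fun t : ℝ => f t * (t : ℂ) ^ (1 - z) / t) (Set.Ioi 0) :=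
    fun z hz => integrable_checkM hlam hf hz
  refine ⟨?_, fun z hz => (mellin_thetaInt hf.1 hint hz).2⟩
  have hloc : LocallyIntegrableOn (thetaInt f) (Set.Ioi 0) := by
    -- At `z = 2` the power `x^(z/2 - 1)` is trivial, so Mellin convergence is plain integrability.
    have h := (mellin_thetaInt hf.1 hint (z := 2) (by norm_num)).1
    have h' : IntegrableOn (thetaInt f) (Set.Ioi 0) := by
      refine IntegrableOn.congr_fun h (fun x _ => ?_) measurableSet_Ioi
      simp
    exact h'.locallyIntegrableOn
  have hp : 0 < Real.pi * lam ^ 2 := by positivity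
  have htop := thetaInt_isBigO hlam f hf.2.1
  have htop' := thetaInt_isBigO hlam _ hf.2.2
  have hbot : ∀ b : ℝ, thetaInt f =O[𝓝[>] 0] fun x => x ^ (-b) := by
    intro b
    -- The exponent `b - 1/2` becomes `1/2 - b` under `x ↦ x⁻¹`, and the factor `x^(-1/2)` of the
    -- functional equation turns it into `-b`.
    have h1 := htop'.trans (isLittleO_exp_neg_mul_rpow_atTop hp (b - 1 / 2)).isBigO
    have h2 := h1.comp_tendsto tendsto_inv_nhdsGT_zero
    have h0 : (fun x : ℝ => ((x ^ (-(1 / 2) : ℝ) : ℝ) : ℂ)) =O[𝓝[>] 0]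
        fun x : ℝ => x ^ (-(1 / 2) : ℝ) :=
      Asymptotics.isBigO_of_le _ fun x => by rw [Complex.norm_real]
    refine (h0.mul h2).congr' ?_ ?_
    · filter_upwards [self_mem_nhdsWithin] with x hx
      exact (thetaInt_fourier f hx).symm
    · filter_upwards [self_mem_nhdsWithin] with x hx
      have hx0 : (0 : ℝ) < x := hx
      simp only [Function.comp_apply]
      rw [Real.inv_rpow hx0.le, ← Real.rpow_neg hx0.le, ← Real.rpow_add hx0]
      congr 1
      ring
  -- Any exponent below `Re s` would do for the behaviour at `0`; since all are available, there is
  -- no restriction on `s`.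
  have hd : Differentiable ℂ (mellin (thetaInt f)) := fun s =>
    mellin_differentiableAt_of_isBigO_rpow_exp hp hloc htop (hbot (s.re - 1)) (by linarith)
  exact hd.comp (differentiable_id.div_const 2)

end

/-! ### Closed subspaces and dilations of `L²(ℝ)`; the real form of `θ_S` -/

section

/-- `L²(ℝ)`. -/
abbrev L2R : Type := Lp ℂ 2 (volume : Measure ℝ)

/-- The reflection `f ↦ f (-·)` of `L²(ℝ)`. -/
def refl : L2R →ₗᵢ[ℂ] L2R :=
  Lp.compMeasurePreservingₗᵢ ℂ (fun x : ℝ => -x) (Measure.measurePreserving_neg volume)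

theorem refl_ae (f : L2R) : refl f =ᵐ[volume] fun x => f (-x) :=
  Lp.coeFn_compMeasurePreserving f (Measure.measurePreserving_neg volume)

/-- The even elements of `L²(ℝ)`. -/
def evenSub : Submodule ℂ L2R :=
  LinearMap.ker ((refl.toContinuousLinearMap - ContinuousLinearMap.id ℂ L2R : L2R →L[ℂ] L2R) :
    L2R →ₗ[ℂ] L2R)

theorem mem_evenSub_iff {f : L2R} : f ∈ evenSub ↔ refl f = f := by
  rw [evenSub, LinearMap.mem_ker]
  exact sub_eq_zero

theorem mem_evenSub {f : L2R} : f ∈ evenSub ↔ ∀ᵐ x : ℝ, f (-x) = f x := by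
  rw [mem_evenSub_iff, Lp.ext_iff]
  constructor
  · intro h
    filter_upwards [h, refl_ae f] with x h1 h2
    rw [← h2, h1]
  · intro h
    filter_upwards [h, refl_ae f] with x h1 h2
    rw [h2, h1]

theorem isClosed_evenSub : IsClosed (evenSub : Set L2R) :=
  ContinuousLinearMap.isClosed_ker _

/-- The elements of `L²(ℝ)` which vanish on `|x| < λ`. -/
def vanSub (lam : ℝ) : Submodule ℂ L2R :=
  LinearMap.ker (LpToLpRestrictCLM ℝ ℂ ℂ volume 2 {x : ℝ | |x| < lam}).toLinearMap

theorem measurableSet_abs_lt (lam : ℝ) : MeasurableSet {x : ℝ | |x| < lam} :=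
  (isOpen_lt continuous_abs continuous_const).measurableSet

theorem mem_vanSub {lam : ℝ} {f : L2R} :
    f ∈ vanSub lam ↔ ∀ᵐ x : ℝ, |x| < lam → f x = 0 := by
  have e : (∀ᵐ x : ℝ, |x| < lam → f x = 0) ↔
      ∀ᵐ x : ℝ ∂volume.restrict {x : ℝ | |x| < lam}, f x = 0 :=
    (ae_restrict_iff' (measurableSet_abs_lt lam)).symm
  rw [vanSub, LinearMap.mem_ker, e]
  have h := LpToLpRestrictCLM_coeFn (F := ℂ) (p := 2) ℂ (μ := volume) {x : ℝ | |x| < lam} f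
  constructor
  · intro h0
    change LpToLpRestrictCLM ℝ ℂ ℂ volume 2 {x : ℝ | |x| < lam} f = 0 at h0
    rw [h0] at h
    filter_upwards [h, Lp.coeFn_zero ℂ 2 (volume.restrict {x : ℝ | |x| < lam})] with x h1 h2
    rw [← h1, h2, Pi.zero_apply]
  · intro h0
    refine Lp.ext ?_
    refine h.trans ?_
    filter_upwards [h0, Lp.coeFn_zero ℂ 2 (volume.restrict {x : ℝ | |x| < lam})] with x h1 h2
    rw [h1, h2, Pi.zero_apply]

theorem isClosed_vanSub (lam : ℝ) : IsClosed (vanSub lam : Set L2R) :=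
  ContinuousLinearMap.isClosed_ker _

theorem mem_soninR {lam : ℝ} {f : L2R} :
    f ∈ soninR lam ↔ f ∈ evenSub ∧ f ∈ vanSub lam ∧ (𝓕 f : L2R) ∈ vanSub lam := by
  rw [mem_evenSub, mem_vanSub, mem_vanSub]
  rfl

/-- Closedness provides the completeness that is later transported to `spaceB`. -/
theorem isClosed_soninR (lam : ℝ) : IsClosed (soninR lam : Set L2R) := by
  have h : (soninR lam : Set L2R) = (evenSub : Set L2R) ∩ ((vanSub lam : Set L2R) ∩
      (Lp.fourierTransformₗᵢ ℝ ℂ) ⁻¹' (vanSub lam : Set L2R)) := by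
    ext f
    exact mem_soninR
  rw [h]
  exact isClosed_evenSub.inter ((isClosed_vanSub lam).inter
    ((isClosed_vanSub lam).preimage (Lp.fourierTransformₗᵢ ℝ ℂ).continuous))

/-! ### Dilations -/

theorem map_div_volume {c : ℝ} (hc : 0 < c) :
    (volume : Measure ℝ).map (fun x => x / c) = ENNReal.ofReal c • volume := by
  have h := Real.map_volume_mul_right (a := c⁻¹) (by positivity)
  rw [inv_inv, abs_of_pos hc] at h
  simpa only [div_eq_mul_inv] using h

theorem quasiMeasurePreserving_div {c : ℝ} (hc : 0 < c) :
    Measure.QuasiMeasurePreserving (fun x : ℝ => x / c) volume volume :=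
  ⟨by fun_prop, by rw [map_div_volume hc]; exact Measure.smul_absolutelyContinuous⟩

theorem eLpNorm_comp_div {c : ℝ} (hc : 0 < c) {f : ℝ → ℂ} (hf : AEStronglyMeasurable f volume) :
    eLpNorm (fun x => f (x / c)) 2 volume
      = ENNReal.ofReal (c ^ (1 / 2 : ℝ)) * eLpNorm f 2 volume := by
  have hm : Measurable fun x : ℝ => x / c := by fun_prop
  have h := eLpNorm_map_measure (p := 2) (f := fun x : ℝ => x / c) (μ := volume) (g := f)
    (by rw [map_div_volume hc]; exact hf.mono_ac Measure.smul_absolutelyContinuous)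
    hm.aemeasurable
  rw [map_div_volume hc, eLpNorm_smul_measure_of_ne_top (by norm_num)] at h
  refine h.symm.trans ?_
  rw [smul_eq_mul, ENNReal.ofReal_rpow_of_pos hc]
  norm_num

theorem memLp_comp_div {c : ℝ} (hc : 0 < c) {f : ℝ → ℂ} (hf : MemLp f 2 volume) :
    MemLp (fun x => f (x / c)) 2 (volume : Measure ℝ) := by
  refine ⟨hf.1.comp_quasiMeasurePreserving (quasiMeasurePreserving_div hc), ?_⟩
  rw [eLpNorm_comp_div hc hf.1]
  exact ENNReal.mul_lt_top ENNReal.ofReal_lt_top hf.2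

/-- The dilation `f ↦ f (· / c)` of `L²(ℝ)`. -/
def dil {c : ℝ} (hc : 0 < c) : L2R →L[ℂ] L2R :=
  LinearMap.mkContinuous
    { toFun := fun f => (memLp_comp_div hc (Lp.memLp f)).toLp
      map_add' := fun f g => by
        refine Lp.ext ?_
        filter_upwards [(memLp_comp_div hc (Lp.memLp (f + g))).coeFn_toLp,
          (memLp_comp_div hc (Lp.memLp f)).coeFn_toLp, (memLp_comp_div hc (Lp.memLp g)).coeFn_toLp,
          Lp.coeFn_add (memLp_comp_div hc (Lp.memLp f)).toLp (memLp_comp_div hc (Lp.memLp g)).toLp,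
          (quasiMeasurePreserving_div hc).ae (Lp.coeFn_add f g)] with x h1 h2 h3 h4 h5
        rw [h1, h4, Pi.add_apply, h2, h3, h5, Pi.add_apply]
      map_smul' := fun a f => by
        refine Lp.ext ?_
        filter_upwards [(memLp_comp_div hc (Lp.memLp (a • f))).coeFn_toLp,
          (memLp_comp_div hc (Lp.memLp f)).coeFn_toLp,
          Lp.coeFn_smul a (memLp_comp_div hc (Lp.memLp f)).toLp,
          (quasiMeasurePreserving_div hc).ae (Lp.coeFn_smul a f)] with x h1 h2 h4 h5
        rw [h1, RingHom.id_apply, h4, Pi.smul_apply, h2, h5, Pi.smul_apply] }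
    (c ^ (1 / 2 : ℝ)) fun f => by
      change ‖(memLp_comp_div hc (Lp.memLp f)).toLp‖ ≤ _
      rw [Lp.norm_toLp, eLpNorm_comp_div hc (Lp.aestronglyMeasurable f), ENNReal.toReal_mul,
        ENNReal.toReal_ofReal (by positivity), Lp.norm_def]

theorem dil_ae {c : ℝ} (hc : 0 < c) (f : L2R) : dil hc f =ᵐ[volume] fun x => f (x / c) :=
  (memLp_comp_div hc (Lp.memLp f)).coeFn_toLp

theorem norm_dil_le {c : ℝ} (hc : 0 < c) : ‖dil hc‖ ≤ c ^ (1 / 2 : ℝ) :=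
  LinearMap.mkContinuous_norm_le _ (by positivity) _

/-- Invertibility is the Neumann series. For a closed `A`-stable `V`, if `x - A x` lies in `V` then
so does each partial sum `x - Aⁿ x`, and these tend to `x`. -/
theorem exists_equiv_one_sub {E : Type*} [NormedAddCommGroup E] [NormedSpace ℂ E] [CompleteSpace E]
    (A : E →L[ℂ] E) (hA : ‖A‖ < 1) :
    ∃ e : E ≃L[ℂ] E, (∀ x, e x = x - A x) ∧ ∀ V : Submodule ℂ E, IsClosed (V : Set E) →
      (∀ x ∈ V, A x ∈ V) → ∀ x, x ∈ V ↔ e x ∈ V := by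
  refine ⟨ContinuousLinearEquiv.unitsEquiv ℂ E (Units.oneSub A hA), fun x => rfl, ?_⟩
  intro V hV hAV x
  change x ∈ V ↔ x - A x ∈ V
  refine ⟨fun hx => V.sub_mem hx (hAV x hx), fun hx => ?_⟩
  have h1 : ∀ n : ℕ, x - (A ^ n) x ∈ V := by
    intro n
    induction n with
    | zero => simp
    | succ n ih =>
      have h2 : x - (A ^ (n + 1)) x = (x - A x) + A (x - (A ^ n) x) := by
        rw [pow_succ', map_sub]
        simp
      rw [h2]
      exact V.add_mem hx (hAV _ ih)
  have h3 : Filter.Tendsto (fun n : ℕ => x - (A ^ n) x) Filter.atTop (𝓝 (x - 0)) := by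
    refine tendsto_const_nhds.sub ?_
    have h4 := ((ContinuousLinearMap.apply ℂ E x).continuous.tendsto 0).comp
      (tendsto_pow_atTop_nhds_zero_of_norm_lt_one hA)
    simpa [Function.comp_def] using h4
  rw [sub_zero] at h3
  exact hV.mem_of_tendsto h3 (Filter.Eventually.of_forall h1)

/-- The integrand of the Mellin integral in `checkM`. -/
def mellinKer (f : ℝ → ℂ) (z : ℂ) (t : ℝ) : ℂ := f t * (t : ℂ) ^ (1 - z) / t

theorem mellinKer_comp_div {c : ℝ} (hc : 0 < c) (f : ℝ → ℂ) (z : ℂ) {t : ℝ} (ht : 0 < t) :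
    mellinKer (fun x => f (x / c)) z t = (c : ℂ) ^ (-z) * mellinKer f z (c⁻¹ * t) := by
  have e : t = c * (c⁻¹ * t) := by field_simp
  have hy : 0 < c⁻¹ * t := by positivity
  have hc' : (c : ℂ) ≠ 0 := by exact_mod_cast hc.ne'
  rw [mellinKer, mellinKer]
  generalize c⁻¹ * t = y at *
  subst e
  have hy' : (y : ℂ) ≠ 0 := by exact_mod_cast hy.ne'
  rw [mul_div_cancel_left₀ _ hc.ne', Complex.ofReal_mul, Complex.mul_cpow_ofReal_nonneg hc.le hy.le,
    sub_eq_add_neg, Complex.cpow_add _ _ hc', Complex.cpow_one]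
  field_simp

/-- Substitution `t = c y`. With `c = p` and the coefficient `p⁻¹`, the factor `c · c^(-z)` is what
produces the Euler factor `1 - p^(-z)`. -/
theorem mellin_comp_div {c : ℝ} (hc : 0 < c) (f : ℝ → ℂ) (z : ℂ)
    (hf : IntegrableOn (mellinKer f z) (Set.Ioi 0)) :
    IntegrableOn (mellinKer (fun x => f (x / c)) z) (Set.Ioi 0) ∧
      ∫ t in Set.Ioi (0 : ℝ), mellinKer (fun x => f (x / c)) z t
        = c * (c : ℂ) ^ (-z) * ∫ t in Set.Ioi (0 : ℝ), mellinKer f z t := by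
  have hci : 0 < c⁻¹ := by positivity
  have h := fun t (ht : t ∈ Set.Ioi (0 : ℝ)) => mellinKer_comp_div hc f z ht
  constructor
  · have h1 : IntegrableOn (fun t => mellinKer f z (c⁻¹ * t)) (Set.Ioi 0) := by
      rw [integrableOn_Ioi_comp_mul_left_iff _ _ hci, mul_zero]
      exact hf
    exact IntegrableOn.congr_fun (h1.const_mul _) (fun t ht => (h t ht).symm) measurableSet_Ioi
  · rw [setIntegral_congr_fun measurableSet_Ioi h, integral_const_mul,
      integral_comp_mul_left_Ioi _ _ hci, mul_zero, inv_inv]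
    rw [Complex.real_smul]
    ring

/-- The function `θ (f)` on the real line: the product over `p ∈ S` of the operators
`f ↦ f - p⁻¹ f (· / p)`. -/
def thetaFun (S : Finset Nat.Primes) (f : ℝ → ℂ) (u : ℝ) : ℂ :=
  ∑ T ∈ S.powerset, (∏ p ∈ T, (-((p : ℕ) : ℂ)⁻¹)) * f (u / ∏ p ∈ T, ((p : ℕ) : ℝ))

/-- The subsets of `insert p S` are those of `S`, with or without `p`; this exhibits the operator as
a composition and drives the induction. -/
theorem thetaFun_insert {S : Finset Nat.Primes} {p : Nat.Primes} (hp : p ∉ S) (f : ℝ → ℂ)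
    (u : ℝ) : thetaFun (insert p S) f u
      = thetaFun S f u - ((p : ℕ) : ℂ)⁻¹ * thetaFun S f (u / ((p : ℕ) : ℝ)) := by
  rw [thetaFun, Finset.sum_powerset_insert hp, ← thetaFun, sub_eq_add_neg, thetaFun, thetaFun,
    ← neg_mul, Finset.mul_sum]
  congr 1
  refine Finset.sum_congr rfl fun T hT => ?_
  have hpT : p ∉ T := fun h => hp (Finset.mem_powerset.1 hT h)
  rw [Finset.prod_insert hpT, Finset.prod_insert hpT, mul_assoc, div_div]

/-- The real form of `θ_S` is invertible, is compatible with parity and with the vanishing near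
`0`, and multiplies the Mellin transform by the inverse Euler factors. -/
theorem exists_thetaEquiv (S : Finset Nat.Primes) :
    ∃ e : L2R ≃L[ℂ] L2R, (∀ f, e f =ᵐ[volume] thetaFun S f) ∧
      (∀ f, f ∈ evenSub ↔ e f ∈ evenSub) ∧
      (∀ lam f, f ∈ vanSub lam ↔ e f ∈ vanSub lam) ∧
      ∀ (f : L2R) (z : ℂ), IntegrableOn (mellinKer f z) (Set.Ioi 0) →
        IntegrableOn (mellinKer (e f) z) (Set.Ioi 0) ∧
        ∫ t in Set.Ioi (0 : ℝ), mellinKer (e f) z t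
          = (∏ p ∈ S, (1 - ((p : ℕ) : ℂ) ^ (-z))) * ∫ t in Set.Ioi (0 : ℝ), mellinKer f z t := by
  classical
  induction S using Finset.induction_on with
  | empty =>
    refine ⟨ContinuousLinearEquiv.refl ℂ L2R, fun f => ?_, fun f => Iff.rfl, fun _ f => Iff.rfl,
      fun f z h => ⟨h, by simp⟩⟩
    refine Filter.Eventually.of_forall fun x => ?_
    simp [thetaFun]
  | insert p S hp ih =>
    obtain ⟨e, h1, h2, h3, h4⟩ := ih
    have hp1 : (1 : ℝ) < ((p : ℕ) : ℝ) := by exact_mod_cast p.2.one_lt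
    have hp0 : (0 : ℝ) < ((p : ℕ) : ℝ) := by linarith
    let A : L2R →L[ℂ] L2R := ((p : ℕ) : ℂ)⁻¹ • dil hp0
    -- Dilation by `p` has norm at most `p^(1/2)`, so the coefficient `p⁻¹` wins.
    have hA : ‖A‖ < 1 := by
      rw [norm_smul, norm_inv, Complex.norm_natCast]
      calc _ ≤ ((p : ℕ) : ℝ)⁻¹ * ((p : ℕ) : ℝ) ^ (1 / 2 : ℝ) := by gcongr; exact norm_dil_le hp0
        _ = ((p : ℕ) : ℝ) ^ (-(1 / 2) : ℝ) := by
          rw [← Real.rpow_neg_one, ← Real.rpow_add hp0]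
          norm_num
        _ < 1 := Real.rpow_lt_one_of_one_lt_of_neg hp1 (by norm_num)
    have hAae : ∀ f, A f =ᵐ[volume] fun x => ((p : ℕ) : ℂ)⁻¹ * f (x / ((p : ℕ) : ℝ)) := by
      intro f
      filter_upwards [Lp.coeFn_smul (((p : ℕ) : ℂ)⁻¹) (dil hp0 f), dil_ae hp0 f] with x a b
      change (((p : ℕ) : ℂ)⁻¹ • dil hp0 f : L2R) x = _
      rw [a, Pi.smul_apply, b, smul_eq_mul]
    obtain ⟨d, d1, d2⟩ := exists_equiv_one_sub A hA
    have hdae : ∀ f, d f =ᵐ[volume] fun x => f x - ((p : ℕ) : ℂ)⁻¹ * f (x / ((p : ℕ) : ℝ)) := by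
      intro f
      rw [d1]
      filter_upwards [Lp.coeFn_sub f (A f), hAae f] with x a b
      rw [a, Pi.sub_apply, b]
    refine ⟨e.trans d, fun f => ?_, fun f => ?_, fun lam f => ?_, fun f z hf => ?_⟩
    · filter_upwards [hdae (e f), h1 f, (quasiMeasurePreserving_div hp0).ae (h1 f)] with x a b c
      change d (e f) x = _
      rw [a, b, c, thetaFun_insert hp]
    · rw [h2]
      refine d2 evenSub isClosed_evenSub (fun g hg => ?_) (e f)
      rw [mem_evenSub] at hg ⊢
      have h5 := (Measure.measurePreserving_neg (volume : Measure ℝ)).quasiMeasurePreserving.ae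
        (hAae g)
      filter_upwards [hAae g, h5, (quasiMeasurePreserving_div hp0).ae hg] with x a b c
      rw [a, b, neg_div, c]
    -- Stability holds because `p > 1`: the point `x / p` stays in `|x| < λ`.
    · rw [h3 lam]
      refine d2 (vanSub lam) (isClosed_vanSub lam) (fun g hg => ?_) (e f)
      rw [mem_vanSub] at hg ⊢
      filter_upwards [hAae g, (quasiMeasurePreserving_div hp0).ae hg] with x a c hx
      rw [a, c, mul_zero]
      rw [abs_div, abs_of_pos hp0]
      exact (div_le_self (abs_nonneg x) hp1.le).trans_lt hx
    · obtain ⟨i1, i2⟩ := h4 f z hf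
      obtain ⟨j1, j2⟩ := mellin_comp_div hp0 (e f) z i1
      have hk : mellinKer (d (e f)) z =ᵐ[volume.restrict (Set.Ioi 0)] fun t => mellinKer (e f) z t
          - ((p : ℕ) : ℂ)⁻¹ * mellinKer (fun x => e f (x / ((p : ℕ) : ℝ))) z t := by
        filter_upwards [ae_restrict_of_ae (hdae (e f))] with t ht
        rw [mellinKer, ht, mellinKer, mellinKer]
        ring
      change IntegrableOn (mellinKer (d (e f)) z) (Set.Ioi 0) ∧
        ∫ t in Set.Ioi (0 : ℝ), mellinKer (d (e f)) z t = _
      constructor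
      · exact (i1.sub (j1.const_mul _)).congr hk.symm
      · rw [integral_congr_ae hk, integral_sub i1 (j1.const_mul _), integral_const_mul, j2, i2,
          Finset.prod_insert hp]
        have : ((p : ℕ) : ℂ) ≠ 0 := by exact_mod_cast p.2.ne_zero
        push_cast
        field_simp

end

/-! ### `L²` limits, logarithmic coordinates and boundary values of Mellin transforms -/

section

theorem norm_toLp_sq {α : Type*} {m : MeasurableSpace α} {μ : Measure α} {f : α → ℂ}
    (hf : MemLp f 2 μ) : ‖hf.toLp‖ ^ 2 = ∫ x, ‖f x‖ ^ 2 ∂μ := by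
  rw [norm_sq_eq_re_inner (𝕜 := ℂ), L2.inner_def]
  have h : ∫ a, inner ℂ ((hf.toLp : Lp ℂ 2 μ) a) ((hf.toLp : Lp ℂ 2 μ) a) ∂μ = ((∫ x, ‖f x‖ ^ 2 ∂μ : ℝ) : ℂ) := by
    rw [← integral_complex_ofReal]
    refine integral_congr_ae ?_
    filter_upwards [hf.coeFn_toLp] with x hx
    rw [hx, inner_self_eq_norm_sq_to_K]
    push_cast
    rfl
  rw [h]
  rfl

/-- Dominated convergence for the squared distance, with majorant `4 ‖b‖²`. -/
theorem tendsto_toLp_of_dominated {α : Type*} {m : MeasurableSpace α} {μ : Measure α}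
    {f : ℕ → α → ℂ} {g b : α → ℂ} (hf : ∀ n, MemLp (f n) 2 μ) (hg : MemLp g 2 μ)
    (hb : MemLp b 2 μ) (hfb : ∀ n, ∀ᵐ x ∂μ, ‖f n x‖ ≤ ‖b x‖)
    (hlim : ∀ᵐ x ∂μ, Filter.Tendsto (fun n => f n x) Filter.atTop (𝓝 (g x))) :
    Filter.Tendsto (fun n => (hf n).toLp) Filter.atTop (𝓝 hg.toLp) := by
  rw [tendsto_iff_norm_sub_tendsto_zero]
  have h1 : ∀ n, ‖(hf n).toLp - hg.toLp‖ ^ 2 = ∫ x, ‖f n x - g x‖ ^ 2 ∂μ := by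
    intro n
    rw [← MemLp.toLp_sub, norm_toLp_sq]
    rfl
  have hgb : ∀ᵐ x ∂μ, ‖g x‖ ≤ ‖b x‖ := by
    filter_upwards [hlim, ae_all_iff.2 hfb] with x h2 h3
    exact le_of_tendsto h2.norm (Filter.Eventually.of_forall h3)
  have h2 : Filter.Tendsto (fun n => ∫ x, ‖f n x - g x‖ ^ 2 ∂μ) Filter.atTop
      (𝓝 (∫ _, 0 ∂μ)) := by
    refine tendsto_integral_of_dominated_convergence (fun x => 4 * ‖b x‖ ^ 2)
      (fun n => (((hf n).1.sub hg.1).norm.pow 2))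
      (((memLp_two_iff_integrable_sq_norm hb.1).1 hb).const_mul 4) (fun n => ?_) ?_
    · filter_upwards [hfb n, hgb] with x h3 h4
      rw [Real.norm_of_nonneg (by positivity)]
      have h5 : ‖f n x - g x‖ ≤ 2 * ‖b x‖ := (norm_sub_le _ _).trans (by linarith)
      calc _ ≤ (2 * ‖b x‖) ^ 2 := by gcongr
        _ = _ := by ring
    · filter_upwards [hlim] with x h3
      have h4 := ((h3.sub_const (g x)).norm).pow 2
      simpa using h4
  simp only [← h1, integral_zero] at h2
  have h3 := h2.sqrt
  simpa [Real.sqrt_sq (norm_nonneg _)] using h3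

/-! ### The substitution `u = exp (2πτ)` -/

/-- The map `τ ↦ exp (2πτ)`. -/
def expMap (τ : ℝ) : ℝ := Real.exp (2 * Real.pi * τ)

theorem expMap_pos (τ : ℝ) : 0 < expMap τ := Real.exp_pos _

theorem measurable_expMap : Measurable expMap := by
  unfold expMap; fun_prop

theorem hasDerivWithinAt_expMap (s : Set ℝ) (τ : ℝ) :
    HasDerivWithinAt expMap (expMap τ * (2 * Real.pi)) s τ := by
  have h1 : HasDerivAt (fun τ : ℝ => 2 * Real.pi * τ) (2 * Real.pi) τ := by
    simpa using (hasDerivAt_id τ).const_mul (2 * Real.pi)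
  exact h1.exp.hasDerivWithinAt

theorem injective_expMap : Function.Injective expMap := fun _ _ hab =>
  mul_left_cancel₀ (by positivity) (Real.exp_injective hab)

theorem range_expMap : Set.range expMap = Set.Ioi 0 := by
  ext u
  constructor
  · rintro ⟨τ, rfl⟩
    exact expMap_pos τ
  · intro hu
    refine ⟨Real.log u / (2 * Real.pi), ?_⟩
    rw [expMap, mul_div_cancel₀ _ (by positivity), Real.exp_log hu]

theorem quasiMeasurePreserving_expMap :
    Measure.QuasiMeasurePreserving expMap volume (volume.restrict (Set.Ioi (0 : ℝ))) := by
  refine ⟨measurable_expMap, Measure.AbsolutelyContinuous.mk fun s hs h0 => ?_⟩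
  rw [Measure.restrict_apply hs] at h0
  rw [Measure.map_apply measurable_expMap hs]
  have hs' := measurable_expMap hs
  have h1 := lintegral_image_eq_lintegral_abs_deriv_mul (s := expMap ⁻¹' s) (f := expMap)
    hs' (fun τ _ => hasDerivWithinAt_expMap _ τ) injective_expMap.injOn (fun _ => 1)
  rw [Set.image_preimage_eq_inter_range, range_expMap, setLIntegral_one, h0] at h1
  have hm : Measurable fun τ => ENNReal.ofReal |expMap τ * (2 * Real.pi)| * 1 := by
    have := measurable_expMap
    fun_prop
  have h3 := (lintegral_eq_zero_iff hm).1 h1.symm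
  rw [Filter.EventuallyEq, ae_restrict_iff' hs'] at h3
  refine measure_eq_zero_iff_ae_notMem.2 ?_
  filter_upwards [h3] with τ h5 h6
  have h7 := h5 h6
  have h8 : 0 < |expMap τ * (2 * Real.pi)| :=
    abs_pos.2 (mul_pos (expMap_pos τ) (by positivity)).ne'
  simp only [mul_one, Pi.zero_apply, ENNReal.ofReal_eq_zero] at h7
  exact absurd h7 (not_le.2 h8)

theorem abs_deriv_expMap_smul {E : Type*} [NormedAddCommGroup E] [NormedSpace ℝ E] (g : ℝ → E)
    (τ : ℝ) : |expMap τ * (2 * Real.pi)| • ((expMap τ)⁻¹ • g (expMap τ))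
      = (2 * Real.pi) • g (expMap τ) := by
  have h := expMap_pos τ
  rw [abs_of_pos (by positivity), smul_smul]
  congr 1
  field_simp

theorem integral_comp_expMap {E : Type*} [NormedAddCommGroup E] [NormedSpace ℝ E] (g : ℝ → E) :
    ∫ u in Set.Ioi (0 : ℝ), u⁻¹ • g u = (2 * Real.pi) • ∫ τ, g (expMap τ) := by
  have h := integral_image_eq_integral_abs_deriv_smul MeasurableSet.univ
    (fun τ _ => hasDerivWithinAt_expMap _ τ) injective_expMap.injOn (fun u => u⁻¹ • g u)
  simp only [abs_deriv_expMap_smul] at h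
  rw [Set.image_univ, range_expMap, Measure.restrict_univ, integral_smul] at h
  exact h

theorem integrable_comp_expMap {E : Type*} [NormedAddCommGroup E] [NormedSpace ℝ E] (g : ℝ → E) :
    IntegrableOn (fun u => u⁻¹ • g u) (Set.Ioi (0 : ℝ)) ↔ Integrable fun τ => g (expMap τ) := by
  have h := integrableOn_image_iff_integrableOn_abs_deriv_smul MeasurableSet.univ
    (fun τ _ => hasDerivWithinAt_expMap _ τ) injective_expMap.injOn (fun u => u⁻¹ • g u)
  simp only [abs_deriv_expMap_smul] at h
  rw [Set.image_univ, range_expMap, integrableOn_univ] at h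
  rw [h]
  exact integrable_smul_iff (by positivity) _

/-! ### The operator `𝔽_μ ∘ w` -/

/-- `𝔽_μ ∘ w`, for `w (φ)(u) = u^{1/2} φ(u)`. -/
def mulF (φ : ℝ → ℂ) (h : MemLp φ 2 (volume.restrict (Set.Ioi (0 : ℝ)))) : L2R :=
  mulFourier _ (memLp_rpow_half_mul h)

theorem mulF_congr {φ ψ : ℝ → ℂ} (hφ : MemLp φ 2 (volume.restrict (Set.Ioi (0 : ℝ))))
    (hψ : MemLp ψ 2 (volume.restrict (Set.Ioi (0 : ℝ))))
    (h : φ =ᵐ[volume.restrict (Set.Ioi (0 : ℝ))] ψ) : mulF φ hφ = mulF ψ hψ := by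
  have e : (memLp_comp_exp (memLp_rpow_half_mul hφ)).toLp
      = (memLp_comp_exp (memLp_rpow_half_mul hψ)).toLp := by
    rw [MemLp.toLp_eq_toLp_iff]
    filter_upwards [quasiMeasurePreserving_expMap.ae h] with τ hτ
    change _ * φ (expMap τ) = _ * ψ (expMap τ)
    rw [hτ]
  rw [mulF, mulF, mulFourier, mulFourier, e]

/-- Plancherel gives `(2π)²`, the substitution `du/u = 2π dτ` takes back one factor `2π`, and the
weight `u^(1/2)` turns `du/u` into `du`. -/
theorem norm_mulF_sq {φ : ℝ → ℂ} (h : MemLp φ 2 (volume.restrict (Set.Ioi (0 : ℝ)))) :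
    ‖mulF φ h‖ ^ 2 = 2 * Real.pi * ∫ u in Set.Ioi (0 : ℝ), ‖φ u‖ ^ 2 := by
  rw [mulF, mulFourier, norm_smul, Lp.norm_fourier_eq, mul_pow, norm_toLp_sq, Complex.norm_real,
    Real.norm_of_nonneg (by positivity)]
  have h1 := integral_comp_expMap fun u : ℝ => ‖((u ^ (1 / 2 : ℝ) : ℝ) : ℂ) * φ u‖ ^ 2
  have h2 : ∫ u in Set.Ioi (0 : ℝ), u⁻¹ • ‖((u ^ (1 / 2 : ℝ) : ℝ) : ℂ) * φ u‖ ^ 2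
      = ∫ u in Set.Ioi (0 : ℝ), ‖φ u‖ ^ 2 := by
    refine setIntegral_congr_fun measurableSet_Ioi fun u hu => ?_
    have hu0 : (0 : ℝ) < u := hu
    simp only [smul_eq_mul]
    rw [norm_mul, mul_pow, Complex.norm_real, Real.norm_eq_abs, sq_abs, ← Real.sqrt_eq_rpow,
      Real.sq_sqrt hu0.le, inv_mul_cancel_left₀ hu0.ne']
  rw [h2] at h1
  rw [h1, smul_eq_mul]
  unfold expMap
  ring

theorem Uinf_eq (f : L2R) : Uinf f = mulF f ((Lp.memLp f).restrict (Set.Ioi (0 : ℝ))) := rfl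

theorem norm_Uinf_sq {f : L2R} (hf : f ∈ evenSub) : ‖Uinf f‖ ^ 2 = Real.pi * ‖f‖ ^ 2 := by
  have hi := (memLp_two_iff_integrable_sq_norm (Lp.aestronglyMeasurable f)).1 (Lp.memLp f)
  have h : ‖f‖ ^ 2 = ∫ x, ‖f x‖ ^ 2 := by
    rw [← norm_toLp_sq (Lp.memLp f), Lp.toLp_coeFn]
  have h1 := integral_eq_two_mul_of_even (f := fun x => ((‖f x‖ ^ 2 : ℝ) : ℂ)) hi.ofReal (by
    filter_upwards [mem_evenSub.1 hf] with x hx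
    rw [hx])
  rw [integral_complex_ofReal, integral_complex_ofReal] at h1
  have h2 : ∫ x, ‖f x‖ ^ 2 = 2 * ∫ x in Set.Ioi (0 : ℝ), ‖f x‖ ^ 2 := by exact_mod_cast h1
  rw [Uinf_eq, norm_mulF_sq, h, h2]
  ring

/-- The boundary values on the critical line of a Mellin transform. -/
theorem critical_of_mellin {lam : ℝ} (hlam : 0 < lam) {h : L2R} (hv : h ∈ vanSub lam)
    (hint : ∀ z : ℂ, 1 / 2 < z.re → IntegrableOn (mellinKer h z) (Set.Ioi 0)) {A F : ℂ → ℂ}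
    (hA : ∀ s : ℝ, ContinuousAt A (1 / 2 + Complex.I * s))
    (hF : ∀ s : ℝ, ContinuousAt F (1 / 2 + Complex.I * s))
    (heq : ∀ z : ℂ, 1 / 2 < z.re → A z * ∫ t in Set.Ioi (0 : ℝ), mellinKer h z t = F z) :
    ∀ᵐ s : ℝ, A (1 / 2 + Complex.I * s) * Uinf h s = F (1 / 2 + Complex.I * s) := by
  have hg := memLp_comp_exp (memLp_rpow_half_mul ((Lp.memLp h).restrict (Set.Ioi (0 : ℝ))))
  let g : ℝ → ℂ := fun τ => ((expMap τ ^ (1 / 2 : ℝ) : ℝ) : ℂ) * h (expMap τ)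
  change MemLp g 2 volume at hg
  -- The critical line is approached from the right along `Re z = 1/2 + ε n`, where the Mellin
  -- integral converges absolutely; the shift multiplies `g` by `u^(-ε n)`.
  let ε : ℕ → ℝ := fun n => 1 / ((n : ℝ) + 1)
  have hε0 : ∀ n, 0 < ε n := fun n => by positivity
  have hε1 : ∀ n, ε n ≤ 1 := fun n => by
    rw [div_le_one (by positivity)]
    linarith [Nat.cast_nonneg (α := ℝ) n]
  have hεt : Filter.Tendsto ε Filter.atTop (𝓝 0) := tendsto_one_div_add_atTop_nhds_zero_nat
  let gn : ℕ → ℝ → ℂ := fun n τ => ((expMap τ ^ (-ε n) : ℝ) : ℂ) * g τ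
  have hvg : ∀ᵐ τ : ℝ, expMap τ < lam → g τ = 0 := by
    filter_upwards [quasiMeasurePreserving_expMap.ae (ae_restrict_of_ae (mem_vanSub.1 hv))]
      with τ h1 h2
    simp only [g]
    rw [h1 (by rwa [abs_of_pos (expMap_pos τ)]), mul_zero]
  -- Only `u ≥ λ` matters, since `h` vanishes below. There `u^(-ε) ≤ λ^(-ε) ≤ 1 + λ⁻¹` for `0 < ε ≤
  -- 1`, a majorant independent of `n`.
  have hbd : ∀ n, ∀ᵐ τ : ℝ, ‖gn n τ‖ ≤ ‖((1 + lam⁻¹ : ℝ) : ℂ) * g τ‖ := by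
    intro n
    filter_upwards [hvg] with τ h1
    by_cases h2 : expMap τ < lam
    · simp [gn, h1 h2]
    · change ‖((expMap τ ^ (-ε n) : ℝ) : ℂ) * g τ‖ ≤ _
      rw [norm_mul, norm_mul ((1 + lam⁻¹ : ℝ) : ℂ)]
      refine mul_le_mul_of_nonneg_right ?_ (norm_nonneg (g τ))
      rw [Complex.norm_real, Complex.norm_real, Real.norm_of_nonneg (Real.rpow_nonneg
        (expMap_pos τ).le _), Real.norm_of_nonneg (by positivity)]
      calc expMap τ ^ (-ε n) ≤ lam ^ (-ε n) :=
            Real.rpow_le_rpow_of_nonpos hlam (not_lt.1 h2) (by linarith [hε0 n])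
        _ ≤ 1 + lam⁻¹ := by
          rcases le_total 1 lam with h3 | h3
          · have := Real.rpow_le_one_of_one_le_of_nonpos h3 (show -ε n ≤ 0 by linarith [hε0 n])
            have : 0 < lam⁻¹ := by positivity
            linarith
          · have h4 : lam ^ (-ε n) ≤ lam ^ (-1 : ℝ) :=
              Real.rpow_le_rpow_of_exponent_ge hlam h3 (by linarith [hε1 n])
            rw [Real.rpow_neg_one] at h4
            linarith
  have hgnm : ∀ n, AEStronglyMeasurable (gn n) volume := by
    intro n
    refine AEStronglyMeasurable.mul (Measurable.aestronglyMeasurable ?_) hg.1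
    have := measurable_expMap
    fun_prop
  have hb : MemLp (fun τ => ((1 + lam⁻¹ : ℝ) : ℂ) * g τ) 2 volume := hg.const_mul ((1 + lam⁻¹ : ℝ) : ℂ)
  have hgn : ∀ n, MemLp (gn n) 2 volume := fun n => hb.mono (hgnm n) (hbd n)
  have hlim : ∀ᵐ τ : ℝ, Filter.Tendsto (fun n => gn n τ) Filter.atTop (𝓝 (g τ)) := by
    refine Filter.Eventually.of_forall fun τ => ?_
    have h1 : Filter.Tendsto (fun n => expMap τ ^ (-ε n)) Filter.atTop (𝓝 (expMap τ ^ (-0 : ℝ))) :=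
      ((Real.continuousAt_const_rpow (expMap_pos τ).ne').tendsto).comp hεt.neg
    rw [neg_zero, Real.rpow_zero] at h1
    have h2 := ((Complex.continuous_ofReal.tendsto 1).comp h1).mul_const (g τ)
    simpa [gn, Function.comp_def] using h2
  have hz : ∀ n (s : ℝ), (1 / 2 : ℝ) < ((1 / 2 + ε n : ℂ) + Complex.I * s).re := fun n s => by
    have := hε0 n
    simp
    exact this
  have hker : ∀ n (s τ : ℝ), h (expMap τ) * (expMap τ : ℂ) ^
      (1 - ((1 / 2 + ε n : ℂ) + Complex.I * s))
      = Complex.exp (((-2 * Real.pi * τ * s : ℝ) : ℂ) * Complex.I) * gn n τ := by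
    intro n s τ
    have hc : (expMap τ : ℂ) = Complex.exp ((2 * Real.pi * τ : ℝ) : ℂ) := by
      rw [expMap, Complex.ofReal_exp]
    have hr : ∀ a : ℝ, ((expMap τ ^ a : ℝ) : ℂ) = Complex.exp ((2 * Real.pi * τ * a : ℝ) : ℂ) := by
      intro a
      rw [expMap, ← Real.exp_mul, Complex.ofReal_exp]
    have hp : ∀ w : ℂ, (expMap τ : ℂ) ^ w = Complex.exp ((2 * Real.pi * τ : ℝ) * w) := by
      intro w
      rw [Complex.cpow_def_of_ne_zero (by exact_mod_cast (expMap_pos τ).ne'), hc,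
        ← Complex.ofReal_exp, ← Complex.ofReal_log (Real.exp_pos _).le, Real.log_exp]
    simp only [gn, g]
    rw [hp, hr, hr, ← mul_assoc, ← mul_assoc, ← Complex.exp_add, ← Complex.exp_add, mul_comm]
    congr 2
    push_cast
    ring
  have hmk : ∀ z : ℂ, mellinKer h z = fun u => u⁻¹ • (h u * (u : ℂ) ^ (1 - z)) := by
    intro z
    funext u
    rw [mellinKer, Complex.real_smul, Complex.ofReal_inv, div_eq_inv_mul]
  -- At `s = 0` the oscillating factor is `1`, so absolute convergence of the Mellin integral there
  -- is integrability of `gn n`.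
  have hgni : ∀ n, Integrable (gn n) := by
    intro n
    have h1 := hint _ (hz n 0)
    rw [hmk, integrable_comp_expMap] at h1
    refine h1.congr (Filter.Eventually.of_forall fun τ => ?_)
    simp only
    rw [hker]
    simp
  have hfour : ∀ n (s : ℝ), ((2 * Real.pi : ℝ) : ℂ) * 𝓕 (gn n) s
      = ∫ t in Set.Ioi (0 : ℝ), mellinKer h ((1 / 2 + ε n : ℂ) + Complex.I * s) t := by
    intro n s
    rw [hmk, integral_comp_expMap, Real.fourier_eq', Complex.real_smul]
    congr 1
    refine integral_congr_ae (Filter.Eventually.of_forall fun τ => ?_)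
    simp only
    rw [hker]
    simp only [RCLike.inner_apply, conj_trivial, smul_eq_mul]
    congr 3
    push_cast
    ring
  have hT : Filter.Tendsto (fun n => (𝓕 (hgn n).toLp : L2R)) Filter.atTop (𝓝 (𝓕 hg.toLp)) :=
    ((Lp.fourierTransformₗᵢ ℝ ℂ).continuous.tendsto _).comp
      (tendsto_toLp_of_dominated hgn hg hb hbd hlim)
  -- `L²` convergence gives almost everywhere convergence only along a subsequence, which suffices
  -- since `A` and `F` are continuous at the limit point.
  obtain ⟨ns, hns, hae⟩ := (tendstoInMeasure_of_tendsto_Lp hT).exists_seq_tendsto_ae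
  have hall : ∀ᵐ s : ℝ, ∀ n, (𝓕 (hgn n).toLp : L2R) s = 𝓕 (gn n) s :=
    ae_all_iff.2 fun n => fourier_toLp_ae_eq (hgni n) (hgn n)
  have hU : Uinf h =ᵐ[volume] fun s => ((2 * Real.pi : ℝ) : ℂ) * (𝓕 hg.toLp : L2R) s := by
    filter_upwards [Lp.coeFn_smul ((2 * Real.pi : ℝ) : ℂ) (𝓕 hg.toLp : L2R)] with s hs
    exact hs
  filter_upwards [hae, hall, hU] with s h1 h2 h3
  have hzt : Filter.Tendsto (fun n => (1 / 2 + ε (ns n) : ℂ) + Complex.I * s) Filter.atTop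
      (𝓝 (1 / 2 + Complex.I * s)) := by
    have h4 := (Complex.continuous_ofReal.tendsto 0).comp (hεt.comp hns.tendsto_atTop)
    have h5 := (h4.const_add (1 / 2 : ℂ)).add_const (Complex.I * s)
    simpa [Function.comp_def] using h5
  have hL : Filter.Tendsto (fun n => A ((1 / 2 + ε (ns n) : ℂ) + Complex.I * s) *
      (((2 * Real.pi : ℝ) : ℂ) * (𝓕 (hgn (ns n)).toLp : L2R) s)) Filter.atTop
      (𝓝 (A (1 / 2 + Complex.I * s) * Uinf h s)) := by
    rw [h3]
    exact ((hA s).tendsto.comp hzt).mul (h1.const_mul _)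
  have hR := (hF s).tendsto.comp hzt
  refine tendsto_nhds_unique hL (hR.congr fun n => ?_)
  rw [Function.comp_apply, h2, hfour, heq _ (hz _ _)]

end

section

variable (p : ℕ) [Fact p.Prime]

/-! ### The character `e_p` -/

/-- The numerator is divisible by the power of `p` in the denominator. This is the injectivity of
`ℤ[1/p]/ℤ → ℚ_p/ℤ_p`. -/
theorem exists_int_of_padic_frac {r : ℚ} (hr : ∃ (a : ℤ) (n : ℕ), r = a / (p : ℚ) ^ n)
    (h : ‖(r : ℚ_[p])‖ ≤ 1) : ∃ m : ℤ, r = m := by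
  obtain ⟨a, n, rfl⟩ := hr
  have hp0 : (p : ℚ) ≠ 0 := by exact_mod_cast (Fact.out : p.Prime).ne_zero
  have hpos : (0 : ℝ) < (p : ℝ) ^ n := by
    have : (0 : ℝ) < p := by exact_mod_cast (Fact.out : p.Prime).pos
    positivity
  push_cast at h
  rw [norm_div, norm_pow, Padic.norm_p, inv_pow, div_inv_eq_mul] at h
  have h1 : ‖(a : ℚ_[p])‖ ≤ (p : ℝ) ^ (-n : ℤ) := by
    rw [zpow_neg, zpow_natCast, ← one_div, le_div_iff₀ hpos]
    exact h
  obtain ⟨m, hm⟩ := (Padic.norm_int_le_pow_iff_dvd a n).1 h1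
  refine ⟨m, ?_⟩
  rw [hm]
  push_cast
  field_simp

theorem padic_frac_add {r s : ℚ} (hr : ∃ (a : ℤ) (n : ℕ), r = a / (p : ℚ) ^ n)
    (hs : ∃ (a : ℤ) (n : ℕ), s = a / (p : ℚ) ^ n) :
    ∃ (a : ℤ) (n : ℕ), r + s = a / (p : ℚ) ^ n := by
  obtain ⟨a, n, rfl⟩ := hr
  obtain ⟨b, m, rfl⟩ := hs
  have hp0 : (p : ℚ) ≠ 0 := by exact_mod_cast (Fact.out : p.Prime).ne_zero
  refine ⟨a * p ^ m + b * p ^ n, n + m, ?_⟩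
  push_cast
  field_simp
  ring

theorem padic_frac_neg (q : ℕ) {r : ℚ} (hr : ∃ (a : ℤ) (n : ℕ), r = a / (q : ℚ) ^ n) :
    ∃ (a : ℤ) (n : ℕ), -r = a / (q : ℚ) ^ n := by
  obtain ⟨a, n, rfl⟩ := hr
  exact ⟨-a, n, by push_cast; ring⟩

theorem norm_sub_le_max_padic (x y : ℚ_[p]) : ‖x - y‖ ≤ max ‖x‖ ‖y‖ := by
  have h := IsUltrametricDist.norm_add_le_max x (-y)
  rwa [norm_neg, ← sub_eq_add_neg] at h

/-- Two fractions approximating `x` differ by an integer, so the representative chosen in the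
definition is immaterial. -/
theorem padicChar_eq {x : ℚ_[p]} {r : ℚ} (hr : ∃ (a : ℤ) (n : ℕ), r = a / (p : ℚ) ^ n)
    (h : ‖x - (r : ℚ_[p])‖ ≤ 1) :
    padicChar p x = Complex.exp (2 * Real.pi * Complex.I * (r : ℂ)) := by
  obtain ⟨hs, hs'⟩ := (exists_padic_frac p x).choose_spec
  rw [padicChar]
  generalize (exists_padic_frac p x).choose = s at *
  obtain ⟨m, hm⟩ := exists_int_of_padic_frac p (padic_frac_add p hs (padic_frac_neg p hr)) (by
    have e : ((s + -r : ℚ) : ℚ_[p]) = (x - (r : ℚ_[p])) - (x - (s : ℚ_[p])) := by push_cast; ring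
    rw [e]
    exact (norm_sub_le_max_padic p _ _).trans (max_le h hs'))
  have hm' : s = r + m := by linarith
  rw [hm', Complex.exp_eq_exp_iff_exists_int]
  refine ⟨m, ?_⟩
  push_cast
  ring

theorem padicChar_add (x y : ℚ_[p]) : padicChar p (x + y) = padicChar p x * padicChar p y := by
  obtain ⟨r, hr, hr'⟩ := exists_padic_frac p x
  obtain ⟨s, hs, hs'⟩ := exists_padic_frac p y
  rw [padicChar_eq p hr hr', padicChar_eq p hs hs', ← Complex.exp_add,
    padicChar_eq p (padic_frac_add p hr hs)]
  · congr 1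
    push_cast
    ring
  · have e : x + y - ((r + s : ℚ) : ℚ_[p]) = (x - (r : ℚ_[p])) + (y - (s : ℚ_[p])) := by
      push_cast; ring
    rw [e]
    exact (IsUltrametricDist.norm_add_le_max _ _).trans (max_le hr' hs')

theorem padicChar_eq_one {x : ℚ_[p]} (hx : ‖x‖ ≤ 1) : padicChar p x = 1 := by
  rw [padicChar_eq p (r := 0) ⟨0, 0, by simp⟩ (by simpa using hx)]
  simp

theorem norm_padicChar (x : ℚ_[p]) : ‖padicChar p x‖ = 1 := by
  obtain ⟨r, hr, hr'⟩ := exists_padic_frac p x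
  rw [padicChar_eq p hr hr']
  have e : (2 * Real.pi * Complex.I * (r : ℂ) : ℂ) = ((2 * Real.pi * r : ℝ) : ℂ) * Complex.I := by
    push_cast; ring
  rw [e, Complex.norm_exp_ofReal_mul_I]

theorem continuous_padicChar : Continuous (padicChar p) := by
  refine IsLocallyConstant.continuous ?_
  rw [IsLocallyConstant.iff_eventually_eq]
  intro x
  filter_upwards [Metric.closedBall_mem_nhds x one_pos] with y hy
  have h : ‖y - x‖ ≤ 1 := by simpa [dist_eq_norm] using hy
  have e : y = (y - x) + x := by ring
  rw [e, padicChar_add, padicChar_eq_one p h, one_mul]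

theorem padicChar_inv_p_ne_one : padicChar p ((p : ℚ_[p])⁻¹) ≠ 1 := by
  have hp : 1 < p := (Fact.out : p.Prime).one_lt
  rw [padicChar_eq p (r := (p : ℚ)⁻¹) ⟨1, 1, by simp⟩ (by simp), Ne, Complex.exp_eq_one_iff]
  rintro ⟨n, hn⟩
  have hpi : (2 * Real.pi * Complex.I : ℂ) ≠ 0 := by simp [Real.pi_ne_zero]
  have h1 : ((p : ℚ)⁻¹ : ℚ) = n := by
    rw [mul_comm (n : ℂ)] at hn
    exact_mod_cast mul_left_cancel₀ hpi hn
  have hp0 : (p : ℚ) ≠ 0 := by positivity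
  have h2 : (1 : ℤ) = n * p := by
    have : (1 : ℚ) = n * p := by rw [← h1]; field_simp
    exact_mod_cast this
  have h3 : (p : ℤ) ∣ 1 := ⟨n, by rw [h2]; ring⟩
  have h4 := Int.le_of_dvd one_pos h3
  omega

/-- The witness is `x = (p y)⁻¹`: then `x y = 1/p`, on which `e_p` is nontrivial. It makes character
integrals over balls vanish. -/
theorem exists_padicChar_ne_one {y : ℚ_[p]} {r : ℝ} (h : p ≤ r * ‖y‖) :
    ∃ x : ℚ_[p], ‖x‖ ≤ r ∧ padicChar p (x * y) ≠ 1 := by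
  have hp : (0 : ℝ) < p := by exact_mod_cast (Fact.out : p.Prime).pos
  have hy : y ≠ 0 := by
    rintro rfl
    rw [norm_zero, mul_zero] at h
    linarith
  have hy' : 0 < ‖y‖ := norm_pos_iff.2 hy
  refine ⟨(p : ℚ_[p])⁻¹ * y⁻¹, ?_, ?_⟩
  · rw [norm_mul, norm_inv, norm_inv, Padic.norm_p, inv_inv, ← div_eq_mul_inv, div_le_iff₀ hy']
    exact h
  · rw [mul_assoc, inv_mul_cancel₀ hy, mul_one]
    exact padicChar_inv_p_ne_one p

/-! ### The Haar measure of `ℚ_p` -/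

theorem p_le_norm {x : ℚ_[p]} (h : 1 < ‖x‖) : (p : ℝ) ≤ ‖x‖ := by
  by_contra hlt
  have h1 := (Padic.norm_le_pow_iff_norm_lt_pow_add_one x 0).2 (by simpa using lt_of_not_ge hlt)
  rw [zpow_zero] at h1
  linarith

theorem norm_le_inv_p {x : ℚ_[p]} (h : ‖x‖ < 1) : ‖x‖ ≤ (p : ℝ)⁻¹ := by
  have h1 := (Padic.norm_le_pow_iff_norm_lt_pow_add_one x (-1)).2 (by simpa using h)
  simpa using h1

theorem padicHaar_closedBall_one : padicHaar p (Metric.closedBall 0 1) = 1 :=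
  Measure.addHaarMeasure_self

open scoped Pointwise NNReal in
theorem smul_closedBall_padic (g : ℚ_[p]ˣ) (r : ℝ) :
    g • (Metric.closedBall (0 : ℚ_[p]) r) = Metric.closedBall 0 (‖(g : ℚ_[p])‖ * r) := by
  have hg : 0 < ‖(g : ℚ_[p])‖ := norm_pos_iff.2 g.ne_zero
  ext x
  rw [Set.mem_smul_set_iff_inv_smul_mem, mem_closedBall_zero_iff, mem_closedBall_zero_iff,
    Units.smul_def, smul_eq_mul, norm_mul, Units.val_inv_eq_inv_val, norm_inv, inv_mul_le_iff₀ hg]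

instance padicHaar_regular : (padicHaar p).Regular := by
  unfold padicHaar
  infer_instance

/-- `ℤ_p` is the disjoint union of the `p` translates of `p ℤ_p` by `0, …, p - 1`. -/
theorem padicHaar_closedBall_inv :
    (p : ℝ≥0∞) * padicHaar p (Metric.closedBall 0 (p : ℝ)⁻¹) = 1 := by
  have hcov : Metric.closedBall (0 : ℚ_[p]) 1
      = ⋃ i : Fin p, (fun x => -((i : ℕ) : ℚ_[p]) + x) ⁻¹' Metric.closedBall 0 (p : ℝ)⁻¹ := by
    ext x
    simp only [Set.mem_iUnion, Set.mem_preimage, mem_closedBall_zero_iff]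
    constructor
    · intro hx
      obtain ⟨n, hn, hn'⟩ := PadicInt.exists_mem_range (⟨x, hx⟩ : ℤ_[p])
      refine ⟨⟨n, hn⟩, norm_le_inv_p p ?_⟩
      have h1 := PadicInt.mem_nonunits.1 hn'
      rw [neg_add_eq_sub]
      exact h1
    · rintro ⟨i, hi⟩
      have e : x = ((i : ℕ) : ℚ_[p]) + (-((i : ℕ) : ℚ_[p]) + x) := by ring
      rw [e]
      refine (IsUltrametricDist.norm_add_le_max _ _).trans (max_le ?_ (hi.trans ?_))
      · exact_mod_cast Padic.norm_int_le_one ((i : ℕ) : ℤ)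
      · have : (1 : ℝ) ≤ p := by exact_mod_cast (Fact.out : p.Prime).one_lt.le
        exact inv_le_one_of_one_le₀ this
  have hdis : Pairwise (Function.onFun Disjoint fun i : Fin p =>
      (fun x => -((i : ℕ) : ℚ_[p]) + x) ⁻¹' Metric.closedBall 0 (p : ℝ)⁻¹) := by
    intro i j hij
    refine Set.disjoint_left.2 fun x hi hj => hij ?_
    simp only [Set.mem_preimage, mem_closedBall_zero_iff] at hi hj
    have h1 : ‖(((i : ℕ) - (j : ℕ) : ℤ) : ℚ_[p])‖ ≤ (p : ℝ) ^ (-(1 : ℕ) : ℤ) := by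
      have e : (((i : ℕ) - (j : ℕ) : ℤ) : ℚ_[p])
          = (-((j : ℕ) : ℚ_[p]) + x) - (-((i : ℕ) : ℚ_[p]) + x) := by push_cast; ring
      rw [e]
      refine (norm_sub_le_max_padic p _ _).trans (max_le ?_ ?_) <;> simpa
    have h2 := (Padic.norm_int_le_pow_iff_dvd _ 1).1 h1
    rw [pow_one] at h2
    have h3 := Int.eq_zero_of_abs_lt_dvd h2 (by
      rw [abs_lt]
      have := i.2
      have := j.2
      constructor <;> omega)
    ext
    omega
  have h := congrArg (padicHaar p) hcov
  rw [measure_iUnion hdis (fun i => by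
    exact (measurable_const_add _) Metric.isClosed_closedBall.measurableSet)] at h
  simp only [measure_preimage_add, tsum_fintype, Finset.sum_const, Finset.card_univ,
    Fintype.card_fin, nsmul_eq_mul] at h
  rw [← h, padicHaar_closedBall_one]

-- Elements of norm `1` preserve `ℤ_p` and multiplication by `p` scales its volume by `p⁻¹`; a
-- general element is a power of `p` times one of norm `1`.
open scoped Pointwise NNReal in
theorem distribHaarChar_padic (g : ℚ_[p]ˣ) :
    distribHaarChar ℚ_[p] g = ‖(g : ℚ_[p])‖₊ := by
  have hp0 : (p : ℚ_[p]) ≠ 0 := by exact_mod_cast (Fact.out : p.Prime).ne_zero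
  have hB0 : padicHaar p (Metric.closedBall 0 1) ≠ 0 := by
    rw [padicHaar_closedBall_one]; exact one_ne_zero
  have hB1 : padicHaar p (Metric.closedBall 0 1) ≠ ∞ := by
    rw [padicHaar_closedBall_one]; exact ENNReal.one_ne_top
  have hunit : ∀ u : ℚ_[p]ˣ, ‖(u : ℚ_[p])‖ = 1 → distribHaarChar ℚ_[p] u = 1 := by
    intro u hu
    refine distribHaarChar_eq_of_measure_smul_eq_mul hB0 hB1 ?_
    rw [smul_closedBall_padic, hu, one_mul, ENNReal.coe_one, one_mul]
  let P : ℚ_[p]ˣ := Units.mk0 (p : ℚ_[p]) hp0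
  have hP : distribHaarChar ℚ_[p] P = (p : ℝ≥0)⁻¹ := by
    refine distribHaarChar_eq_of_measure_smul_eq_mul hB0 hB1 ?_
    have hpp : (p : ℝ≥0∞) ≠ 0 := by exact_mod_cast (Fact.out : p.Prime).ne_zero
    have h := padicHaar_closedBall_inv p
    rw [smul_closedBall_padic, Units.val_mk0, Padic.norm_p, mul_one, padicHaar_closedBall_one,
      mul_one, ENNReal.coe_inv (by exact_mod_cast (Fact.out : p.Prime).ne_zero), ENNReal.coe_natCast]
    rw [mul_comm] at h
    exact ENNReal.eq_inv_of_mul_eq_one_left h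
  have hg := Padic.norm_eq_zpow_neg_valuation g.ne_zero
  set v := Padic.valuation (g : ℚ_[p])
  have hu := hunit (g * P ^ (-v)) (by
    rw [Units.val_mul, norm_mul, hg, Units.val_zpow_eq_zpow_val, norm_zpow, Units.val_mk0,
      Padic.norm_p, inv_zpow', neg_neg, ← zpow_add₀ (by
        exact_mod_cast (Fact.out : p.Prime).ne_zero)]
    simp)
  rw [map_mul, map_zpow, hP, zpow_neg, inv_zpow, inv_inv] at hu
  have hpv : ((p : ℝ≥0) ^ v) ≠ 0 := by
    refine zpow_ne_zero _ ?_
    exact_mod_cast (Fact.out : p.Prime).ne_zero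
  ext
  rw [coe_nnnorm, hg, eq_inv_of_mul_eq_one_left hu]
  push_cast
  rw [zpow_neg]

open scoped Pointwise in
theorem padicHaar_map_mul {g : ℚ_[p]} (hg : g ≠ 0) :
    (padicHaar p).map (fun x => g * x) = ENNReal.ofReal ‖g‖⁻¹ • padicHaar p := by
  ext s hs
  rw [Measure.map_apply (by fun_prop) hs, Measure.smul_apply, smul_eq_mul]
  have h := distribHaarChar_mul (padicHaar p) (Units.mk0 g hg)⁻¹ s
  rw [distribHaarChar_padic] at h
  have e : (fun x => g * x) ⁻¹' s = (Units.mk0 g hg)⁻¹ • s := by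
    ext x
    rw [Set.mem_smul_set_iff_inv_smul_mem, inv_inv]
    rfl
  rw [e, ← h]
  congr 1
  rw [Units.val_inv_eq_inv_val, Units.val_mk0, ← norm_inv, ofReal_norm]
  rfl

end

section

variable (p : ℕ) [Fact p.Prime]

/-! ### The local Fourier transform of `σ_p` -/

/-- The characteristic function of the ball `‖x‖ ≤ r` of `ℚ_p`. -/
def ballInd (r : ℝ) (x : ℚ_[p]) : ℂ := (Metric.closedBall 0 r).indicator 1 x

theorem ballInd_of_le {r : ℝ} {x : ℚ_[p]} (h : ‖x‖ ≤ r) : ballInd p r x = 1 :=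
  Set.indicator_of_mem (mem_closedBall_zero_iff.2 h) _

theorem ballInd_of_lt {r : ℝ} {x : ℚ_[p]} (h : r < ‖x‖) : ballInd p r x = 0 :=
  Set.indicator_of_notMem (fun h' => (mem_closedBall_zero_iff.1 h').not_gt h) _

/-- If `‖y‖ ≤ 1` the character is trivial on the ball. Otherwise translating by an element `t` of
the ball with `e_p(t y) ≠ 1` multiplies the integral by that value, so it is zero. -/
theorem integral_ball_padicChar (y : ℚ_[p]) :
    ∫ x, ballInd p 1 x * padicChar p (x * y) ∂(padicHaar p) = ballInd p 1 y := by
  rcases le_or_gt ‖y‖ 1 with hy | hy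
  · rw [ballInd_of_le p hy]
    have h : ∀ x, ballInd p 1 x * padicChar p (x * y)
        = (Metric.closedBall 0 1).indicator (fun _ => (1 : ℂ)) x := by
      intro x
      rcases le_or_gt ‖x‖ 1 with hx | hx
      · rw [padicChar_eq_one p (x := x * y) (by
          rw [norm_mul]; exact mul_le_one₀ hx (norm_nonneg _) hy), mul_one]
        rfl
      · rw [ballInd_of_lt p hx, zero_mul, Set.indicator_of_notMem]
        exact fun h' => (mem_closedBall_zero_iff.1 h').not_gt hx
    simp only [h]
    rw [integral_indicator Metric.isClosed_closedBall.measurableSet, setIntegral_const,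
      Measure.real, padicHaar_closedBall_one]
    simp
  · rw [ballInd_of_lt p hy]
    obtain ⟨t, ht, htne⟩ := exists_padicChar_ne_one p (y := y) (r := 1)
      (by rw [one_mul]; exact p_le_norm p hy)
    have h := integral_add_right_eq_self (μ := padicHaar p)
      (fun x => ballInd p 1 x * padicChar p (x * y)) t
    have hb : ∀ x, ballInd p 1 (x + t) = ballInd p 1 x := by
      intro x
      rcases le_or_gt ‖x‖ 1 with hx | hx
      · rw [ballInd_of_le p hx, ballInd_of_le p]
        exact (IsUltrametricDist.norm_add_le_max _ _).trans (max_le hx ht)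
      · rw [ballInd_of_lt p hx, ballInd_of_lt p]
        by_contra hle
        have h1 := norm_sub_le_max_padic p (x + t) t
        rw [add_sub_cancel_right] at h1
        exact absurd (h1.trans (max_le (not_lt.1 hle) ht)) (not_le.2 hx)
    simp only [hb, add_mul, padicChar_add, ← mul_assoc] at h
    rw [integral_mul_const] at h
    by_contra hne
    exact htne (mul_left_cancel₀ hne (h.trans (mul_one _).symm))

theorem integral_comp_mul_padic {g : ℚ_[p]} (hg : g ≠ 0) (f : ℚ_[p] → ℂ) :
    ∫ x, f x ∂(padicHaar p) = ‖g‖ * ∫ x, f (g * x) ∂(padicHaar p) := by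
  have hm : MeasurableEmbedding fun x : ℚ_[p] => g * x :=
    (Homeomorph.mulLeft₀ g hg).measurableEmbedding
  have h := hm.integral_map (μ := padicHaar p) f
  rw [padicHaar_map_mul p hg, integral_smul_measure, ENNReal.toReal_ofReal (by positivity)] at h
  rw [← h, Complex.real_smul, ← mul_assoc, ← Complex.ofReal_mul,
    mul_inv_cancel₀ (norm_ne_zero_iff.2 hg), Complex.ofReal_one, one_mul]

theorem fourier_ballInd {g : ℚ_[p]} (hg : g ≠ 0) (y : ℚ_[p]) :
    ∫ x, ballInd p ‖g‖ x * padicChar p (-(x * y)) ∂(padicHaar p)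
      = ‖g‖ * ballInd p ‖g‖⁻¹ y := by
  have hg' : 0 < ‖g‖ := norm_pos_iff.2 hg
  rw [integral_comp_mul_padic p hg]
  congr 1
  have h : ∀ x, ballInd p ‖g‖ (g * x) = ballInd p 1 x := by
    intro x
    rcases le_or_gt ‖x‖ 1 with hx | hx
    · rw [ballInd_of_le p hx, ballInd_of_le p]
      rw [norm_mul]
      exact mul_le_of_le_one_right hg'.le hx
    · rw [ballInd_of_lt p hx, ballInd_of_lt p]
      rw [norm_mul]
      exact lt_mul_of_one_lt_right hg' hx
  have e : ∀ x, -(g * x * y) = x * (-(g * y)) := fun x => by ring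
  simp only [h, e]
  rw [integral_ball_padicChar]
  have hn : ‖-(g * y)‖ = ‖g‖ * ‖y‖ := by rw [norm_neg, norm_mul]
  rcases le_or_gt ‖y‖ ‖g‖⁻¹ with hy | hy
  · rw [ballInd_of_le p hy, ballInd_of_le p]
    rw [hn, mul_comm, ← le_div_iff₀ hg', one_div]
    exact hy
  · rw [ballInd_of_lt p hy, ballInd_of_lt p]
    rw [hn, mul_comm, ← div_lt_iff₀ hg', one_div]
    exact hy

theorem integrable_ballInd_mul (r : ℝ) (y : ℚ_[p]) :
    Integrable (fun x => ballInd p r x * padicChar p (-(x * y))) (padicHaar p) := by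
  have h1 : Integrable (ballInd p r) (padicHaar p) :=
    (integrable_indicator_iff Metric.isClosed_closedBall.measurableSet).2
      (integrableOn_const (isCompact_closedBall 0 r).measure_lt_top.ne)
  refine h1.mul_bdd (c := 1) ?_ (Filter.Eventually.of_forall fun x => (norm_padicChar p _).le)
  exact ((continuous_padicChar p).comp (by fun_prop)).aestronglyMeasurable

/-- Norms take no value strictly between `p⁻¹` and `1` or between `1` and `p`, so on the relevant
range spheres are differences of balls, whose transforms are known. -/
theorem sigmaP_eq (x : ℚ_[p]) : sigmaP p x = (1 + (p : ℂ)⁻¹) * ballInd p 1 x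
    - ballInd p (p : ℝ)⁻¹ x - (p : ℂ)⁻¹ * ballInd p p x := by
  have hp : (1 : ℝ) < p := by exact_mod_cast (Fact.out : p.Prime).one_lt
  have hpi : (p : ℝ)⁻¹ < 1 := inv_lt_one_of_one_lt₀ hp
  have hs : ∀ r : ℝ, (Metric.sphere (0 : ℚ_[p]) r).indicator (1 : ℚ_[p] → ℂ) x
      = if ‖x‖ = r then 1 else 0 := by
    intro r
    classical
    rw [Set.indicator_apply]
    simp only [mem_sphere_zero_iff_norm, Pi.one_apply]
  rw [sigmaP, hs, hs]
  rcases lt_trichotomy ‖x‖ 1 with h | h | h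
  · have h1 := norm_le_inv_p p h
    rw [ballInd_of_le p h.le, ballInd_of_le p h1, ballInd_of_le p (h.le.trans hp.le),
      if_neg h.ne, if_neg (h.trans hp).ne]
    ring
  · rw [ballInd_of_le p h.le, ballInd_of_lt p (by rw [h]; exact hpi),
      ballInd_of_le p (h.le.trans hp.le), if_pos h, if_neg (by rw [h]; exact hp.ne)]
    ring
  · rw [ballInd_of_lt p h, ballInd_of_lt p (hpi.trans h), if_neg h.ne']
    rcases (p_le_norm p h).eq_or_lt with h1 | h1
    · rw [ballInd_of_le p h1.ge, if_pos h1.symm]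
      ring
    · rw [ballInd_of_lt p h1, if_neg h1.ne']
      ring

/-- `σ_p` is its own Fourier transform. -/
theorem fourier_sigmaP (y : ℚ_[p]) :
    ∫ x, sigmaP p x * padicChar p (-(x * y)) ∂(padicHaar p) = sigmaP p y := by
  have hp0 : (p : ℚ_[p]) ≠ 0 := by exact_mod_cast (Fact.out : p.Prime).ne_zero
  have hpc : (p : ℂ) ≠ 0 := by exact_mod_cast (Fact.out : p.Prime).ne_zero
  -- The unit ball is self-dual, and the balls of radii `p` and `p⁻¹` are exchanged with factors `p`
  -- and `p⁻¹`; in the decomposition `sigmaP_eq` the last two terms swap.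
  have h1 := fourier_ballInd p (one_ne_zero (α := ℚ_[p])) y
  have h2 := fourier_ballInd p hp0 y
  have h3 := fourier_ballInd p (inv_ne_zero hp0) y
  rw [norm_one, inv_one] at h1
  rw [Padic.norm_p, inv_inv] at h2
  rw [norm_inv, Padic.norm_p, inv_inv] at h3
  simp only [sigmaP_eq, sub_mul, mul_assoc]
  have i1 := (integrable_ballInd_mul p 1 y).const_mul (1 + (p : ℂ)⁻¹)
  have i2 := integrable_ballInd_mul p (p : ℝ)⁻¹ y
  have i3 := (integrable_ballInd_mul p p y).const_mul (p : ℂ)⁻¹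
  rw [integral_sub (show Integrable (fun x => (1 + (p : ℂ)⁻¹) * (ballInd p 1 x *
      padicChar p (-(x * y))) - ballInd p (p : ℝ)⁻¹ x * padicChar p (-(x * y))) _ from i1.sub i2) i3,
    integral_sub i1 i2, integral_const_mul, integral_const_mul, h1, h2, h3]
  push_cast
  field_simp
  ring

end

section

variable (S : Finset Nat.Primes)

/-! ### The Fourier transform on the finite part of `𝔸_S` -/

/-- The product of the `ℚ_p` for `p ∈ S`. -/
abbrev FinAdele : Type := ∀ p : S, ℚ_[(p : Nat.Primes)]

/-- The Haar measure of `∏_{p ∈ S} ℚ_p`. -/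
def finHaar : Measure (FinAdele S) := Measure.pi fun p : S => padicHaar (p : Nat.Primes)

instance finHaar_sigmaFinite : SigmaFinite (finHaar S) := by
  unfold finHaar; infer_instance

instance finHaar_isAddHaarMeasure : (finHaar S).IsAddHaarMeasure := by
  unfold finHaar; infer_instance

theorem adeleHaar_eq : adeleHaar S = (finHaar S).prod volume := rfl

/-- The character of `∏_{p ∈ S} ℚ_p`. -/
def finChar (x : FinAdele S) : ℂ := ∏ p : S, padicChar (p : Nat.Primes) (x p)

theorem continuous_finChar : Continuous (finChar S) := by
  unfold finChar
  exact continuous_finsetProd _ fun p _ => (continuous_padicChar _).comp (continuous_apply p)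

theorem norm_finChar (x : FinAdele S) : ‖finChar S x‖ = 1 := by
  simp [finChar, norm_prod, norm_padicChar]

theorem finChar_add (x y : FinAdele S) : finChar S (x + y) = finChar S x * finChar S y := by
  simp [finChar, padicChar_add, Finset.prod_mul_distrib]

/-- The Fourier transform of `∏_{p ∈ S} ℚ_p`. -/
def finFourier (ψ : FinAdele S → ℂ) (y : FinAdele S) : ℂ :=
  ∫ x, ψ x * finChar S (-(x * y)) ∂(finHaar S)

theorem adeleChar_eq (x : Adele S) :
    adeleChar S x = finChar S x.1 * Complex.exp (2 * Real.pi * Complex.I * x.2) := rfl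

theorem continuous_adeleChar : Continuous (adeleChar S) := by
  simp only [funext (adeleChar_eq S)]
  have h := (continuous_finChar S).comp (continuous_fst (X := FinAdele S) (Y := ℝ))
  refine h.mul ?_
  fun_prop

theorem norm_adeleChar (x : Adele S) : ‖adeleChar S x‖ = 1 := by
  rw [adeleChar_eq, norm_mul, norm_finChar, one_mul]
  have e : (2 * Real.pi * Complex.I * x.2 : ℂ) = ((2 * Real.pi * x.2 : ℝ) : ℂ) * Complex.I := by
    push_cast; ring
  rw [e, Complex.norm_exp_ofReal_mul_I]

theorem adeleFourier_prod (ψ : FinAdele S → ℂ) (g : 𝓢(ℝ, ℂ)) (y : Adele S) :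
    adeleFourier S (fun x => ψ x.1 * g x.2) y = finFourier S ψ y.1 * (𝓕 g : 𝓢(ℝ, ℂ)) y.2 := by
  rw [adeleFourier, finFourier, SchwartzMap.fourier_coe, Real.fourier_eq', adeleHaar_eq,
    ← integral_prod_mul]
  refine integral_congr_ae (Filter.Eventually.of_forall fun x => ?_)
  simp only [adeleChar_eq]
  have e : Complex.exp (2 * Real.pi * Complex.I * ((-(x * y)).2 : ℝ))
      = Complex.exp (((-2 * Real.pi * inner ℝ x.2 y.2 : ℝ) : ℂ) * Complex.I) := by
    congr 1
    simp only [Prod.snd_neg, Prod.snd_mul, RCLike.inner_apply, conj_trivial]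
    push_cast
    ring
  rw [e]
  simp only [Prod.fst_neg, Prod.fst_mul, smul_eq_mul]
  ring

/-- The function `⨂_p σ_p`. -/
def sigmaFin (x : FinAdele S) : ℂ := ∏ p : S, sigmaP (p : Nat.Primes) (x p)

theorem finFourier_sigmaFin : finFourier S (sigmaFin S) = sigmaFin S := by
  funext y
  rw [finFourier, sigmaFin, finHaar]
  have h := integral_fintype_prod_eq_prod (𝕜 := ℂ) (μ := fun p : S => padicHaar (p : Nat.Primes))
    (fun (p : S) (x : ℚ_[(p : Nat.Primes)]) =>
      sigmaP (p : Nat.Primes) x * padicChar (p : Nat.Primes) (-(x * y p)))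
  simp only [fourier_sigmaP] at h
  rw [← h]
  refine integral_congr_ae (Filter.Eventually.of_forall fun x => ?_)
  simp only [sigmaFin, finChar, ← Finset.prod_mul_distrib]
  rfl

/-! ### Local constancy, compact support and bounds for transforms on the finite part -/

theorem ballInd_add (p : ℕ) [Fact p.Prime] {r : ℝ} {t : ℚ_[p]} (ht : ‖t‖ ≤ r) (x : ℚ_[p]) :
    ballInd p r (x + t) = ballInd p r x := by
  rcases le_or_gt ‖x‖ r with hx | hx
  · rw [ballInd_of_le p hx, ballInd_of_le p]
    exact (IsUltrametricDist.norm_add_le_max _ _).trans (max_le hx ht)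
  · rw [ballInd_of_lt p hx, ballInd_of_lt p]
    by_contra hle
    have h1 := norm_sub_le_max_padic p (x + t) t
    rw [add_sub_cancel_right] at h1
    exact absurd (h1.trans (max_le (not_lt.1 hle) ht)) (not_le.2 hx)

theorem isLocallyConstant_sigmaP (p : ℕ) [Fact p.Prime] : IsLocallyConstant (sigmaP p) := by
  have hp : (1 : ℝ) < p := by exact_mod_cast (Fact.out : p.Prime).one_lt
  have hpi : (p : ℝ)⁻¹ < 1 := inv_lt_one_of_one_lt₀ hp
  rw [IsLocallyConstant.iff_eventually_eq]
  intro x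
  filter_upwards [Metric.closedBall_mem_nhds x (inv_pos.2 (one_pos.trans hp))] with y hy
  have h : ‖y - x‖ ≤ (p : ℝ)⁻¹ := by simpa [dist_eq_norm] using hy
  have e : y = x + (y - x) := by ring
  rw [e, sigmaP_eq, sigmaP_eq, ballInd_add p h, ballInd_add p (h.trans hpi.le),
    ballInd_add p (h.trans (hpi.trans hp).le)]

theorem isLocallyConstant_sigmaFin : IsLocallyConstant (sigmaFin S) := by
  rw [IsLocallyConstant.iff_eventually_eq]
  intro x
  have h : ∀ p : S, ∀ᶠ y in 𝓝 x, sigmaP (p : Nat.Primes) (y p) = sigmaP (p : Nat.Primes) (x p) :=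
    fun p => (continuous_apply p).continuousAt.eventually
      ((isLocallyConstant_sigmaP (p : Nat.Primes)).eventually_eq (x p))
  filter_upwards [Filter.eventually_all.2 h] with y hy
  exact Finset.prod_congr rfl fun p _ => hy p

theorem sigmaP_eq_ite (p : ℕ) [Fact p.Prime] (x : ℚ_[p]) : sigmaP p x
    = (if ‖x‖ = 1 then 1 else 0) - (p : ℂ)⁻¹ * if ‖x‖ = p then 1 else 0 := by
  classical
  rw [sigmaP, Set.indicator_apply, Set.indicator_apply]
  simp only [mem_sphere_zero_iff_norm, Pi.one_apply]

theorem sigmaP_ne_zero {p : ℕ} [Fact p.Prime] {x : ℚ_[p]} (h : sigmaP p x ≠ 0) :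
    ‖x‖ = 1 ∨ ‖x‖ = p := by
  by_contra hne
  push Not at hne
  rw [sigmaP_eq_ite, if_neg hne.1, if_neg hne.2] at h
  simp at h

theorem hasCompactSupport_sigmaFin : HasCompactSupport (sigmaFin S) := by
  refine HasCompactSupport.intro
    (isCompact_univ_pi fun p : S => isCompact_closedBall (0 : ℚ_[(p : Nat.Primes)]) (p : Nat.Primes))
    fun x hx => ?_
  by_contra hne
  refine hx fun p _ => mem_closedBall_zero_iff.2 ?_
  have h1 : (1 : ℝ) ≤ ((p : Nat.Primes) : ℕ) := by exact_mod_cast (p : Nat.Primes).2.one_lt.le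
  rcases sigmaP_ne_zero (Finset.prod_ne_zero_iff.1 hne p (Finset.mem_univ p)) with h | h
  · rw [h]; exact h1
  · exact h.le

/-- A bounded measurable function on `∏_{p ∈ S} ℚ_p` with bounded support. -/
structure IsBddSupp (ψ : FinAdele S → ℂ) (C R : ℝ) : Prop where
  meas : Measurable ψ
  bound : ∀ x, ‖ψ x‖ ≤ C
  supp : ∀ x, ∀ p : S, R < ‖x p‖ → ψ x = 0

theorem exists_isBddSupp {ψ : FinAdele S → ℂ} (hψ : Continuous ψ) (hc : HasCompactSupport ψ) :
    ∃ C R, IsBddSupp S ψ C R := by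
  obtain ⟨C, hC⟩ := hc.exists_bound_of_continuous hψ
  obtain ⟨R, hR⟩ := hc.isBounded.exists_norm_le
  refine ⟨C, R, hψ.measurable, hC, fun x p hx => ?_⟩
  by_contra hne
  have h1 := hR x (subset_tsupport ψ hne)
  exact absurd (hx.trans_le ((norm_le_pi_norm x p).trans h1)) (lt_irrefl _)

/-- A locally constant function with compact support has finitely many values, separated by some
`d`; uniform continuity brings `ψ (x + t)` and `ψ x` closer than `d`, so they coincide. -/
theorem exists_translation_invariant {ψ : FinAdele S → ℂ} (hψ : IsLocallyConstant ψ)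
    (hc : HasCompactSupport ψ) : ∃ ε > 0, ∀ t : FinAdele S, ‖t‖ ≤ ε → ∀ x, ψ (x + t) = ψ x := by
  have hfin : (Set.range ψ).Finite := by
    have h1 : (ψ '' tsupport ψ).Finite := by
      have : CompactSpace (tsupport ψ) := isCompact_iff_compactSpace.1 hc
      have h2 := (hψ.comp_continuous (continuous_subtype_val (p := (· ∈ tsupport ψ)))).range_finite
      rwa [Set.range_comp, Subtype.range_coe] at h2
    refine (h1.insert 0).subset ?_
    rintro _ ⟨x, rfl⟩
    by_cases hx : x ∈ tsupport ψ
    · exact Or.inr ⟨x, hx, rfl⟩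
    · exact Or.inl (image_eq_zero_of_notMem_tsupport hx)
  obtain ⟨d, hd, hd'⟩ : ∃ d > 0, ∀ a ∈ Set.range ψ, ∀ b ∈ Set.range ψ, dist a b < d → a = b := by
    rcases (Set.range ψ).subsingleton_or_nontrivial with hs | hs
    · exact ⟨1, one_pos, fun a ha b hb _ => hs ha hb⟩
    · refine ⟨(Set.range ψ).infsep, (hfin.infsep_pos_iff_nontrivial).2 hs, fun a ha b hb hab => ?_⟩
      by_contra hne
      have := hfin.to_subtype
      exact absurd (Set.infsep_le_dist_of_mem ha hb hne) (not_le.2 hab)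
  obtain ⟨ε, hε, hε'⟩ := Metric.uniformContinuous_iff.1
    (hc.uniformContinuous_of_continuous hψ.continuous) d hd
  refine ⟨ε / 2, half_pos hε, fun t ht x => ?_⟩
  refine hd' _ ⟨_, rfl⟩ _ ⟨_, rfl⟩ (hε' ?_)
  rw [dist_eq_norm, add_sub_cancel_left]
  linarith

theorem integrable_mul_finChar {ψ : FinAdele S → ℂ} (hψ : Integrable ψ (finHaar S))
    (y : FinAdele S) : Integrable (fun x => ψ x * finChar S (-(x * y))) (finHaar S) := by
  refine hψ.mul_bdd (c := 1) ?_ (Filter.Eventually.of_forall fun x => (norm_finChar S _).le)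
  exact ((continuous_finChar S).comp (by fun_prop)).aestronglyMeasurable

theorem continuous_finFourier {ψ : FinAdele S → ℂ} (hψ : Integrable ψ (finHaar S)) :
    Continuous (finFourier S ψ) := by
  refine continuous_of_dominated (fun y => (integrable_mul_finChar S hψ y).1) (bound := fun x => ‖ψ x‖)
    (fun y => Filter.Eventually.of_forall fun x => ?_) hψ.norm
    (Filter.Eventually.of_forall fun x => ?_)
  · rw [norm_mul, norm_finChar, mul_one]
  · exact continuous_const.mul ((continuous_finChar S).comp (by fun_prop))

/-- If `ψ` is invariant under translations of size at most `ε`, shifting the `p`-th variable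
multiplies the transform at `y` by a character value. That value can be made different from `1` once
`ε ‖y p‖ ≥ p`. -/
theorem exists_isBddSupp_finFourier {ψ : FinAdele S → ℂ} (hψ : IsLocallyConstant ψ)
    (hc : HasCompactSupport ψ) : ∃ C R, IsBddSupp S (finFourier S ψ) C R := by
  classical
  have hi : Integrable ψ (finHaar S) := hψ.continuous.integrable_of_hasCompactSupport hc
  obtain ⟨ε, hε, hinv⟩ := exists_translation_invariant S hψ hc
  -- The sum of the primes in `S` dominates each of them, giving a single radius valid for all
  -- coordinates.
  refine ⟨∫ x, ‖ψ x‖ ∂(finHaar S), (∑ p : S, (((p : Nat.Primes) : ℕ) : ℝ)) / ε,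
    (continuous_finFourier S hi).measurable, fun y => ?_, fun y p hy => ?_⟩
  · refine (norm_integral_le_integral_norm _).trans (le_of_eq ?_)
    simp only [norm_mul, norm_finChar, mul_one]
  · have hp : (((p : Nat.Primes) : ℕ) : ℝ) ≤ ε * ‖y p‖ := by
      rw [div_lt_iff₀' hε] at hy
      refine le_trans ?_ hy.le
      exact Finset.single_le_sum (f := fun p : S => (((p : Nat.Primes) : ℕ) : ℝ))
        (fun _ _ => Nat.cast_nonneg _) (Finset.mem_univ p)
    obtain ⟨x, hx, hne⟩ := exists_padicChar_ne_one ((p : Nat.Primes) : ℕ) (y := -y p) (r := ε)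
      (by rwa [norm_neg])
    let t : FinAdele S := Pi.single p x
    have ht : ‖t‖ ≤ ε := by
      rw [pi_norm_le_iff_of_nonneg hε.le]
      intro q
      by_cases hq : q = p
      · subst hq
        simpa [t] using hx
      · simp [t, hq, hε.le]
    have hchar : finChar S (-(t * y)) ≠ 1 := by
      rw [finChar, Finset.prod_eq_single p]
      · simp only [Pi.neg_apply, Pi.mul_apply, t, Pi.single_eq_same]
        rwa [mul_neg] at hne
      · intro q _ hq
        simp only [Pi.neg_apply, Pi.mul_apply, t, Pi.single_eq_of_ne hq, zero_mul, neg_zero]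
        exact padicChar_eq_one _ (by simp)
      · exact fun h => absurd (Finset.mem_univ p) h
    have h := integral_add_right_eq_self (μ := finHaar S)
      (fun x => ψ x * finChar S (-(x * y))) t
    have e : ∀ x, -((x + t) * y) = -(x * y) + -(t * y) := fun x => by ring
    simp only [hinv t ht, e, finChar_add, ← mul_assoc] at h
    rw [integral_mul_const] at h
    by_contra hne'
    exact hchar (mul_left_cancel₀ hne' (h.trans (mul_one _).symm))

end

section

variable (S : Finset Nat.Primes)

/-! ### The action of `Γ` on `𝔸_S` -/

variable {S} in
/-- The rational number underlying an element of `Γ`. -/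
def gv (q : Gam S) : ℚ := ((q : ℚˣ) : ℚ)

theorem gv_ne_zero (q : Gam S) : gv q ≠ 0 := (q : ℚˣ).ne_zero

theorem gv_mul (q r : Gam S) : gv (q * r) = gv q * gv r := rfl

theorem gv_inv (q : Gam S) : gv q⁻¹ = (gv q)⁻¹ := by
  rw [gv, Subgroup.coe_inv, Units.val_inv_eq_inv_val]
  rfl

theorem gv_injective : Function.Injective (gv (S := S)) := fun _ _ h =>
  Subtype.ext (Units.ext h)

theorem norm_gv (q : Gam S) (p : Nat.Primes) (hp : p ∉ S) : ‖(gv q : ℚ_[p])‖ = 1 := q.2 p hp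

theorem gv_prod_norm (q : Gam S) :
    (∏ p : S, ‖(gv q : ℚ_[(p : Nat.Primes)])‖) * |(gv q : ℝ)| = 1 := gam_prod_norm S q

instance gam_countable : Countable (Gam S) := (gv_injective S).countable

theorem smul_fst (q : Gam S) (x : Adele S) (p : S) :
    (q • x).1 p = (gv q : ℚ_[(p : Nat.Primes)]) * x.1 p := by
  change ((q : ℚˣ) : ℚ) • x.1 p = _
  rw [Rat.smul_def]
  rfl

theorem smul_snd (q : Gam S) (x : Adele S) : (q • x).2 = (gv q : ℝ) * x.2 := by
  change ((q : ℚˣ) : ℚ) • x.2 = _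
  rw [Rat.smul_def]
  rfl

/-- The action of `q ∈ Γ` on `∏_{p ∈ S} ℚ_p`. -/
def finMul (q : Gam S) (x : FinAdele S) : FinAdele S :=
  fun p => (gv q : ℚ_[(p : Nat.Primes)]) * x p

theorem smul_eq_map (q : Gam S) :
    (fun x : Adele S => q • x) = Prod.map (finMul S q) (fun u => (gv q : ℝ) * u) := by
  funext x
  exact Prod.ext (funext fun p => smul_fst S q x p) (smul_snd S q x)

theorem continuous_finMul (q : Gam S) : Continuous (finMul S q) :=
  continuous_pi fun p => by unfold finMul; fun_prop

theorem continuous_gam_smul (q : Gam S) : Continuous fun x : Adele S => q • x := by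
  rw [smul_eq_map]
  exact (continuous_finMul S q).prodMap (by fun_prop)

instance gam_measurableConstSMul : MeasurableConstSMul (Gam S) (Adele S) :=
  ⟨fun q => (continuous_gam_smul S q).measurable⟩

/-- The local scalings by `|q|_p⁻¹` multiply to `|q|` by the product formula; the real factor
`|q|⁻¹` then cancels this, and the Haar measure of `𝔸_S` is `Γ`-invariant. -/
theorem map_finMul (q : Gam S) : (finHaar S).map (finMul S q)
    = ENNReal.ofReal |(gv q : ℝ)| • finHaar S := by
  have hm : ∀ p : S, Measurable fun x : ℚ_[(p : Nat.Primes)] =>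
      (gv q : ℚ_[(p : Nat.Primes)]) * x := fun p => by fun_prop
  have hq : ∀ p : S, (gv q : ℚ_[(p : Nat.Primes)]) ≠ 0 := fun p => by
    exact_mod_cast gv_ne_zero S q
  have ha : 0 < |(gv q : ℝ)| := abs_pos.2 (by exact_mod_cast gv_ne_zero S q)
  have hprod : ∏ p : S, ENNReal.ofReal ‖(gv q : ℚ_[(p : Nat.Primes)])‖⁻¹
      = ENNReal.ofReal |(gv q : ℝ)| := by
    rw [← ENNReal.ofReal_prod_of_nonneg fun p _ => by positivity, Finset.prod_inv_distrib]
    congr 1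
    rw [inv_eq_iff_eq_inv]
    exact eq_inv_of_mul_eq_one_left (gv_prod_norm S q)
  have h : finHaar S = (ENNReal.ofReal |(gv q : ℝ)|)⁻¹ • (finHaar S).map (finMul S q) := by
    refine Measure.pi_eq fun s hs => ?_
    have hpre : finMul S q ⁻¹' (Set.univ.pi s) = Set.univ.pi fun p : S =>
        (fun x : ℚ_[(p : Nat.Primes)] => (gv q : ℚ_[(p : Nat.Primes)]) * x) ⁻¹' (s p) := by
      ext x; simp [finMul]
    rw [Measure.smul_apply, Measure.map_apply (continuous_finMul S q).measurable
      (MeasurableSet.univ_pi hs), hpre, finHaar, Measure.pi_pi]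
    have h1 : ∀ p : S, padicHaar (p : Nat.Primes)
        ((fun x : ℚ_[(p : Nat.Primes)] => (gv q : ℚ_[(p : Nat.Primes)]) * x) ⁻¹' (s p))
        = ENNReal.ofReal ‖(gv q : ℚ_[(p : Nat.Primes)])‖⁻¹ * padicHaar (p : Nat.Primes) (s p) := by
      intro p
      rw [← Measure.map_apply (hm p) (hs p), padicHaar_map_mul _ (hq p), Measure.smul_apply,
        smul_eq_mul]
    rw [Finset.prod_congr rfl fun p _ => h1 p, Finset.prod_mul_distrib, hprod, smul_eq_mul,
      ← mul_assoc, ENNReal.inv_mul_cancel (by simpa using ha.ne') ENNReal.ofReal_ne_top, one_mul]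
  conv_rhs => rw [h]
  rw [smul_smul, ENNReal.mul_inv_cancel (by simpa using ha.ne') ENNReal.ofReal_ne_top, one_smul]

theorem map_gam_smul (q : Gam S) : (adeleHaar S).map (fun x => q • x) = adeleHaar S := by
  have hq : (gv q : ℝ) ≠ 0 := by exact_mod_cast gv_ne_zero S q
  rw [smul_eq_map, adeleHaar_eq, ← Measure.map_prod_map _ _ (continuous_finMul S q).measurable
    (by fun_prop), map_finMul, Real.map_volume_mul_left hq, Measure.prod_smul_left,
    Measure.prod_smul_right, smul_smul, ← ENNReal.ofReal_mul (abs_nonneg _), ← abs_mul,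
    mul_inv_cancel₀ hq, abs_one, ENNReal.ofReal_one, one_smul]

instance gam_smulInvariantMeasure : SMulInvariantMeasure (Gam S) (Adele S) (adeleHaar S) := by
  refine ⟨fun q s hs => ?_⟩
  conv_rhs => rw [← map_gam_smul S q]
  rw [Measure.map_apply (continuous_gam_smul S q).measurable hs]

/-! ### The fundamental domain -/

theorem norm_prod_prime_zpow (T : Finset Nat.Primes) (n : Nat.Primes → ℤ) (l : Nat.Primes) :
    ‖((∏ p ∈ T, ((p : ℕ) : ℚ) ^ n p : ℚ) : ℚ_[l])‖ = if l ∈ T then ((l : ℕ) : ℝ) ^ (-n l) else 1 := by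
  classical
  rw [Rat.cast_prod, norm_prod]
  have h : ∀ p : Nat.Primes, ‖((((p : ℕ) : ℚ) ^ n p : ℚ) : ℚ_[l])‖
      = if p = l then ((l : ℕ) : ℝ) ^ (-n l) else 1 := by
    intro p
    rw [Rat.cast_zpow, Rat.cast_natCast, norm_zpow]
    split_ifs with hp
    · subst hp
      rw [Padic.norm_p, inv_zpow']
    · rw [Padic.norm_natCast_eq_one_iff.2, one_zpow]
      exact (Nat.coprime_primes l.2 p.2).2 fun h => hp (Subtype.ext h.symm)
  rw [Finset.prod_congr rfl fun p _ => h p, Finset.prod_ite_eq']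

/-- The element `ε ∏_{p ∈ S} p ^ {n_p}` of `Γ`. -/
def gamOf (ε : ℤˣ) (n : Nat.Primes → ℤ) : Gam S :=
  ⟨Units.mk0 (((ε : ℤ) : ℚ) * ∏ p ∈ S, ((p : ℕ) : ℚ) ^ n p) (mul_ne_zero
    (by exact_mod_cast ε.ne_zero)
    (Finset.prod_ne_zero_iff.2 fun p _ => zpow_ne_zero _ (by exact_mod_cast p.2.ne_zero))), by
    intro l hl
    rw [Units.val_mk0, Rat.cast_mul, norm_mul, norm_prod_prime_zpow, if_neg hl, mul_one]
    rcases Int.units_eq_one_or ε with h | h <;> simp [h]⟩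

theorem gv_gamOf (ε : ℤˣ) (n : Nat.Primes → ℤ) :
    gv (gamOf S ε n) = ((ε : ℤ) : ℚ) * ∏ p ∈ S, ((p : ℕ) : ℚ) ^ n p := rfl

theorem norm_gv_gamOf (ε : ℤˣ) (n : Nat.Primes → ℤ) (p : S) :
    ‖(gv (gamOf S ε n) : ℚ_[(p : Nat.Primes)])‖
      = (((p : Nat.Primes) : ℕ) : ℝ) ^ (-n (p : Nat.Primes)) := by
  rw [gv_gamOf, Rat.cast_mul, norm_mul, norm_prod_prime_zpow, if_pos p.2]
  rcases Int.units_eq_one_or ε with h | h <;> simp [h]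

theorem gv_eq_of_norm_eq_one {q : Gam S}
    (h : ∀ p : S, ‖(gv q : ℚ_[(p : Nat.Primes)])‖ = 1) : gv q = 1 ∨ gv q = -1 := by
  have h1 := gv_prod_norm S q
  rw [Finset.prod_congr rfl fun p _ => h p, Finset.prod_const_one, one_mul] at h1
  rcases (abs_eq one_pos.le).1 h1 with h2 | h2
  · left; exact_mod_cast h2
  · right; exact_mod_cast h2

theorem mem_fundDom {x : Adele S} : x ∈ fundDom S ↔ (∀ p : S, ‖x.1 p‖ = 1) ∧ 0 < x.2 := by
  simp [fundDom, Set.mem_prod, Set.mem_pi]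

theorem measurableSet_fundDom : MeasurableSet (fundDom S) :=
  (MeasurableSet.univ_pi fun _ => Metric.isClosed_sphere.measurableSet).prod measurableSet_Ioi

/-- Every invertible element of `𝔸_S` has a translate in the fundamental domain. -/
theorem exists_smul_mem_fundDom {x : Adele S} (hx : adeleMod S x ≠ 0) :
    ∃ q : Gam S, q • x ∈ fundDom S := by
  classical
  rw [adeleMod, mul_ne_zero_iff, Finset.prod_ne_zero_iff] at hx
  obtain ⟨h1, h2⟩ := hx
  have h1' : ∀ p : S, x.1 p ≠ 0 := fun p => norm_ne_zero_iff.1 (h1 p (Finset.mem_univ p))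
  have h2' : x.2 ≠ 0 := abs_ne_zero.1 h2
  -- The exponents cancel the valuations of the finite components, and the sign `ε` makes the real
  -- one positive.
  let n : Nat.Primes → ℤ := fun p => if h : p ∈ S then -(Padic.valuation (x.1 ⟨p, h⟩)) else 0
  let ε : ℤˣ := if 0 < x.2 then 1 else -1
  refine ⟨gamOf S ε n, (mem_fundDom S).2 ⟨fun p => ?_, ?_⟩⟩
  · have hp : ((p : Nat.Primes) : ℕ) ≠ 0 := (p : Nat.Primes).2.ne_zero
    have hn : n (p : Nat.Primes) = -(Padic.valuation (x.1 p)) := by simp [n]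
    rw [smul_fst, norm_mul, norm_gv_gamOf, Padic.norm_eq_zpow_neg_valuation (h1' p), hn,
      ← zpow_add₀ (by exact_mod_cast hp)]
    simp
  · rw [smul_snd, gv_gamOf]
    have hpos : (0 : ℝ) < ((∏ p ∈ S, ((p : ℕ) : ℚ) ^ n p : ℚ) : ℝ) := by
      have : (0 : ℚ) < ∏ p ∈ S, ((p : ℕ) : ℚ) ^ n p :=
        Finset.prod_pos fun p _ => zpow_pos (by exact_mod_cast p.2.pos) _
      exact_mod_cast this
    rw [Rat.cast_mul]
    by_cases h : 0 < x.2
    · simp only [ε, if_pos h]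
      simpa using mul_pos hpos h
    · simp only [ε, if_neg h]
      have h3 : x.2 < 0 := lt_of_le_of_ne (not_lt.1 h) h2'
      have h4 := mul_pos hpos (neg_pos.2 h3)
      push_cast at h4 ⊢
      linarith

theorem ae_adeleMod_ne_zero : ∀ᵐ x ∂(adeleHaar S), adeleMod S x ≠ 0 := by
  have h1 : ∀ p : S, ∀ᵐ x ∂(finHaar S), x p ≠ 0 := fun p => by
    have h := Measure.pi_hyperplane (μ := fun p : S => padicHaar (p : Nat.Primes)) p 0
    rw [ae_iff]
    simpa [finHaar] using h
  have h2 : ∀ᵐ x : Adele S ∂(adeleHaar S), ∀ p : S, x.1 p ≠ 0 :=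
    Measure.quasiMeasurePreserving_fst.ae (ae_all_iff.2 h1)
  have h3 : ∀ᵐ x : Adele S ∂(adeleHaar S), x.2 ≠ 0 :=
    Measure.quasiMeasurePreserving_snd.ae (Measure.ae_ne volume 0)
  filter_upwards [h2, h3] with x h4 h5
  exact mul_ne_zero (Finset.prod_ne_zero_iff.2 fun p _ => norm_ne_zero_iff.2 (h4 p))
    (abs_ne_zero.2 h5)

-- An element of `Γ` moving a point of the domain into the domain has norm `1` at every `p ∈ S`,
-- hence is `±1` by the product formula, and positivity of the real component excludes `-1`.
open scoped Pointwise in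
theorem isFundamentalDomain_fundDom : IsFundamentalDomain (Gam S) (fundDom S) (adeleHaar S) := by
  refine IsFundamentalDomain.mk'' (measurableSet_fundDom S).nullMeasurableSet ?_ ?_ fun q =>
    (measurePreserving_smul q (adeleHaar S)).quasiMeasurePreserving
  · filter_upwards [ae_adeleMod_ne_zero S] with x hx
    exact exists_smul_mem_fundDom S hx
  · intro q hq
    refine Disjoint.aedisjoint (Set.disjoint_left.2 ?_)
    rintro _ ⟨x, hx, rfl⟩ hqx
    rw [mem_fundDom] at hx
    have hqx' := (mem_fundDom S).1 hqx
    have h1 : ∀ p : S, ‖(gv q : ℚ_[(p : Nat.Primes)])‖ = 1 := fun p => by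
      have h2 := hqx'.1 p
      rwa [smul_fst, norm_mul, hx.1 p, mul_one] at h2
    have h3 := hqx'.2
    rw [smul_snd] at h3
    rcases gv_eq_of_norm_eq_one S h1 with h | h
    · exact hq (gv_injective S h)
    · rw [h] at h3
      push_cast at h3
      linarith [hx.2]

end

section
variable (S : Finset Nat.Primes)

/-! ### The class of `(⨂_p σ_p) ⊗ f` on the fundamental domain -/

/-- The element `ε ∏_{p ∈ T} p⁻¹` of `Γ`. -/
def gamT (i : S.powerset × ℤˣ) : Gam S :=
  open Classical in gamOf S i.2 fun p => if p ∈ (i.1 : Finset Nat.Primes) then -1 else 0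

theorem norm_gv_gamT (i : S.powerset × ℤˣ) (p : S) [Decidable ((p : Nat.Primes) ∈ i.1.1)] :
    ‖(gv (gamT S i) : ℚ_[(p : Nat.Primes)])‖
      = if (p : Nat.Primes) ∈ i.1.1 then (((p : Nat.Primes) : ℕ) : ℝ) else 1 := by
  rw [gamT, norm_gv_gamOf]
  split_ifs <;> simp

theorem gv_gamT (i : S.powerset × ℤˣ) :
    gv (gamT S i) = ((i.2 : ℤ) : ℚ) * ∏ p ∈ i.1.1, ((p : ℕ) : ℚ)⁻¹ := by
  classical
  rw [gamT, gv_gamOf]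
  congr 1
  rw [← Finset.prod_subset (Finset.mem_powerset.1 i.1.2)]
  · refine Finset.prod_congr rfl fun p hp => ?_
    rw [if_pos hp, zpow_neg_one]
  · intro p _ hp
    rw [if_neg hp, zpow_zero]

theorem gamT_injective : Function.Injective (gamT S) := by
  classical
  rintro ⟨⟨T, hT⟩, ε⟩ ⟨⟨T', hT'⟩, ε'⟩ h
  have hTT : T = T' := by
    ext p
    by_cases hp : p ∈ S
    · have h1 := norm_gv_gamT S (⟨T, hT⟩, ε) ⟨p, hp⟩
      rw [h, norm_gv_gamT] at h1
      have h2 : ((p : ℕ) : ℝ) ≠ 1 := by exact_mod_cast p.2.one_lt.ne'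
      by_cases a : p ∈ T <;> by_cases b : p ∈ T' <;> simp_all
    · exact iff_of_false (fun h => hp (Finset.mem_powerset.1 hT h))
        fun h => hp (Finset.mem_powerset.1 hT' h)
  subst hTT
  have h1 := congrArg gv h
  rw [gv_gamT, gv_gamT] at h1
  have h2 : (∏ p ∈ T, ((p : ℕ) : ℚ)⁻¹) ≠ 0 := Finset.prod_ne_zero_iff.2 fun p _ =>
    inv_ne_zero (by exact_mod_cast p.2.ne_zero)
  have h3 := mul_right_cancel₀ h2 h1
  have h4 : ε = ε' := Units.ext (by exact_mod_cast h3)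
  rw [h4]

/-- Take for `T` the set of `p` with `|q|_p ≠ 1`: dividing by `∏_{p ∈ T} p⁻¹` leaves an element of
norm `1` at each `p ∈ S`, that is `±1`. -/
theorem mem_range_gamT {q : Gam S} (h : ∀ p : S, ‖(gv q : ℚ_[(p : Nat.Primes)])‖ = 1 ∨
    ‖(gv q : ℚ_[(p : Nat.Primes)])‖ = (((p : Nat.Primes) : ℕ) : ℝ)) : q ∈ Set.range (gamT S) := by
  classical
  let T : Finset Nat.Primes := S.filter fun p => ‖(gv q : ℚ_[p])‖ ≠ 1
  have hT : T ∈ S.powerset := Finset.mem_powerset.2 (Finset.filter_subset _ _)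
  have h1 : ∀ p : S, ‖(gv (q * (gamT S (⟨T, hT⟩, 1))⁻¹) : ℚ_[(p : Nat.Primes)])‖ = 1 := by
    intro p
    have hp0 : (((p : Nat.Primes) : ℕ) : ℝ) ≠ 0 := by exact_mod_cast (p : Nat.Primes).2.ne_zero
    rw [gv_mul, gv_inv, Rat.cast_mul, Rat.cast_inv, norm_mul, norm_inv, norm_gv_gamT]
    by_cases hp : ‖(gv q : ℚ_[(p : Nat.Primes)])‖ = 1
    · have : (p : Nat.Primes) ∉ T := fun hm => (Finset.mem_filter.1 hm).2 hp
      rw [if_neg this, hp, inv_one, mul_one]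
    · have : (p : Nat.Primes) ∈ T := Finset.mem_filter.2 ⟨p.2, hp⟩
      rw [if_pos this, (h p).resolve_left hp, mul_inv_cancel₀ hp0]
  have h2 := gv_eq_of_norm_eq_one S h1
  rw [gv_mul, gv_inv, mul_inv_eq_iff_eq_mul₀ (gv_ne_zero S _),
    mul_inv_eq_iff_eq_mul₀ (gv_ne_zero S _)] at h2
  rcases h2 with h2 | h2
  · refine ⟨(⟨T, hT⟩, 1), gv_injective S ?_⟩
    rw [h2, one_mul]
  · refine ⟨(⟨T, hT⟩, -1), gv_injective S ?_⟩
    rw [h2, gv_gamT, gv_gamT]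
    push_cast
    ring

theorem mem_range_gamT_of_sigmaFin_ne_zero {q : Gam S} {x : Adele S} (hx : x ∈ fundDom S)
    (h : sigmaFin S (q • x).1 ≠ 0) : q ∈ Set.range (gamT S) := by
  refine mem_range_gamT S fun p => ?_
  have h1 := sigmaP_ne_zero (Finset.prod_ne_zero_iff.1 h p (Finset.mem_univ p))
  rwa [smul_fst, norm_mul, ((mem_fundDom S).1 hx).1 p, mul_one] at h1

theorem sigmaFin_gamT_smul (i : S.powerset × ℤˣ) {x : Adele S} (hx : x ∈ fundDom S) :
    sigmaFin S (gamT S i • x).1 = ∏ p ∈ i.1.1, -((p : ℕ) : ℂ)⁻¹ := by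
  classical
  have h1 : ∀ p : S, sigmaP (p : Nat.Primes) ((gamT S i • x).1 p)
      = if (p : Nat.Primes) ∈ i.1.1 then -(((p : Nat.Primes) : ℕ) : ℂ)⁻¹ else 1 := by
    intro p
    have hp : (((p : Nat.Primes) : ℕ) : ℝ) ≠ 1 := by exact_mod_cast (p : Nat.Primes).2.one_lt.ne'
    rw [sigmaP_eq_ite, smul_fst, norm_mul, ((mem_fundDom S).1 hx).1 p, mul_one, norm_gv_gamT]
    split_ifs <;> simp_all
  rw [sigmaFin, Finset.prod_congr rfl fun p _ => h1 p,
    Finset.prod_coe_sort S fun p : Nat.Primes => if p ∈ i.1.1 then -((p : ℕ) : ℂ)⁻¹ else 1,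
    ← Finset.prod_subset (Finset.mem_powerset.1 i.1.2)]
  · exact Finset.prod_congr rfl fun p hp => if_pos hp
  · exact fun p _ hp => if_neg hp

/-- Since the finite components of `x` are units, `σ` kills every term except those with `|q|_p ∈
{1, p}` for all `p ∈ S`; the sum is finite. -/
theorem tsum_sigmaFin_smul (f : Adele S → ℂ) {x : Adele S} (hx : x ∈ fundDom S) :
    ∑' q : Gam S, sigmaFin S (q • x).1 * f (q • x)
      = ∑ i, sigmaFin S (gamT S i • x).1 * f (gamT S i • x) := by
  rw [← (gamT_injective S).tsum_eq (f := fun q => sigmaFin S (q • x).1 * f (q • x)), tsum_fintype]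
  intro q hq
  exact mem_range_gamT_of_sigmaFin_ne_zero S hx (left_ne_zero_of_mul hq)

/-- The surviving `±∏_{p ∈ T} p⁻¹` carry the weight `∏_{p ∈ T} (-p⁻¹)`; the two signs produce the
even part of `f`, and the sum over `T` is the expanded product defining `thetaFun`. -/
theorem theta_proj (f : ℝ → ℂ) {x : Adele S} (hx : x ∈ fundDom S) :
    theta S f (proj S x) = thetaFun S (fun u => (1 / 2) * (f u + f (-u))) x.2 := by
  change (1 / 2 : ℂ) * ∑' q : Gam S, sigmaFin S (q • x).1 * f (q • x).2 = _
  rw [tsum_sigmaFin_smul S (fun y => f y.2) hx, thetaFun, Fintype.sum_prod_type,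
    ← Finset.sum_coe_sort S.powerset, Finset.mul_sum]
  refine Finset.sum_congr rfl fun T _ => ?_
  have h1 : (Finset.univ : Finset ℤˣ) = {1, -1} := rfl
  have h2 : (1 : ℤˣ) ≠ -1 := by decide
  have h3 : ∀ ε : ℤˣ, (gamT S (T, ε) • x).2
      = (((ε : ℤ) : ℝ) * (x.2 / ∏ p ∈ T.1, ((p : ℕ) : ℝ))) := by
    intro ε
    rw [smul_snd, gv_gamT]
    push_cast
    rw [Finset.prod_inv_distrib]
    ring
  rw [h1, Finset.sum_pair h2, sigmaFin_gamT_smul S _ hx, sigmaFin_gamT_smul S _ hx, h3, h3]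
  push_cast
  rw [one_mul, neg_one_mul]
  ring

end

section
variable (S : Finset Nat.Primes)

/-! ### A summability estimate on `Γ` -/

theorem den_eq_one_of_padic_norm_le_one {r : ℚ} (h : ∀ p : Nat.Primes, ‖(r : ℚ_[p])‖ ≤ 1) :
    r.den = 1 := by
  by_contra hne
  obtain ⟨p, hp, hd⟩ := Nat.exists_prime_and_dvd hne
  have hf : Fact p.Prime := ⟨hp⟩
  have hn : ¬ (p : ℤ) ∣ r.num := by
    rw [Int.natCast_dvd]
    exact fun hn => Nat.not_coprime_of_dvd_of_dvd hp.one_lt hn hd r.reduced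
  have h1 : ‖(r.num : ℚ_[p])‖ = 1 :=
    le_antisymm (Padic.norm_int_le_one _) (not_lt.1 fun h => hn (Padic.norm_intCast_lt_one_iff.1 h))
  have h2 : ‖((r.den : ℤ) : ℚ_[p])‖ < 1 :=
    Padic.norm_intCast_lt_one_iff.2 (by exact_mod_cast hd)
  have h3 : (r : ℚ_[p]) * ((r.den : ℤ) : ℚ_[p]) = (r.num : ℚ_[p]) := by
    exact_mod_cast congrArg (fun t : ℚ => (t : ℚ_[p])) (Rat.mul_den_eq_num r)
  have h4 := congrArg norm h3
  rw [norm_mul, h1] at h4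
  have h5 := h ⟨p, hp⟩
  have h6 : ‖(r : ℚ_[p])‖ * ‖((r.den : ℤ) : ℚ_[p])‖ ≤ 1 * ‖((r.den : ℤ) : ℚ_[p])‖ :=
    mul_le_mul_of_nonneg_right h5 (norm_nonneg _)
  linarith

theorem summable_inv_factoredNumbers (s : Finset ℕ) :
    Summable fun m : Nat.factoredNumbers s => ((m : ℕ) : ℝ)⁻¹ := by
  let f : ℕ →* ℝ :=
    { toFun := fun n => (n : ℝ)⁻¹, map_one' := by simp, map_mul' := fun a b => by simp [mul_comm] }
  refine ((EulerProduct.summable_and_hasSum_factoredNumbers_prod_filter_prime_geometric (f := f)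
    (fun {p} hp => ?_) s).2).summable
  change ‖(p : ℝ)⁻¹‖ < 1
  rw [norm_inv, Real.norm_natCast]
  exact inv_lt_one_of_one_lt₀ (by exact_mod_cast hp.one_lt)

/-- Bounded denominators: after multiplication by `∏_{p ∈ S} p^N` with `2^N > R`, these elements
are, up to sign, integers with prime factors in `S`. The sum of inverses of such integers is a
finite product of geometric series. -/
theorem summable_gam_inv (R : ℝ) : Summable (Set.indicator
    {q : Gam S | ∀ p : S, ‖(gv q : ℚ_[(p : Nat.Primes)])‖ ≤ R} fun q => |(gv q : ℝ)|⁻¹) := by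
  classical
  rw [← summable_subtype_iff_indicator]
  obtain ⟨N, hN⟩ := pow_unbounded_of_one_lt R one_lt_two
  let m : Gam S := gamOf S 1 fun _ => N
  have hm : (gv m : ℝ) = ∏ p ∈ S, ((p : ℕ) : ℝ) ^ N := by
    simp only [m, gv_gamOf]
    push_cast
    simp
  have hm0 : (0 : ℝ) < gv m := by
    rw [hm]
    exact Finset.prod_pos fun p _ => pow_pos (by exact_mod_cast p.2.pos) _
  let s : Finset ℕ := S.image fun p : Nat.Primes => (p : ℕ)
  let U := {q : Gam S | ∀ p : S, ‖(gv q : ℚ_[(p : Nat.Primes)])‖ ≤ R}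
  have hden : ∀ q ∈ U, (gv (m * q)).den = 1 := by
    intro q hq
    refine den_eq_one_of_padic_norm_le_one fun p => ?_
    by_cases hp : p ∈ S
    · have h2 : (2 : ℝ) ≤ ((p : ℕ) : ℝ) := by exact_mod_cast p.2.two_le
      have h3 : (0 : ℝ) < ((p : ℕ) : ℝ) := by linarith
      rw [gv_mul, Rat.cast_mul, norm_mul, norm_gv_gamOf S 1 _ ⟨p, hp⟩, zpow_neg, zpow_natCast,
        inv_mul_le_one₀ (pow_pos h3 N)]
      exact ((hq ⟨p, hp⟩).trans hN.le).trans (pow_le_pow_left₀ zero_le_two h2 N)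
    · exact (norm_gv S _ p hp).le
  have hnum : ∀ q ∈ U, gv (m * q) = ((gv (m * q)).num : ℚ) := fun q hq =>
    ((Rat.den_eq_one_iff _).1 (hden q hq)).symm
  have hmem : ∀ q ∈ U, (gv (m * q)).num.natAbs ∈ Nat.factoredNumbers s := by
    intro q hq
    rw [Nat.mem_factoredNumbers']
    intro p hp hd
    by_contra hps
    have hpS : (⟨p, hp⟩ : Nat.Primes) ∉ S := fun h =>
      hps (Finset.mem_image.2 ⟨⟨p, hp⟩, h, rfl⟩)
    have hf : Fact p.Prime := ⟨hp⟩
    have h1 := norm_gv S (m * q) ⟨p, hp⟩ hpS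
    rw [hnum q hq, Rat.cast_intCast] at h1
    exact absurd h1 (Padic.norm_intCast_lt_one_iff.2 (Int.natCast_dvd.2 hd)).ne
  let i : U → Nat.factoredNumbers s × SignType := fun q =>
    (⟨_, hmem q q.2⟩, SignType.sign (gv (m * (q : Gam S))).num)
  have hi : Function.Injective i := by
    rintro ⟨q, hq⟩ ⟨r, hr⟩ h
    have h1 : (gv (m * q)).num.natAbs = (gv (m * r)).num.natAbs :=
      congrArg (fun t : Nat.factoredNumbers s × SignType => (t.1 : ℕ)) h
    have h2 : SignType.sign (gv (m * q)).num = SignType.sign (gv (m * r)).num :=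
      congrArg Prod.snd h
    have h3 : (gv (m * q)).num = (gv (m * r)).num := by
      rw [← sign_mul_abs (gv (m * q)).num, ← sign_mul_abs (gv (m * r)).num, h2,
        Int.abs_eq_natAbs, Int.abs_eq_natAbs, h1]
    have h4 : gv (m * q) = gv (m * r) := by rw [hnum q hq, hnum r hr, h3]
    exact Subtype.ext (mul_left_cancel (gv_injective S h4))
  have hsum : Summable fun t : Nat.factoredNumbers s × SignType => ((t.1 : ℕ) : ℝ)⁻¹ * 1 :=
    (summable_inv_factoredNumbers s).mul_of_nonneg (f := fun t : Nat.factoredNumbers s =>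
      ((t : ℕ) : ℝ)⁻¹) (g := fun _ : SignType => (1 : ℝ)) (Summable.of_finite)
      (fun _ => by positivity) (fun _ => zero_le_one)
  refine ((hsum.comp_injective hi).mul_left (gv m : ℝ)).congr fun q => ?_
  obtain ⟨q, hq⟩ := q
  have h1 : (((gv (m * q)).num.natAbs : ℕ) : ℝ) = gv m * |(gv q : ℝ)| := by
    have h2 : ((gv (m * q) : ℚ) : ℝ) = ((gv (m * q)).num : ℝ) := by
      conv_lhs => rw [hnum q hq]
      rw [Rat.cast_intCast]
    rw [Nat.cast_natAbs, Int.cast_abs, ← h2, gv_mul, Rat.cast_mul, abs_mul, abs_of_pos hm0]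
  change (gv m : ℝ) * ((((gv (m * q)).num.natAbs : ℕ) : ℝ)⁻¹ * 1) = |(gv q : ℝ)|⁻¹
  rw [h1, mul_one, mul_inv, mul_inv_cancel_left₀ hm0.ne']

/-! ### Unfolding -/

theorem integrable_tsum {α ι : Type*} [MeasurableSpace α] [Countable ι] {μ : Measure α}
    {F : ι → α → ℂ} (hF : ∀ i, Integrable (F i) μ) (hs : Summable fun i => ∫ a, ‖F i a‖ ∂μ) :
    Integrable (fun a => ∑' i, F i a) μ := by
  refine ⟨(AEMeasurable.tsum fun i => (hF i).1.aemeasurable).aestronglyMeasurable, ?_⟩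
  have h : ∫⁻ a, ∑' i, ‖F i a‖ₑ ∂μ < ∞ := by
    rw [lintegral_tsum fun i => (hF i).1.enorm]
    have h1 : ∀ i, ∫⁻ a, ‖F i a‖ₑ ∂μ = ENNReal.ofReal (∫ a, ‖F i a‖ ∂μ) := fun i =>
      (ofReal_integral_norm_eq_lintegral_enorm (hF i)).symm
    simp only [h1]
    rw [← ENNReal.ofReal_tsum_of_nonneg (fun i => integral_nonneg fun _ => norm_nonneg _) hs]
    exact ENNReal.ofReal_lt_top
  exact (lintegral_mono fun a => enorm_tsum_le_tsum_enorm).trans_lt h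

/-- The integral over `X_S` of the product of the classes of `φ` and of `(⨂_p σ_p) ⊗ f`. -/
theorem integral_classX_mul_theta {φ : Adele S → ℂ} {f : ℝ → ℂ}
    (hi : ∀ q : Gam S, Integrable (fun x => φ (q • x) * (sigmaFin S x.1 * f x.2)) (adeleHaar S))
    (hs : Summable fun q : Gam S => ∫ x, ‖φ (q • x) * (sigmaFin S x.1 * f x.2)‖ ∂(adeleHaar S)) :
    ∫ x in fundDom S, classX S φ (proj S x) * theta S f (proj S x) ∂(adeleHaar S)
      = (1 / 4) * ∑' q : Gam S, ∫ x, φ (q • x) * (sigmaFin S x.1 * f x.2) ∂(adeleHaar S) := by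
  classical
  set H : Adele S → ℂ := fun x => ∑' q : Gam S, φ (q • x) * (sigmaFin S x.1 * f x.2) with hH
  have hHi : Integrable H (adeleHaar S) := integrable_tsum hi hs
  -- The factor coming from `φ` is `Γ`-invariant, so the translates of `H` over the fundamental
  -- domain reassemble the sum defining the class of `σ ⊗ f`. The two halves in `classX` account for
  -- the constant `1/4`.
  have hHr : ∀ (r : Gam S) (x : Adele S), H (r • x)
      = (2 * classX S φ (proj S x)) * (sigmaFin S (r • x).1 * f (r • x).2) := by
    intro r x
    have h1 : classX S φ (proj S (r • x)) = classX S φ (proj S x) :=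
      congrArg (classX S φ) (Quotient.sound ⟨r, rfl⟩)
    rw [← h1]
    change ∑' q : Gam S, φ (q • r • x) * (sigmaFin S (r • x).1 * f (r • x).2)
      = 2 * ((1 / 2 : ℂ) * ∑' q : Gam S, φ (q • r • x)) * _
    rw [tsum_mul_right]
    ring
  -- The integral of `H` over `𝔸_S` is computed twice: term by term, and by unfolding over the
  -- fundamental domain, where only the finitely many translates by `gamT` contribute.
  rw [integral_tsum_of_summable_integral_norm hi hs,
    (isFundamentalDomain_fundDom S).integral_eq_tsum'' H hHi,
    ← (gamT_injective S).tsum_eq (f := fun r => ∫ x in fundDom S, H (r • x) ∂(adeleHaar S)),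
    tsum_fintype, ← integral_finsetSum, ← integral_const_mul]
  · refine setIntegral_congr_fun (measurableSet_fundDom S) fun x hx => ?_
    simp only [hHr]
    rw [← Finset.mul_sum]
    change _ * ((1 / 2 : ℂ) * ∑' q : Gam S, sigmaFin S (q • x).1 * f (q • x).2) = _
    rw [tsum_sigmaFin_smul S (fun y => f y.2) hx]
    ring
  · intro i _
    exact ((measurePreserving_smul (gamT S i) (adeleHaar S)).integrable_comp_of_integrable
      hHi).integrableOn
  · intro q hq
    by_contra hne
    refine hq (setIntegral_eq_zero_of_forall_eq_zero fun x hx => ?_)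
    rw [hHr]
    by_cases h : sigmaFin S (q • x).1 = 0
    · rw [h, zero_mul, mul_zero]
    · exact absurd (mem_range_gamT_of_sigmaFin_ne_zero S hx h) hne

end

section
variable (S : Finset Nat.Primes)

/-! ### Parseval's formula -/

instance adeleHaar_sigmaFinite : SigmaFinite (adeleHaar S) := by
  rw [adeleHaar_eq]; infer_instance

theorem integrable_sigmaFin : Integrable (sigmaFin S) (finHaar S) :=
  (isLocallyConstant_sigmaFin S).continuous.integrable_of_hasCompactSupport
    (hasCompactSupport_sigmaFin S)

theorem mul_gam_smul (q : Gam S) (x y : Adele S) : x * (q • y) = (q • x) * y := by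
  refine Prod.ext (funext fun p => ?_) ?_
  · rw [Prod.fst_mul, Prod.fst_mul, Pi.mul_apply, Pi.mul_apply, smul_fst, smul_fst]
    ring
  · rw [Prod.snd_mul, Prod.snd_mul, smul_snd, smul_snd]
    ring

/-- Fubini: `Γ` can be moved from one variable of the kernel `α(-xy)` to the other, and the change
of variables `x ↦ q x` preserves the measure. -/
theorem integral_adeleFourier_smul_mul {φ χ : Adele S → ℂ} (hφ : Integrable φ (adeleHaar S))
    (hχ : Integrable χ (adeleHaar S)) (q : Gam S) :
    ∫ y, adeleFourier S φ (q • y) * χ y ∂(adeleHaar S)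
      = ∫ x, φ (q⁻¹ • x) * adeleFourier S χ x ∂(adeleHaar S) := by
  have hint : Integrable (fun z : Adele S × Adele S =>
      (φ z.1 * χ z.2) * adeleChar S (-(z.1 * (q • z.2)))) ((adeleHaar S).prod (adeleHaar S)) := by
    refine (hφ.mul_prod hχ).mul_bdd (c := 1) ?_
      (Filter.Eventually.of_forall fun x => (norm_adeleChar S _).le)
    refine ((continuous_adeleChar S).comp ?_).aestronglyMeasurable
    exact (continuous_fst.mul ((continuous_gam_smul S q).comp continuous_snd)).neg
  have h1 : ∫ y, adeleFourier S φ (q • y) * χ y ∂(adeleHaar S)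
      = ∫ y, ∫ x, (φ x * χ y) * adeleChar S (-(x * (q • y))) ∂(adeleHaar S) ∂(adeleHaar S) := by
    refine integral_congr_ae (Filter.Eventually.of_forall fun y => ?_)
    simp only [adeleFourier]
    rw [← integral_mul_const]
    refine integral_congr_ae (Filter.Eventually.of_forall fun x => ?_)
    simp only
    ring
  have h2 : ∀ x, ∫ y, (φ x * χ y) * adeleChar S (-(x * (q • y))) ∂(adeleHaar S)
      = φ x * adeleFourier S χ (q • x) := by
    intro x
    rw [adeleFourier, ← integral_const_mul]
    refine integral_congr_ae (Filter.Eventually.of_forall fun y => ?_)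
    simp only
    rw [mul_gam_smul, mul_comm (q • x) y, mul_assoc]
  rw [h1, ← integral_integral_swap (f := fun x y => (φ x * χ y) * adeleChar S (-(x * (q • y)))) hint,
    integral_congr_ae (Filter.Eventually.of_forall h2)]
  have h3 := (measurePreserving_smul q (adeleHaar S)).integral_comp
    (measurableEmbedding_const_smul q) (fun x => φ (q⁻¹ • x) * adeleFourier S χ x)
  rw [← h3]
  refine integral_congr_ae (Filter.Eventually.of_forall fun x => ?_)
  simp only [inv_smul_smul]

variable {S}

theorem IsBddSupp.integrable_smul_mul {ψ : FinAdele S → ℂ} {C R : ℝ} (h : IsBddSupp S ψ C R)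
    (g f : 𝓢(ℝ, ℂ)) (q : Gam S) :
    Integrable (fun x : Adele S => (ψ (q • x).1 * g (q • x).2) * (sigmaFin S x.1 * f x.2))
      (adeleHaar S) := by
  obtain ⟨B, hB'⟩ : ∃ B, ∀ x, ‖g x‖ ≤ B :=
    ⟨_, g.toBoundedContinuousFunction.norm_coe_le_norm⟩
  have hC : 0 ≤ C := (norm_nonneg _).trans (h.bound 0)
  refine ((integrable_sigmaFin S).mul_prod f.integrable).bdd_mul (c := C * B) ?_
    (Filter.Eventually.of_forall fun x => ?_)
  · have hm := (continuous_gam_smul S q).measurable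
    exact ((h.meas.comp (measurable_fst.comp hm)).mul
      (g.continuous.measurable.comp (measurable_snd.comp hm))).aestronglyMeasurable
  · rw [norm_mul]
    exact mul_le_mul (h.bound _) (hB' _) (norm_nonneg _) hC

/-- On the support of `σ` one has `‖x p‖ ≥ 1`, so terms with `|q|_p > R` for some `p` vanish. For
the others the real integral contributes `|q|⁻¹`, and `summable_gam_inv` applies. -/
theorem IsBddSupp.summable_smul_mul {ψ : FinAdele S → ℂ} {C R : ℝ} (h : IsBddSupp S ψ C R)
    (g f : 𝓢(ℝ, ℂ)) :
    Summable fun q : Gam S => ∫ x : Adele S,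
      ‖(ψ (q • x).1 * g (q • x).2) * (sigmaFin S x.1 * f x.2)‖ ∂(adeleHaar S) := by
  obtain ⟨B, hB'⟩ : ∃ B, ∀ x, ‖f x‖ ≤ B :=
    ⟨_, f.toBoundedContinuousFunction.norm_coe_le_norm⟩
  have hC : 0 ≤ C := (norm_nonneg _).trans (h.bound 0)
  have hB0 : 0 ≤ B := (norm_nonneg _).trans (hB' 0)
  refine Summable.of_nonneg_of_le (fun _ => integral_nonneg fun _ => norm_nonneg _) (fun q => ?_)
    ((summable_gam_inv S R).mul_left
      (C * B * (∫ x, ‖sigmaFin S x‖ ∂(finHaar S)) * ∫ u, ‖g u‖))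
  have hq : (gv q : ℝ) ≠ 0 := by exact_mod_cast gv_ne_zero S q
  by_cases hqR : q ∈ {q : Gam S | ∀ p : S, ‖(gv q : ℚ_[(p : Nat.Primes)])‖ ≤ R}
  · rw [Set.indicator_of_mem hqR]
    have h1 : ∫ x : Adele S, (C * B * ‖sigmaFin S x.1‖) * ‖g (gv q * x.2)‖ ∂(adeleHaar S)
        = (C * B * (∫ x, ‖sigmaFin S x‖ ∂(finHaar S)) * ∫ u, ‖g u‖) * |(gv q : ℝ)|⁻¹ := by
      rw [adeleHaar_eq, integral_prod_mul (fun x => C * B * ‖sigmaFin S x‖)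
        (fun u => ‖g (gv q * u)‖), integral_const_mul,
        Measure.integral_comp_mul_left (fun u => ‖g u‖), abs_inv, smul_eq_mul]
      ring
    rw [← h1]
    have hgi : Integrable (fun u => g (gv q * u)) := g.integrable.comp_mul_left' hq
    refine integral_mono (h.integrable_smul_mul g f q).norm
      ((((integrable_sigmaFin S).norm.const_mul (C * B)).mul_prod hgi.norm)) fun x => ?_
    simp only [norm_mul, smul_snd]
    calc ‖ψ (q • x).1‖ * ‖g (gv q * x.2)‖ * (‖sigmaFin S x.1‖ * ‖f x.2‖)
        ≤ C * ‖g (gv q * x.2)‖ * (‖sigmaFin S x.1‖ * B) := by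
          gcongr
          · exact h.bound _
          · exact hB' _
      _ = _ := by ring
  · rw [Set.indicator_of_notMem hqR, mul_zero]
    simp only [Set.mem_ofPred_eq, not_forall, not_le] at hqR
    obtain ⟨p, hp⟩ := hqR
    refine (integral_eq_zero_of_ae (Filter.Eventually.of_forall fun x => ?_)).le
    simp only [Pi.zero_apply, norm_eq_zero]
    by_cases hx : sigmaFin S x.1 = 0
    · rw [hx, zero_mul, mul_zero]
    · have h1 : 1 ≤ ‖x.1 p‖ := by
        rcases sigmaP_ne_zero (Finset.prod_ne_zero_iff.1 hx p (Finset.mem_univ p)) with h2 | h2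
        · exact h2.ge
        · rw [h2]; exact_mod_cast (p : Nat.Primes).2.one_lt.le
      rw [h.supp (q • x).1 p, zero_mul, zero_mul]
      rw [smul_fst, norm_mul]
      exact hp.trans_le (le_mul_of_one_le_right (norm_nonneg _) h1)

theorem adeleFourier_sigmaFin_mul (f : 𝓢(ℝ, ℂ)) (y : Adele S) :
    adeleFourier S (fun x => sigmaFin S x.1 * f x.2) y = sigmaFin S y.1 * (𝓕 f : 𝓢(ℝ, ℂ)) y.2 := by
  rw [adeleFourier_prod, finFourier_sigmaFin]

theorem IsBddSupp.integral_classX_mul_theta {ψ : FinAdele S → ℂ} {C R : ℝ}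
    (h : IsBddSupp S ψ C R) (g f : 𝓢(ℝ, ℂ)) :
    ∫ x in fundDom S, classX S (fun x => ψ x.1 * g x.2) (proj S x) * theta S f (proj S x)
        ∂(adeleHaar S)
      = (1 / 4) * ∑' q : Gam S, ∫ x : Adele S, ψ (q • x).1 * g (q • x).2
        * (sigmaFin S x.1 * f x.2) ∂(adeleHaar S) :=
  Semilocal.integral_classX_mul_theta S (φ := fun x => ψ x.1 * g x.2) (f := fun u => f u)
    (h.integrable_smul_mul g f) (h.summable_smul_mul g f)

/-- Both sides are unfolded into sums over `Γ`; the terms of index `q` and `q⁻¹` agree by the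
Parseval formula on `𝔸_S`, because `σ ⊗ f` has transform `σ ⊗ 𝓕 f`. -/
theorem integral_classX_adeleFourier_mul_theta {φ : Adele S → ℂ} (hφ : IsBruhatSchwartz S φ)
    (f : 𝓢(ℝ, ℂ)) :
    ∫ x in fundDom S, classX S (adeleFourier S φ) (proj S x) * theta S f (proj S x) ∂(adeleHaar S)
      = ∫ x in fundDom S, classX S φ (proj S x) * theta S (𝓕 f : 𝓢(ℝ, ℂ)) (proj S x)
        ∂(adeleHaar S) := by
  obtain ⟨ψ, g, hψ, hc, rfl⟩ := hφ
  obtain ⟨C, R, h1⟩ := exists_isBddSupp S hψ.continuous hc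
  obtain ⟨C', R', h2⟩ := exists_isBddSupp_finFourier S hψ hc
  have h3 : adeleFourier S (fun x => ψ x.1 * g x.2)
      = fun y => finFourier S ψ y.1 * (𝓕 g : 𝓢(ℝ, ℂ)) y.2 := funext (adeleFourier_prod S ψ g)
  have h4 : Integrable (fun x : Adele S => ψ x.1 * g x.2) (adeleHaar S) :=
    (hψ.continuous.integrable_of_hasCompactSupport hc).mul_prod g.integrable
  have h5 : Integrable (fun x : Adele S => sigmaFin S x.1 * f x.2) (adeleHaar S) :=
    (integrable_sigmaFin S).mul_prod f.integrable
  have h6 := h1.integral_classX_mul_theta g (𝓕 f)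
  have h7 := h2.integral_classX_mul_theta (𝓕 g) f
  have h8 : ∀ q : Gam S, ∫ x : Adele S, finFourier S ψ (q • x).1 * (𝓕 g : 𝓢(ℝ, ℂ)) (q • x).2
        * (sigmaFin S x.1 * f x.2) ∂(adeleHaar S)
      = ∫ x : Adele S, ψ (q⁻¹ • x).1 * g (q⁻¹ • x).2
        * (sigmaFin S x.1 * (𝓕 f : 𝓢(ℝ, ℂ)) x.2) ∂(adeleHaar S) := by
    intro q
    have h9 := integral_adeleFourier_smul_mul S h4 h5 q
    rw [h3, funext (adeleFourier_sigmaFin_mul f)] at h9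
    exact h9
  rw [h3]
  refine h7.trans (Eq.trans ?_ h6.symm)
  congr 1
  rw [tsum_congr h8]
  exact (Equiv.inv (Gam S)).tsum_eq (fun q : Gam S => ∫ x : Adele S, ψ (q • x).1 * g (q • x).2
        * (sigmaFin S x.1 * (𝓕 f : 𝓢(ℝ, ℂ)) x.2) ∂(adeleHaar S))

end

section
variable (S : Finset Nat.Primes)

/-! ### Functions of the module on `X_S` -/

theorem measurable_proj : Measurable (proj S) := fun _ hs => hs

theorem measurable_modX : Measurable (modX S) := by
  have h : Continuous (adeleMod S) := by unfold adeleMod; fun_prop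
  exact fun s hs => h.measurable hs

theorem modX_proj {x : Adele S} (hx : x ∈ fundDom S) : modX S (proj S x) = x.2 := by
  obtain ⟨h1, h2⟩ := (mem_fundDom S).1 hx
  change (∏ p : S, ‖x.1 p‖) * |x.2| = x.2
  rw [Finset.prod_congr rfl fun p _ => h1 p, Finset.prod_const_one, one_mul, abs_of_pos h2]

/-- The Haar measure of `∏_{p ∈ S} ℤ_p^*`. -/
def unitsHaar : Measure (FinAdele S) :=
  (finHaar S).restrict (Set.univ.pi fun p : S => Metric.sphere (0 : ℚ_[(p : Nat.Primes)]) 1)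

/-- The volume of `∏_{p ∈ S} ℤ_p^*`. -/
def unitsVol : ℝ≥0∞ := unitsHaar S Set.univ

theorem unitsVol_ne_zero : unitsVol S ≠ 0 := by
  rw [unitsVol, unitsHaar, Measure.restrict_apply_univ, finHaar, Measure.pi_pi, Ne,
    Finset.prod_eq_zero_iff]
  rintro ⟨p, -, hp⟩
  exact (IsOpen.measure_pos (padicHaar (p : Nat.Primes))
    (IsUltrametricDist.isOpen_sphere (0 : ℚ_[(p : Nat.Primes)]) one_ne_zero) ⟨1, by simp⟩).ne' hp

theorem unitsVol_ne_top : unitsVol S ≠ ∞ := by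
  rw [unitsVol, unitsHaar, Measure.restrict_apply_univ, finHaar, Measure.pi_pi]
  exact ENNReal.prod_ne_top fun p _ => (isCompact_sphere _ _).measure_lt_top.ne

theorem restrict_fundDom : (adeleHaar S).restrict (fundDom S)
    = (unitsHaar S).prod (volume.restrict (Set.Ioi 0)) :=
  (Measure.prod_restrict _ _).symm

theorem map_modX : (muX S).map (modX S) = unitsVol S • volume.restrict (Set.Ioi (0 : ℝ)) := by
  have h : modX S ∘ proj S =ᵐ[(adeleHaar S).restrict (fundDom S)] Prod.snd := by
    filter_upwards [ae_restrict_mem (measurableSet_fundDom S)] with x hx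
    exact modX_proj S hx
  rw [muX, Measure.map_map (measurable_modX S) (measurable_proj S), Measure.map_congr h,
    restrict_fundDom, Measure.map_snd_prod]
  rfl

theorem quasiMeasurePreserving_modX :
    Measure.QuasiMeasurePreserving (modX S) (muX S) (volume.restrict (Set.Ioi (0 : ℝ))) :=
  ⟨measurable_modX S, by rw [map_modX]; exact Measure.smul_absolutelyContinuous⟩

theorem quasiMeasurePreserving_modX_volume :
    Measure.QuasiMeasurePreserving (modX S) (muX S) volume :=
  (quasiMeasurePreserving_modX S).mono_right Measure.absolutelyContinuous_restrict

theorem ae_exists_proj : ∀ᵐ X ∂(muX S), ∃ x ∈ fundDom S, proj S x = X ∧ modX S X = x.2 := by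
  filter_upwards [(quasiMeasurePreserving_modX S).ae (ae_restrict_mem measurableSet_Ioi)] with X hX
  obtain ⟨x, rfl⟩ := Quotient.exists_rep X
  obtain ⟨q, hq⟩ := exists_smul_mem_fundDom S (x := x) (ne_of_gt hX)
  have h : proj S (q • x) = proj S x := Quotient.sound ⟨q, rfl⟩
  refine ⟨q • x, hq, h, ?_⟩
  rw [← modX_proj S hq, h]
  rfl

variable {S} in
-- Fubini on the fundamental domain: `∏ ℤ_p^*` has nonzero volume, so a good fibre exists, and on it
-- the module is the real coordinate.
theorem ae_of_ae_modX {P : ℝ → Prop} (h : ∀ᵐ X ∂(muX S), P (modX S X)) :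
    ∀ᵐ u ∂(volume.restrict (Set.Ioi (0 : ℝ))), P u := by
  have h1 : ∀ᵐ x ∂((unitsHaar S).prod (volume.restrict (Set.Ioi (0 : ℝ)))), P x.2 := by
    rw [← restrict_fundDom]
    filter_upwards [ae_restrict_mem (measurableSet_fundDom S),
      ae_of_ae_map (measurable_proj S).aemeasurable h] with x hx hP
    rwa [modX_proj S hx] at hP
  have h2 := Measure.ae_ae_of_ae_prod h1
  have h3 : Filter.NeBot (ae (unitsHaar S)) := ae_neBot.2 fun h0 => unitsVol_ne_zero S (by
    rw [unitsVol, h0]; rfl)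
  obtain ⟨a, ha⟩ := h2.exists
  exact ha

theorem memLp_comp_modX {f : ℝ → ℂ} (hf : MemLp f 2 (volume.restrict (Set.Ioi (0 : ℝ)))) :
    MemLp (fun X => f (modX S X)) 2 (muX S) := by
  have h : MemLp f 2 ((muX S).map (modX S)) := by
    rw [map_modX]
    exact hf.smul_measure (unitsVol_ne_top S)
  exact (memLp_map_measure_iff h.1 (measurable_modX S).aemeasurable).1 h

theorem integral_comp_modX {f : ℝ → ℝ}
    (hf : AEStronglyMeasurable f (volume.restrict (Set.Ioi (0 : ℝ)))) :
    ∫ X, f (modX S X) ∂(muX S) = (unitsVol S).toReal * ∫ u in Set.Ioi (0 : ℝ), f u := by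
  have h : AEStronglyMeasurable f ((muX S).map (modX S)) := by
    rw [map_modX]
    exact hf.smul_measure _
  rw [← integral_map (measurable_modX S).aemeasurable h, map_modX, integral_smul_measure,
    smul_eq_mul]

/-- The element `X ↦ f (|X|_S)` of `L²(X_S)`, for a function `f` in `L²(ℝ)`. -/
def radialLift : L2R →L[ℂ] L2X S :=
  LinearMap.mkContinuous
    { toFun := fun f => (memLp_comp_modX S ((Lp.memLp f).restrict (Set.Ioi (0 : ℝ)))).toLp
      map_add' := fun f g => by
        refine Lp.ext ?_
        filter_upwards [MemLp.coeFn_toLp (memLp_comp_modX S ((Lp.memLp (f + g)).restrict _)),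
          MemLp.coeFn_toLp (memLp_comp_modX S ((Lp.memLp f).restrict _)),
          MemLp.coeFn_toLp (memLp_comp_modX S ((Lp.memLp g).restrict _)), Lp.coeFn_add (MemLp.toLp _ (memLp_comp_modX S ((Lp.memLp f).restrict _)))
            (MemLp.toLp _ (memLp_comp_modX S ((Lp.memLp g).restrict _))),
          (quasiMeasurePreserving_modX_volume S).ae (Lp.coeFn_add f g)] with X h1 h2 h3 h4 h5
        rw [h1, h4, Pi.add_apply, h2, h3, h5, Pi.add_apply]
      map_smul' := fun c f => by
        refine Lp.ext ?_
        filter_upwards [MemLp.coeFn_toLp (memLp_comp_modX S ((Lp.memLp (c • f)).restrict _)),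
          MemLp.coeFn_toLp (memLp_comp_modX S ((Lp.memLp f).restrict _)), Lp.coeFn_smul c (MemLp.toLp _ (memLp_comp_modX S ((Lp.memLp f).restrict _))),
          (quasiMeasurePreserving_modX_volume S).ae (Lp.coeFn_smul c f)] with X h1 h2 h4 h5
        rw [h1, RingHom.id_apply, h4, Pi.smul_apply, h2, h5, Pi.smul_apply] }
    ((unitsVol S).toReal ^ (1 / 2 : ℝ)) fun f => by
      have hi := (memLp_two_iff_integrable_sq_norm (Lp.aestronglyMeasurable f)).1 (Lp.memLp f)
      refine le_of_sq_le_sq ?_ (by positivity)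
      change ‖(memLp_comp_modX S ((Lp.memLp f).restrict (Set.Ioi (0 : ℝ)))).toLp‖ ^ 2 ≤ _
      rw [norm_toLp_sq, integral_comp_modX S (f := fun u => ‖f u‖ ^ 2) hi.1.restrict, mul_pow,
        ← Real.sqrt_eq_rpow, Real.sq_sqrt ENNReal.toReal_nonneg]
      gcongr
      have h := norm_toLp_sq (Lp.memLp f)
      rw [Lp.toLp_coeFn] at h
      rw [h]
      exact setIntegral_le_integral hi (Filter.Eventually.of_forall fun _ => by positivity)

theorem radialLift_ae (f : L2R) : radialLift S f =ᵐ[muX S] fun X => f (modX S X) :=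
  MemLp.coeFn_toLp (memLp_comp_modX S ((Lp.memLp f).restrict (Set.Ioi (0 : ℝ))))

theorem integral_Ioi_norm_sq {f : L2R} (hf : f ∈ evenSub) :
    ∫ u in Set.Ioi (0 : ℝ), ‖f u‖ ^ 2 = ‖f‖ ^ 2 / 2 := by
  have h1 := norm_Uinf_sq hf
  rw [Uinf_eq, norm_mulF_sq] at h1
  have h2 := Real.pi_pos
  field_simp
  nlinarith

theorem norm_radialLift_sq {f : L2R} (hf : f ∈ evenSub) :
    ‖radialLift S f‖ ^ 2 = (unitsVol S).toReal / 2 * ‖f‖ ^ 2 := by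
  have hi := (memLp_two_iff_integrable_sq_norm (Lp.aestronglyMeasurable f)).1 (Lp.memLp f)
  change ‖(memLp_comp_modX S ((Lp.memLp f).restrict (Set.Ioi (0 : ℝ)))).toLp‖ ^ 2 = _
  rw [norm_toLp_sq, integral_comp_modX S (f := fun u => ‖f u‖ ^ 2) hi.1.restrict,
    integral_Ioi_norm_sq hf]
  ring

theorem adeleMod_mul (x y : Adele S) : adeleMod S (x * y) = adeleMod S x * adeleMod S y := by
  simp only [adeleMod, Prod.fst_mul, Prod.snd_mul, Pi.mul_apply, norm_mul, abs_mul,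
    Finset.prod_mul_distrib]
  ring

theorem radialLift_mem (f : L2R) : radialLift S f ∈ L2Xinv S := by
  refine ⟨fun X => f (modX S X), radialLift_ae S f, fun u hu x => ?_⟩
  change f (adeleMod S (u * x)) = f (adeleMod S x)
  rw [adeleMod_mul, hu, one_mul]

theorem ae_eq_radial (h : L2Xinv S) :
    (h : L2X S) =ᵐ[muX S] fun X => radial S h (modX S X) := by
  filter_upwards [h.2.choose_spec.1, ae_exists_proj S] with X h1 h2
  obtain ⟨x, hx, rfl, h3⟩ := h2
  rw [h1, h3]
  exact radial_eq S h hx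

theorem radial_radialLift {f : L2R} {h : L2Xinv S} (hh : (h : L2X S) = radialLift S f) :
    radial S h =ᵐ[volume.restrict (Set.Ioi (0 : ℝ))] f := by
  refine ae_of_ae_modX (S := S) (P := fun u => radial S h u = f u) ?_
  have h1 := ae_eq_radial S h
  rw [hh] at h1
  filter_upwards [h1, radialLift_ae S f] with X h2 h3
  rw [← h2, h3]

theorem USmap_radialLift {f : L2R} {h : L2Xinv S} (hh : (h : L2X S) = radialLift S f) :
    USmap S h = Uinf f :=
  mulF_congr (memLp_radial S h) ((Lp.memLp f).restrict (Set.Ioi (0 : ℝ))) (radial_radialLift S hh)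

/-- An invariant element depends only on the module; extending its radial part by zero to the
negative half-line and adding the reflection gives `f`. -/
theorem exists_even_radialLift (h : L2Xinv S) :
    ∃ f ∈ evenSub, radialLift S f = h := by
  have h0 : MemLp ((Set.Ioi (0 : ℝ)).indicator (radial S h)) 2 volume :=
    (memLp_indicator_iff_restrict measurableSet_Ioi).2 (memLp_radial S h)
  let g : L2R := h0.toLp
  have hrr : refl (refl g) = g := by
    refine Lp.ext ?_
    filter_upwards [refl_ae (refl g),
      (Measure.measurePreserving_neg volume).quasiMeasurePreserving.ae (refl_ae g)] with x h1 h2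
    rw [h1, h2, neg_neg]
  refine ⟨g + refl g, mem_evenSub_iff.2 (by rw [map_add, hrr, add_comm]), Lp.ext ?_⟩
  have hg := h0.coeFn_toLp
  have h1 : ∀ᵐ u : ℝ, 0 < u → (g + refl g : L2R) u = radial S h u := by
    filter_upwards [Lp.coeFn_add g (refl g), refl_ae g, hg,
      (Measure.measurePreserving_neg volume).quasiMeasurePreserving.ae hg] with u h2 h3 h4 h5 hu
    rw [h2, Pi.add_apply, h3, h4, h5, Set.indicator_of_mem (show u ∈ Set.Ioi (0 : ℝ) from hu),
      Set.indicator_of_notMem (by simp [hu.le]), add_zero]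
  filter_upwards [radialLift_ae S (g + refl g), (quasiMeasurePreserving_modX_volume S).ae h1,
    (quasiMeasurePreserving_modX S).ae (ae_restrict_mem measurableSet_Ioi), ae_eq_radial S h]
    with X h2 h3 h4 h5
  rw [h2, h3 h4, h5]

theorem ae_of_ae_Ioi {P : ℝ → Prop} (h : ∀ᵐ u ∂(volume.restrict (Set.Ioi (0 : ℝ))), P u)
    (h' : ∀ᵐ u : ℝ, P (-u) → P u) : ∀ᵐ u : ℝ, P u := by
  rw [ae_restrict_iff' measurableSet_Ioi] at h
  filter_upwards [h, (Measure.measurePreserving_neg volume).quasiMeasurePreserving.ae h, h',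
    Measure.ae_ne volume (0 : ℝ)] with u h1 h2 h3 h4
  rcases lt_or_gt_of_ne h4 with h5 | h5
  · exact h3 (h2 (neg_pos.2 h5))
  · exact h1 h5

theorem radialLift_mem_vanishX {lam : ℝ} {f : L2R} (hf : f ∈ evenSub) :
    radialLift S f ∈ vanishX S lam ↔ f ∈ vanSub lam := by
  rw [mem_vanSub]
  constructor
  · intro h
    have h1 : ∀ᵐ u ∂(volume.restrict (Set.Ioi (0 : ℝ))), |u| < lam → f u = 0 := by
      rw [ae_restrict_iff' measurableSet_Ioi]
      have h2 : ∀ᵐ u ∂(volume.restrict (Set.Ioi (0 : ℝ))), u < lam → f u = 0 := by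
        refine ae_of_ae_modX (S := S) (P := fun u => u < lam → f u = 0) ?_
        filter_upwards [h, radialLift_ae S f] with X h3 h4 h5
        rw [← h4, h3 h5]
      rw [ae_restrict_iff' measurableSet_Ioi] at h2
      filter_upwards [h2] with u h3 h4 h5
      exact h3 h4 ((le_abs_self u).trans_lt h5)
    refine ae_of_ae_Ioi h1 ?_
    filter_upwards [mem_evenSub.1 hf] with u h2 h3
    rwa [abs_neg, h2] at h3
  · intro h
    filter_upwards [radialLift_ae S f, (quasiMeasurePreserving_modX_volume S).ae h,
      (quasiMeasurePreserving_modX S).ae (ae_restrict_mem measurableSet_Ioi)] with X h1 h2 h3 h4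
    rw [h1, h2 (by rwa [abs_of_pos h3])]

end

section
variable (S : Finset Nat.Primes)

/-! ### The operator `θ_S` on `L²(ℝ)` -/

/-- The invertible operator of `L²(ℝ)` given by `thetaFun`. -/
def thetaEquiv : L2R ≃L[ℂ] L2R := (exists_thetaEquiv S).choose

theorem thetaEquiv_ae (f : L2R) : thetaEquiv S f =ᵐ[volume] thetaFun S f :=
  (exists_thetaEquiv S).choose_spec.1 f

theorem thetaEquiv_mem_evenSub {f : L2R} : thetaEquiv S f ∈ evenSub ↔ f ∈ evenSub :=
  ((exists_thetaEquiv S).choose_spec.2.1 f).symm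

theorem thetaEquiv_mem_vanSub {lam : ℝ} {f : L2R} :
    thetaEquiv S f ∈ vanSub lam ↔ f ∈ vanSub lam :=
  ((exists_thetaEquiv S).choose_spec.2.2.1 lam f).symm

theorem thetaEquiv_mellin {f : L2R} {z : ℂ} (h : IntegrableOn (mellinKer f z) (Set.Ioi 0)) :
    IntegrableOn (mellinKer (thetaEquiv S f) z) (Set.Ioi 0) ∧
      ∫ t in Set.Ioi (0 : ℝ), mellinKer (thetaEquiv S f) z t
        = (∏ p ∈ S, (1 - ((p : ℕ) : ℂ) ^ (-z))) * ∫ t in Set.Ioi (0 : ℝ), mellinKer f z t :=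
  (exists_thetaEquiv S).choose_spec.2.2.2 f z h

/-- The projection of `L²(ℝ)` onto the even functions. -/
def evenPart : L2R →L[ℂ] L2R :=
  (1 / 2 : ℂ) • (ContinuousLinearMap.id ℂ L2R + refl.toContinuousLinearMap)

theorem evenPart_of_mem {f : L2R} (hf : f ∈ evenSub) : evenPart f = f := by
  change (1 / 2 : ℂ) • (f + refl f) = f
  rw [mem_evenSub_iff.1 hf, ← two_smul ℂ f, smul_smul]
  norm_num

theorem evenPart_ae {F : ℝ → ℂ} {f : L2R} (h : F =ᵐ[volume] f) :
    evenPart f =ᵐ[volume] fun u => (1 / 2 : ℂ) * (F u + F (-u)) := by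
  change ((1 / 2 : ℂ) • (f + refl f) : L2R) =ᵐ[volume] _
  filter_upwards [Lp.coeFn_smul (1 / 2 : ℂ) (f + refl f), Lp.coeFn_add f (refl f), refl_ae f, h,
    (Measure.measurePreserving_neg volume).quasiMeasurePreserving.ae h] with u h1 h2 h3 h4 h5
  rw [h1, Pi.smul_apply, h2, Pi.add_apply, h3, h4, h5, smul_eq_mul]

theorem thetaFun_congr {f g : ℝ → ℂ} (h : f =ᵐ[volume] g) :
    thetaFun S f =ᵐ[volume] thetaFun S g := by
  have h1 : ∀ T : Finset Nat.Primes, ∀ᵐ u : ℝ,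
      f (u / ∏ p ∈ T, ((p : ℕ) : ℝ)) = g (u / ∏ p ∈ T, ((p : ℕ) : ℝ)) := fun T =>
    (quasiMeasurePreserving_div
      (Finset.prod_pos fun (p : Nat.Primes) _ => (by exact_mod_cast p.2.pos : (0 : ℝ) < ((p : ℕ) : ℝ)))).ae h
  filter_upwards [ae_all_iff.2 h1] with u hu
  exact Finset.sum_congr rfl fun T _ => by rw [hu T]

/-- The operator `θ_S` on `L²(ℝ)`. -/
def thetaL2 : L2R →L[ℂ] L2X S :=
  (radialLift S).comp ((thetaEquiv S : L2R →L[ℂ] L2R).comp evenPart)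

theorem thetaL2_of_mem {f : L2R} (hf : f ∈ evenSub) :
    thetaL2 S f = radialLift S (thetaEquiv S f) := by
  change radialLift S (thetaEquiv S (evenPart f)) = _
  rw [evenPart_of_mem hf]

theorem theta_ae {F : ℝ → ℂ} {f : L2R} (h : F =ᵐ[volume] f) :
    theta S F =ᵐ[muX S] thetaL2 S f := by
  have h1 := (thetaEquiv_ae S (evenPart f)).trans (thetaFun_congr S (evenPart_ae h))
  filter_upwards [ae_exists_proj S, radialLift_ae S (thetaEquiv S (evenPart f)),
    (quasiMeasurePreserving_modX_volume S).ae h1] with X h2 h3 h4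
  obtain ⟨x, hx, rfl, h5⟩ := h2
  rw [theta_proj S F hx, ← h5, ← h4, ← h3]
  rfl

theorem isBruhatSchwartz_sigmaFin (f : 𝓢(ℝ, ℂ)) :
    IsBruhatSchwartz S fun x => sigmaFin S x.1 * f x.2 :=
  ⟨sigmaFin S, f, isLocallyConstant_sigmaFin S, hasCompactSupport_sigmaFin S, rfl⟩

theorem theta_schwartz_ae (f : 𝓢(ℝ, ℂ)) : theta S f =ᵐ[muX S] thetaL2 S (f.toLp 2) :=
  theta_ae S (f.coeFn_toLp 2 volume).symm

theorem l2_induction {P : L2R → Prop} (hc : IsClosed {f | P f})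
    (h : ∀ f : 𝓢(ℝ, ℂ), P (f.toLp 2)) (f : L2R) : P f :=
  DenseRange.induction_on (p := P)
    (SchwartzMap.denseRange_toLpCLM (E := ℝ) (F := ℂ) (p := 2) (μ := volume) ENNReal.ofNat_ne_top)
    f hc h

theorem continuous_fourier_L2 : Continuous fun f : L2R => (𝓕 f : L2R) :=
  (Lp.fourierTransformₗᵢ ℝ ℂ).continuous

/-- For Schwartz `f` the pair is among the generators, since `σ` is self-dual. The general case
follows by density, the graph being closed and the operators continuous. -/
theorem thetaL2_fourier_mem_fourierGraph (f : L2R) :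
    (thetaL2 S f, thetaL2 S (𝓕 f)) ∈ fourierGraph S := by
  refine l2_induction (P := fun f => (thetaL2 S f, thetaL2 S (𝓕 f)) ∈ fourierGraph S) ?_
    (fun f => ?_) f
  · refine (Submodule.isClosed_topologicalClosure _).preimage ?_
    exact (thetaL2 S).continuous.prodMk ((thetaL2 S).continuous.comp continuous_fourier_L2)
  · refine Submodule.le_topologicalClosure _ (Submodule.subset_span
      ⟨_, isBruhatSchwartz_sigmaFin S f, (theta_schwartz_ae S f).symm, ?_⟩)
    rw [funext (adeleFourier_sigmaFin_mul f), SchwartzMap.toLp_fourier_eq]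
    exact (theta_schwartz_ae S (𝓕 f)).symm

/-- The bilinear pairing `(f, g) ↦ ∫ f g` on `L²(X_S)`. -/
def pairX : L2X S →L[ℂ] L2X S →L[ℂ] ℂ :=
  (ContinuousLinearMap.mul ℂ ℂ).lpPairing (muX S) 2 2

theorem pairX_apply (f g : L2X S) : pairX S f g = ∫ X, f X * g X ∂(muX S) :=
  ContinuousLinearMap.lpPairing_eq_integral _ f g

theorem pairX_eq {f g : L2X S} {F G : XS S → ℂ} (hF : f =ᵐ[muX S] F) (hG : g =ᵐ[muX S] G) :
    pairX S f g = ∫ x in fundDom S, F (proj S x) * G (proj S x) ∂(adeleHaar S) := by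
  rw [pairX_apply]
  refine (integral_map (measurable_proj S).aemeasurable
    ((Lp.aestronglyMeasurable f).mul (Lp.aestronglyMeasurable g))).trans ?_
  refine integral_congr_ae ?_
  filter_upwards [ae_of_ae_map (measurable_proj S).aemeasurable hF,
    ae_of_ae_map (measurable_proj S).aemeasurable hG] with x h1 h2
  exact congrArg₂ (· * ·) h1 h2

theorem pairX_of_mem_fourierGraph {a b : L2X S}
    (h : ∀ (φ : Adele S → ℂ) (Q : L2X S × L2X S), IsBruhatSchwartz S φ →
      Q.1 =ᵐ[muX S] classX S φ → Q.2 =ᵐ[muX S] classX S (adeleFourier S φ) →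
      pairX S Q.2 a = pairX S Q.1 b) {P : L2X S × L2X S} (hP : P ∈ fourierGraph S) :
    pairX S P.2 a = pairX S P.1 b := by
  let V : Submodule ℂ (L2X S × L2X S) :=
    { carrier := {Q | pairX S Q.2 a = pairX S Q.1 b}
      zero_mem' := by
        change pairX S 0 a = pairX S 0 b
        simp
      add_mem' := by
        intro Q R (hQ : pairX S Q.2 a = pairX S Q.1 b) (hR : pairX S R.2 a = pairX S R.1 b)
        change pairX S (Q.2 + R.2) a = pairX S (Q.1 + R.1) b
        rw [map_add, map_add, add_apply, add_apply, hQ, hR]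
      smul_mem' := by
        intro c Q (hQ : pairX S Q.2 a = pairX S Q.1 b)
        change pairX S (c • Q.2) a = pairX S (c • Q.1) b
        rw [map_smul, map_smul, smul_apply, smul_apply, hQ] }
  have hV : IsClosed (V : Set (L2X S × L2X S)) := by
    refine isClosed_eq ?_ ?_
    · exact (((pairX S).continuous.comp continuous_snd).clm_apply continuous_const)
    · exact (((pairX S).continuous.comp continuous_fst).clm_apply continuous_const)
  have hle : fourierGraph S ≤ V := by
    refine Submodule.topologicalClosure_minimal _ (Submodule.span_le.2 ?_) hV
    rintro Q ⟨φ, hφ, h1, h2⟩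
    exact h φ Q hφ h1 h2
  exact hle hP

/-- Parseval's formula for the elements of the graph of `𝔽_S` and the classes `θ_S (f)`. -/
theorem pairX_thetaL2 {P : L2X S × L2X S} (hP : P ∈ fourierGraph S) (f : L2R) :
    pairX S P.2 (thetaL2 S f) = pairX S P.1 (thetaL2 S (𝓕 f)) := by
  refine l2_induction
    (P := fun f => pairX S P.2 (thetaL2 S f) = pairX S P.1 (thetaL2 S (𝓕 f))) ?_ (fun f => ?_) f
  · exact isClosed_eq ((pairX S P.2).continuous.comp (thetaL2 S).continuous)
      ((pairX S P.1).continuous.comp ((thetaL2 S).continuous.comp continuous_fourier_L2))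
  · refine pairX_of_mem_fourierGraph S (fun φ Q hφ h1 h2 => ?_) hP
    rw [SchwartzMap.toLp_fourier_eq]
    exact (pairX_eq S h2 (theta_schwartz_ae S f).symm).trans
      ((integral_classX_adeleFourier_mul_theta hφ f).trans
        (pairX_eq S h1 (theta_schwartz_ae S (𝓕 f)).symm).symm)

/-! ### Comparison of the real and semilocal Sonin spaces -/

theorem fourier_mem_evenSub {f : L2R} (hf : f ∈ evenSub) : (𝓕 f : L2R) ∈ evenSub := by
  have h : ∀ f : L2R, refl (𝓕 f) = 𝓕 (refl f) := by
    refine l2_induction (isClosed_eq (refl.continuous.comp continuous_fourier_L2)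
      (continuous_fourier_L2.comp refl.continuous)) fun f => ?_
    let g : 𝓢(ℝ, ℂ) := SchwartzMap.compCLMOfContinuousLinearEquiv ℝ (ContinuousLinearEquiv.neg ℝ) f
    have hg : ∀ x, g x = f (-x) := fun x => rfl
    have h1 : refl (f.toLp 2) = g.toLp 2 := by
      refine Lp.ext ?_
      filter_upwards [refl_ae (f.toLp 2), g.coeFn_toLp 2 volume,
        (Measure.measurePreserving_neg volume).quasiMeasurePreserving.ae (f.coeFn_toLp 2 volume)]
        with x h1 h2 h3
      rw [h1, h2, h3, hg]
    rw [h1, SchwartzMap.toLp_fourier_eq, SchwartzMap.toLp_fourier_eq]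
    refine Lp.ext ?_
    filter_upwards [refl_ae ((𝓕 f).toLp 2), (𝓕 g).coeFn_toLp 2 volume,
      (Measure.measurePreserving_neg volume).quasiMeasurePreserving.ae
        ((𝓕 f).coeFn_toLp 2 volume)] with x h1 h2 h3
    rw [h1, h2, h3, SchwartzMap.fourier_coe, SchwartzMap.fourier_coe,
      ← Real.fourierInv_eq_fourier_neg, Real.fourierInv_eq_fourier_comp_neg]
    rfl
  rw [mem_evenSub_iff, h, mem_evenSub_iff.1 hf]

/-- If some element of the graph of `𝔽_S` over `θ_S (f)` vanishes on `|x|_S < λ`, then the Fourier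
transform of `f` vanishes on `|x| < λ`. -/
theorem fourier_mem_vanSub {lam : ℝ} {f : L2R} (hf : f ∈ evenSub) {g : L2X S}
    (hg : (thetaL2 S f, g) ∈ fourierGraph S) (hv : g ∈ vanishX S lam) :
    (𝓕 f : L2R) ∈ vanSub lam := by
  have hFe := fourier_mem_evenSub hf
  set k : L2R := thetaEquiv S (𝓕 f) with hk
  have hke : k ∈ evenSub := (thetaEquiv_mem_evenSub S).2 hFe
  -- The test function is the conjugate of `k` cut off to `|u| < λ`. Being even, it is of the form
  -- `thetaEquiv S b` with `b` even, so Parseval can be applied to it.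
  have hm : MemLp ({u : ℝ | |u| < lam}.indicator fun u => (starRingEnd ℂ) (k u)) 2 volume :=
    (Lp.memLp k).star.indicator (measurableSet_abs_lt lam)
  let w : L2R := hm.toLp
  have hw := hm.coeFn_toLp
  have hwe : w ∈ evenSub := by
    rw [mem_evenSub]
    filter_upwards [hw, (Measure.measurePreserving_neg volume).quasiMeasurePreserving.ae hw,
      mem_evenSub.1 hke] with u h1 h2 h3
    rw [h1, h2]
    simp only [Set.indicator_apply, Set.mem_ofPred_eq, abs_neg, h3]
  let b : L2R := (thetaEquiv S).symm w
  have hbe : b ∈ evenSub := by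
    rw [← thetaEquiv_mem_evenSub S, ContinuousLinearEquiv.apply_symm_apply]
    exact hwe
  have hb : thetaL2 S b = radialLift S w := by
    rw [thetaL2_of_mem S hbe, ContinuousLinearEquiv.apply_symm_apply]
  have hkl : thetaL2 S (𝓕 f) = radialLift S k := thetaL2_of_mem S hFe
  -- Both `g` and `θ_S(𝓕 f)` are related to `θ_S(f)`, so they have the same pairing with `θ_S(b)`.
  -- The first pairing vanishes because `g` does on `|x|_S < λ`; the second is the squared norm of
  -- the cut-off.
  have h1 := pairX_thetaL2 S hg b
  have h2 := pairX_thetaL2 S (thetaL2_fourier_mem_fourierGraph S f) b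
  simp only at h1 h2
  rw [← h2, hb, hkl, pairX_apply, pairX_apply] at h1
  have hRw : radialLift S w =ᵐ[muX S] fun X =>
      {u : ℝ | |u| < lam}.indicator (fun u => (starRingEnd ℂ) (k u)) (modX S X) :=
    (radialLift_ae S w).trans ((quasiMeasurePreserving_modX_volume S).ae hw)
  have hpos : ∀ᵐ X ∂(muX S), 0 < modX S X :=
    (quasiMeasurePreserving_modX S).ae (ae_restrict_mem measurableSet_Ioi)
  have h3 : ∫ X, g X * radialLift S w X ∂(muX S) = 0 := by
    refine integral_eq_zero_of_ae ?_
    filter_upwards [hv, hRw, hpos] with X h4 h5 h6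
    rw [h5, Pi.zero_apply]
    by_cases h7 : modX S X < lam
    · rw [h4 h7, zero_mul]
    · rw [Set.indicator_of_notMem (by simpa [abs_of_pos h6] using h7), mul_zero]
  rw [h3] at h1
  have h4 : ∫ X, radialLift S k X * radialLift S w X ∂(muX S)
      = ((∫ X, ‖radialLift S w X‖ ^ 2 ∂(muX S) : ℝ) : ℂ) := by
    rw [← integral_complex_ofReal]
    refine integral_congr_ae ?_
    filter_upwards [hRw, radialLift_ae S k] with X h5 h6
    rw [h5, h6]
    by_cases h7 : modX S X ∈ {u : ℝ | |u| < lam}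
    · rw [Set.indicator_of_mem h7, RCLike.norm_conj, Complex.mul_conj, Complex.normSq_eq_norm_sq]
    · rw [Set.indicator_of_notMem h7]
      simp
  have h5 : ‖radialLift S w‖ ^ 2 = 0 := by
    have h6 := norm_toLp_sq (Lp.memLp (radialLift S w))
    rw [Lp.toLp_coeFn] at h6
    rw [h6]
    exact_mod_cast (h1.trans h4).symm
  rw [norm_radialLift_sq S hwe] at h5
  have h6 : (unitsVol S).toReal / 2 ≠ 0 :=
    div_ne_zero (ENNReal.toReal_ne_zero.2 ⟨unitsVol_ne_zero S, unitsVol_ne_top S⟩) two_ne_zero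
  have h7 : w = 0 := norm_eq_zero.1 (pow_eq_zero_iff two_ne_zero |>.1
    ((mul_eq_zero.1 h5).resolve_left h6))
  rw [← thetaEquiv_mem_vanSub S, mem_vanSub]
  rw [show hm.toLp = 0 from h7] at hw
  filter_upwards [hw, Lp.coeFn_zero ℂ 2 (volume : Measure ℝ)] with u h8 h9 h10
  rw [h9, Set.indicator_of_mem (show u ∈ {u : ℝ | |u| < lam} from h10)] at h8
  exact (map_eq_zero (starRingEnd ℂ)).1 h8.symm

/-- Invertibility of `θ_S` on even functions provides `f` and its vanishing near `0`. The vanishing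
of `𝓕 f` needs the duality argument, as nothing says beforehand that `g` is `θ_S(𝓕 f)`. -/
theorem exists_soninR_of_soninX {lam : ℝ} {h : L2Xinv S} (hh : h ∈ soninX S lam) :
    ∃ f ∈ soninR lam, thetaL2 S f = h := by
  obtain ⟨h1, g, h2, h3⟩ := hh
  obtain ⟨k, hke, hk⟩ := exists_even_radialLift S h
  let f : L2R := (thetaEquiv S).symm k
  have hfk : thetaEquiv S f = k := ContinuousLinearEquiv.apply_symm_apply _ _
  have hfe : f ∈ evenSub := by
    rw [← thetaEquiv_mem_evenSub S, hfk]
    exact hke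
  have hfh : thetaL2 S f = h := by rw [thetaL2_of_mem S hfe, hfk, hk]
  refine ⟨f, mem_soninR.2 ⟨hfe, ?_, ?_⟩, hfh⟩
  · rw [← thetaEquiv_mem_vanSub S, hfk, ← radialLift_mem_vanishX S hke, hk]
    exact h1
  · exact fourier_mem_vanSub S hfe (by rw [hfh]; exact h2) h3

theorem thetaL2_mem_L2Xinv (f : L2R) : thetaL2 S f ∈ L2Xinv S := radialLift_mem S _

theorem thetaL2_mem_soninX {lam : ℝ} {f : L2R} (hf : f ∈ soninR lam) :
    (⟨thetaL2 S f, thetaL2_mem_L2Xinv S f⟩ : L2Xinv S) ∈ soninX S lam := by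
  obtain ⟨h1, h2, h3⟩ := mem_soninR.1 hf
  have h4 := fourier_mem_evenSub h1
  refine ⟨?_, thetaL2 S (𝓕 f), thetaL2_fourier_mem_fourierGraph S f, ?_⟩
  · change thetaL2 S f ∈ vanishX S lam
    rw [thetaL2_of_mem S h1, radialLift_mem_vanishX S ((thetaEquiv_mem_evenSub S).2 h1),
      thetaEquiv_mem_vanSub]
    exact h2
  · rw [thetaL2_of_mem S h4, radialLift_mem_vanishX S ((thetaEquiv_mem_evenSub S).2 h4),
      thetaEquiv_mem_vanSub]
    exact h3

end

section
variable (S : Finset Nat.Primes)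

/-! ### The dual Hardy–Titchmarsh transforms -/

theorem norm_betaS (f : L2R) : ‖betaS S f‖ = ‖f‖ := by
  have h : ‖betaS S f‖ ^ 2 = ‖f‖ ^ 2 := by
    have h1 := norm_toLp_sq (Lp.memLp f)
    rw [Lp.toLp_coeFn] at h1
    rw [betaS, norm_toLp_sq, h1, weight, integral_withDensity_eq_integral_toReal_smul
      (measurable_weight S) (Filter.Eventually.of_forall fun _ => ENNReal.ofReal_lt_top)]
    refine integral_congr_ae (Filter.Eventually.of_forall fun s => ?_)
    have hE := norm_ne_zero_iff.2 (ES_ne_zero S s)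
    simp only
    rw [ENNReal.toReal_ofReal (by positivity), norm_mul, smul_eq_mul, mul_pow,
      inv_mul_cancel_left₀ (pow_ne_zero 2 hE)]
  exact (sq_eq_sq₀ (norm_nonneg _) (norm_nonneg _)).1 h

/-- The product of the local factors `L_v (z)` for the places `v` in `S` and `∞`. -/
def eulerFactor (z : ℂ) : ℂ :=
  Complex.Gammaℝ z * ∏ p : S, (1 - (((p : Nat.Primes) : ℕ) : ℂ) ^ (-z))⁻¹

theorem one_sub_cpow_ne_zero (p : Nat.Primes) {z : ℂ} (hz : 0 < z.re) :
    1 - ((p : ℕ) : ℂ) ^ (-z) ≠ 0 := by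
  intro h
  have hp : 1 < (p : ℕ) := p.2.one_lt
  have h1 : ‖((p : ℕ) : ℂ) ^ (-z)‖ = 1 := by rw [← sub_eq_zero.1 h, norm_one]
  rw [Complex.norm_natCast_cpow_of_pos (by lia), Complex.neg_re] at h1
  exact (Real.rpow_lt_one_of_one_lt_of_neg (by exact_mod_cast hp) (neg_neg_of_pos hz)).ne h1

theorem continuousAt_eulerFactor {z : ℂ} (hz : 0 < z.re) : ContinuousAt (eulerFactor S) z := by
  have h1 : ContinuousAt (fun z : ℂ => Complex.Gammaℝ z) z := by
    have h := (Complex.differentiable_Gammaℝ_inv.continuous.continuousAt (x := z)).inv₀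
      (inv_ne_zero (Complex.Gammaℝ_ne_zero_of_re_pos hz))
    simpa only [Pi.inv_def, inv_inv] using h
  refine h1.mul ?_
  refine tendsto_finsetProd _ fun p _ => ?_
  refine ContinuousAt.inv₀ ?_ (one_sub_cpow_ne_zero p hz)
  have hp : (((p : Nat.Primes) : ℕ) : ℂ) ≠ 0 := by exact_mod_cast (p : Nat.Primes).2.ne_zero
  exact continuousAt_const.sub (continuousAt_id.neg.const_cpow (Or.inl hp))

/-- Stated for an arbitrary `S` so as to serve twice: with the empty set for `upsilonInf`, and with
`S` itself for `upsilon`. -/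
theorem critical_ae_betaS {lam : ℝ} (hlam : 0 < lam) {g : L2R} (hg : g ∈ vanSub lam)
    (hint : ∀ z : ℂ, 1 / 2 < z.re → IntegrableOn (mellinKer g z) (Set.Ioi 0)) {F : ℂ → ℂ}
    (hF : Differentiable ℂ F)
    (heq : ∀ z : ℂ, 1 / 2 < z.re →
      eulerFactor S z * ∫ t in Set.Ioi (0 : ℝ), mellinKer g z t = F z) :
    critical F =ᵐ[volume] betaS S (Uinf g) := by
  have h1 := critical_of_mellin hlam hg hint
    (fun s => continuousAt_eulerFactor S (by simp)) (fun s => hF.continuous.continuousAt) heq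
  filter_upwards [h1, (volume_abs_weight S).ae_eq (memLp_weight S (Uinf g)).coeFn_toLp]
    with s h2 h3
  rw [critical, ← h2]
  exact h3.symm

variable {S}

theorem integrable_mellinKer {lam : ℝ} (hlam : 0 < lam) {f : L2R} (hf : f ∈ soninR lam) (z : ℂ)
    (hz : 1 / 2 < z.re) : IntegrableOn (mellinKer f z) (Set.Ioi 0) :=
  integrable_checkM hlam hf hz

theorem critical_ae_upsilonInf {lam : ℝ} (hlam : 0 < lam) {f : L2R} (hf : f ∈ soninR lam)
    {F : ℂ → ℂ} (hF : IsCheckM f F) : critical F =ᵐ[volume] upsilonInf f := by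
  refine critical_ae_betaS ∅ hlam (mem_soninR.1 hf).2.1 (integrable_mellinKer hlam hf) hF.1
    fun z hz => ?_
  rw [hF.2 z hz, checkM, eulerFactor]
  simp [mellinKer]

/-- The factors `(1 - p^(-z))⁻¹` of `E_S` cancel those which `θ_S` introduces into the Mellin
transform, leaving the same entire function as for the real place alone. -/
theorem critical_ae_upsilon {lam : ℝ} (hlam : 0 < lam) {f : L2R} (hf : f ∈ soninR lam)
    {F : ℂ → ℂ} (hF : IsCheckM f F) {h : L2Xinv S} (hh : (h : L2X S) = thetaL2 S f) :
    critical F =ᵐ[volume] upsilon S h := by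
  obtain ⟨h1, h2, -⟩ := mem_soninR.1 hf
  rw [thetaL2_of_mem S h1] at hh
  rw [upsilon, USmap_radialLift S hh]
  have hm := fun z (hz : (1 / 2 : ℝ) < z.re) =>
    thetaEquiv_mellin S (integrable_mellinKer hlam hf z hz)
  refine critical_ae_betaS S hlam ((thetaEquiv_mem_vanSub S).2 h2) (fun z hz => (hm z hz).1) hF.1
    fun z hz => ?_
  have hz0 : 0 < z.re := one_half_pos.trans hz
  rw [(hm z hz).2, hF.2 z hz, checkM, eulerFactor,
    Finset.prod_coe_sort S fun p : Nat.Primes => (1 - ((p : ℕ) : ℂ) ^ (-z))⁻¹,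
    mul_assoc, ← mul_assoc (∏ p ∈ S, _) (∏ p ∈ S, _), ← Finset.prod_mul_distrib,
    Finset.prod_congr rfl fun p _ => inv_mul_cancel₀ (one_sub_cpow_ne_zero p hz0),
    Finset.prod_const_one, one_mul]
  rfl

/-! ### The map `f ↦ M̌ (f)` -/

theorem IsCheckM.unique {f : ℝ → ℂ} {F G : ℂ → ℂ} (hF : IsCheckM f F) (hG : IsCheckM f G) :
    F = G := by
  have h : F =ᶠ[𝓝 (1 : ℂ)] G := by
    have ho : IsOpen {z : ℂ | 1 / 2 < z.re} := isOpen_lt continuous_const Complex.continuous_re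
    filter_upwards [ho.mem_nhds (show (1 : ℂ) ∈ {z : ℂ | 1 / 2 < z.re} by norm_num)] with z hz
    rw [hF.2 z hz, hG.2 z hz]
  have hA : ∀ {F : ℂ → ℂ}, Differentiable ℂ F → AnalyticOnNhd ℂ F Set.univ :=
    fun h z _ => h.analyticAt z
  exact (hA hF.1).eq_of_eventuallyEq (hA hG.1) h

theorem IsCheckM.add {lam : ℝ} (hlam : 0 < lam) {f g : L2R} (hf : f ∈ soninR lam)
    (hg : g ∈ soninR lam) {F G : ℂ → ℂ} (hF : IsCheckM f F) (hG : IsCheckM g G) :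
    IsCheckM (f + g : L2R) (F + G) := by
  refine ⟨hF.1.add hG.1, fun z hz => ?_⟩
  rw [Pi.add_apply, hF.2 z hz, hG.2 z hz, checkM, checkM, checkM, ← mul_add,
    ← integral_add (integrable_checkM hlam hf hz) (integrable_checkM hlam hg hz)]
  congr 1
  apply integral_congr_ae
  filter_upwards [ae_restrict_of_ae (Lp.coeFn_add f g)] with t ht
  simp only [ht, Pi.add_apply]
  ring

theorem IsCheckM.smul {f : L2R} (c : ℂ) {F : ℂ → ℂ} (hF : IsCheckM f F) :
    IsCheckM (c • f : L2R) (c • F) := by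
  refine ⟨hF.1.const_smul c, fun z hz => ?_⟩
  rw [Pi.smul_apply, smul_eq_mul, hF.2 z hz, checkM, checkM, mul_left_comm, ← integral_const_mul]
  congr 1
  apply integral_congr_ae
  filter_upwards [ae_restrict_of_ae (Lp.coeFn_smul c f)] with t ht
  simp only [ht, Pi.smul_apply, smul_eq_mul]
  ring

theorem weight_ac : weight S ≪ (volume : Measure ℝ) := withDensity_absolutelyContinuous _ _

theorem memLp_critical {lam : ℝ} (hlam : 0 < lam) {f : L2R} (hf : f ∈ soninR lam)
    {F : ℂ → ℂ} (hF : IsCheckM f F) : MemLp (critical F) 2 (weight ∅) :=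
  (memLp_congr_ae (weight_ac.ae_eq (critical_ae_upsilonInf hlam hf hF))).2 (Lp.memLp _)

/-- The element `M̌ (f)` of `EntireL2`. -/
def checkEntire {lam : ℝ} (hlam : 0 < lam) (f : soninR lam) : EntireL2 :=
  ⟨fun z => mellin (thetaInt (f : L2R)) (z / 2), (exists_isCheckM hlam f.2).1,
    memLp_critical hlam f.2 (exists_isCheckM hlam f.2)⟩

theorem isCheckM_checkEntire {lam : ℝ} (hlam : 0 < lam) (f : soninR lam) :
    IsCheckM (f : L2R) (checkEntire hlam f).fn := exists_isCheckM hlam f.2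

theorem checkEntire_eq {lam : ℝ} (hlam : 0 < lam) {f : soninR lam} {F : EntireL2}
    (hF : IsCheckM (f : L2R) F.fn) : checkEntire hlam f = F :=
  Subtype.ext ((isCheckM_checkEntire hlam f).unique hF)

/-- Multiplication by `E_∞` is isometric into the weighted space, so only the Plancherel constant
remains: `2π`, halved because `f` is even. -/
theorem norm_checkEntire_sq {lam : ℝ} (hlam : 0 < lam) (f : soninR lam) :
    ‖checkEntire hlam f‖ ^ 2 = Real.pi * ‖f‖ ^ 2 := by
  have h1 : entireToLp (checkEntire hlam f) = upsilonInf (f : L2R) := by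
    refine Lp.ext ?_
    exact (memLp_critical hlam f.2 (exists_isCheckM hlam f.2)).coeFn_toLp.trans
      (weight_ac.ae_eq (critical_ae_upsilonInf hlam f.2 (exists_isCheckM hlam f.2)))
  change ‖entireToLp (checkEntire hlam f)‖ ^ 2 = _
  rw [h1, upsilonInf, norm_betaS, norm_Uinf_sq (mem_soninR.1 f.2).1]
  rfl

/-- The linear map `f ↦ M̌ (f)` from `𝐒_λ(ℝ, e_∞)` to `ℬ_λ`. -/
def checkLin {lam : ℝ} (hlam : 0 < lam) : soninR lam →ₗ[ℂ] spaceB lam hlam where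
  toFun f := ⟨checkEntire hlam f, f, f.2, isCheckM_checkEntire hlam f⟩
  map_add' f g := Subtype.ext (checkEntire_eq hlam
    (IsCheckM.add hlam f.2 g.2 (isCheckM_checkEntire hlam f) (isCheckM_checkEntire hlam g)))
  map_smul' c f := Subtype.ext (checkEntire_eq hlam ((isCheckM_checkEntire hlam f).smul c))

theorem norm_checkLin {lam : ℝ} (hlam : 0 < lam) (f : soninR lam) :
    ‖checkLin hlam f‖ = Real.pi ^ (1 / 2 : ℝ) * ‖f‖ := by
  refine (sq_eq_sq₀ (norm_nonneg _) (by positivity)).1 ?_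
  rw [mul_pow, ← Real.sqrt_eq_rpow, Real.sq_sqrt Real.pi_pos.le]
  exact norm_checkEntire_sq hlam f

theorem bijective_of_norm_bound {E F : Type*} [NormedAddCommGroup E] [NormedSpace ℂ E]
    [NormedAddCommGroup F] [NormedSpace ℂ F] (T : E →ₗ[ℂ] F) {C : ℝ}
    (hC : ∀ x, ‖x‖ ≤ C * ‖T x‖) (hs : Function.Surjective T) : Function.Bijective T := by
  refine ⟨(injective_iff_map_eq_zero T).2 fun x hx => ?_, hs⟩
  have h := hC x
  rw [hx, norm_zero, mul_zero] at h
  exact norm_le_zero_iff.1 h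

/-- A linear surjection bounded above and below, as a linear homeomorphism. -/
def equivOfBounds {E F : Type*} [NormedAddCommGroup E] [NormedSpace ℂ E]
    [NormedAddCommGroup F] [NormedSpace ℂ F] (T : E →ₗ[ℂ] F) (B C : ℝ)
    (hB : ∀ x, ‖T x‖ ≤ B * ‖x‖) (hC : ∀ x, ‖x‖ ≤ C * ‖T x‖) (hs : Function.Surjective T) :
    E ≃L[ℂ] F :=
  (LinearEquiv.ofBijective T (bijective_of_norm_bound T hC hs)).toContinuousLinearEquivOfBounds B C
    hB fun y => by
      have h := hC ((LinearEquiv.ofBijective T (bijective_of_norm_bound T hC hs)).symm y)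
      rwa [show T _ = y from LinearEquiv.apply_symm_apply
        (LinearEquiv.ofBijective T (bijective_of_norm_bound T hC hs)) y] at h

/-- The isomorphism `f ↦ M̌ (f)` from `𝐒_λ(ℝ, e_∞)` onto `ℬ_λ`. -/
def checkEquiv {lam : ℝ} (hlam : 0 < lam) : soninR lam ≃L[ℂ] spaceB lam hlam :=
  equivOfBounds (checkLin hlam) (Real.pi ^ (1 / 2 : ℝ)) (Real.pi ^ (1 / 2 : ℝ))⁻¹
    (fun f => (norm_checkLin hlam f).le)
    (fun f => by rw [norm_checkLin, inv_mul_cancel_left₀ (by positivity)])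
    fun F => by
      obtain ⟨f, hf, hF⟩ := F.2
      exact ⟨⟨f, hf⟩, Subtype.ext (checkEntire_eq hlam hF)⟩

theorem completeSpace_spaceB {lam : ℝ} (hlam : 0 < lam) : CompleteSpace (spaceB lam hlam) := by
  have h : CompleteSpace (soninR lam) := (isClosed_soninR lam).completeSpace_coe
  exact (completeSpace_congr (e := (checkEquiv hlam).toEquiv)
    (checkEquiv hlam).isUniformEmbedding).1 h

variable (S) in
/-- The linear map `θ_S` from `𝐒_λ(ℝ, e_∞)` to `𝐒_λ(X_S, α)`. -/
def thetaLin (lam : ℝ) : soninR lam →ₗ[ℂ] soninX S lam where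
  toFun f := ⟨⟨thetaL2 S f, thetaL2_mem_L2Xinv S f⟩, thetaL2_mem_soninX S f.2⟩
  map_add' f g := Subtype.ext (Subtype.ext (map_add (thetaL2 S) (f : L2R) g))
  map_smul' c f := Subtype.ext (Subtype.ext (map_smul (thetaL2 S) c (f : L2R)))

theorem norm_thetaLin_sq {lam : ℝ} (f : soninR lam) :
    ‖thetaLin S lam f‖ ^ 2 = (unitsVol S).toReal / 2 * ‖thetaEquiv S f‖ ^ 2 := by
  have h := (mem_soninR.1 f.2).1
  rw [← norm_radialLift_sq S ((thetaEquiv_mem_evenSub S).2 h), ← thetaL2_of_mem S h]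
  rfl

/-- On even functions `radialLift` is a multiple of an isometry with nonzero constant, so the lower
bound comes from the bounded inverse of `thetaEquiv`. -/
theorem norm_le_norm_thetaLin {lam : ℝ} (f : soninR lam) :
    ‖f‖ ≤ ‖((thetaEquiv S).symm : L2R →L[ℂ] L2R)‖ * (Real.sqrt ((unitsVol S).toReal / 2))⁻¹
      * ‖thetaLin S lam f‖ := by
  have hc : 0 < (unitsVol S).toReal / 2 :=
    half_pos (ENNReal.toReal_pos (unitsVol_ne_zero S) (unitsVol_ne_top S))
  have h1 : ‖thetaLin S lam f‖ = Real.sqrt ((unitsVol S).toReal / 2) * ‖thetaEquiv S f‖ := by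
    refine (sq_eq_sq₀ (norm_nonneg _) (by positivity)).1 ((norm_thetaLin_sq f).trans ?_)
    rw [mul_pow, Real.sq_sqrt hc.le]
  rw [h1, mul_assoc, inv_mul_cancel_left₀ (Real.sqrt_pos.2 hc).ne']
  have h2 := ((thetaEquiv S).symm : L2R →L[ℂ] L2R).le_opNorm (thetaEquiv S f)
  rwa [ContinuousLinearEquiv.coe_coe, ContinuousLinearEquiv.symm_apply_apply] at h2

theorem norm_thetaLin_le {lam : ℝ} (f : soninR lam) :
    ‖thetaLin S lam f‖ ≤ ‖thetaL2 S‖ * ‖f‖ := (thetaL2 S).le_opNorm f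

theorem thetaLin_surjective (lam : ℝ) : Function.Surjective (thetaLin S lam) := fun h => by
  obtain ⟨f, hf, hfh⟩ := exists_soninR_of_soninX S h.2
  exact ⟨⟨f, hf⟩, Subtype.ext (Subtype.ext hfh)⟩

variable (S) in
/-- The isomorphism `θ_S` from `𝐒_λ(ℝ, e_∞)` onto `𝐒_λ(X_S, α)`. -/
def thetaSonin (lam : ℝ) : soninR lam ≃L[ℂ] soninX S lam :=
  equivOfBounds (E := soninR lam) (F := soninX S lam) (thetaLin S lam) _ _ norm_thetaLin_le
    norm_le_norm_thetaLin (thetaLin_surjective lam)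

end

end Semilocal

end

/-! ### The isomorphism of the semilocal Sonin space with the space of entire functions -/

open Semilocal in
theorem mainTheorem6 (S : Finset Nat.Primes) (lam : ℝ) (hlam : 0 < lam) :
    CompleteSpace (spaceB lam hlam) ∧
    ∃ Φ : soninX S lam ≃L[ℂ] spaceB lam hlam,
      (∀ h : soninX S lam,
        critical ((Φ h : spaceB lam hlam) : EntireL2).fn
          =ᵐ[MeasureTheory.volume] (upsilon S (h : L2Xinv S) : ℝ → ℂ)) ∧
      ∀ f ∈ soninR lam,
        ∃ (hmem : MeasureTheory.MemLp (theta S f) 2 (muX S))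
          (hinv : hmem.toLp ∈ L2Xinv S)
          (hson : (⟨hmem.toLp, hinv⟩ : L2Xinv S) ∈ soninX S lam),
          (upsilon S ⟨hmem.toLp, hinv⟩ : ℝ → ℂ)
            =ᵐ[MeasureTheory.volume] (upsilonInf f : ℝ → ℂ) ∧
          IsCheckM f ((Φ ⟨⟨hmem.toLp, hinv⟩, hson⟩ : spaceB lam hlam) : EntireL2).fn := by
  refine ⟨completeSpace_spaceB hlam, (thetaSonin S lam).symm.trans (checkEquiv hlam), ?_, ?_⟩
  · intro h
    obtain ⟨f, rfl⟩ := (thetaSonin S lam).surjective h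
    rw [ContinuousLinearEquiv.trans_apply, ContinuousLinearEquiv.symm_apply_apply]
    -- Every `h` is `θ_S(f)` for some `f` in the real Sonin space, and `Φ h` is then the entire
    -- continuation of `checkM f`.
    exact critical_ae_upsilon hlam f.2 (isCheckM_checkEntire hlam f) rfl
  · intro f hf
    have h1 : theta S f =ᵐ[muX S] thetaL2 S f := theta_ae S (Filter.EventuallyEq.refl _ _)
    have hmem : MemLp (theta S f) 2 (muX S) := (memLp_congr_ae h1).2 (Lp.memLp _)
    have h2 : hmem.toLp = thetaL2 S f := Lp.ext (hmem.coeFn_toLp.trans h1)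
    have hinv : hmem.toLp ∈ L2Xinv S := h2 ▸ thetaL2_mem_L2Xinv S f
    have h3 : (⟨hmem.toLp, hinv⟩ : L2Xinv S) = thetaSonin S lam ⟨f, hf⟩ := Subtype.ext h2
    have hson : (⟨hmem.toLp, hinv⟩ : L2Xinv S) ∈ soninX S lam := h3 ▸ Subtype.property _
    have h4 : (⟨⟨hmem.toLp, hinv⟩, hson⟩ : soninX S lam) = thetaSonin S lam ⟨f, hf⟩ :=
      Subtype.ext h3
    have hF := isCheckM_checkEntire hlam ⟨f, hf⟩
    refine ⟨hmem, hinv, hson, ?_, ?_⟩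
    · exact (critical_ae_upsilon hlam hf hF h2).symm.trans (critical_ae_upsilonInf hlam hf hF)
    · rw [h4, ContinuousLinearEquiv.trans_apply, ContinuousLinearEquiv.symm_apply_apply]
      exact hF
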